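/- Let $|a|<m$, $r_+=m+\sqrt{m^2-a^2}$, and consider the exterior $r>r_+$ of the Kerr metric $\bar g$ in Boyer–Lindquist coordinates $(t,r,\theta,\phi)$ (axis included), with $\Delta=r^2-2mr+a^2$, $\Sigma=r^2+a^2\cos^2\theta$, $\Pi=(r^2+a^2)^2-a^2\Delta\sin^2\theta$. Write $\bar g=e^{-2\gamma}(-N^2dt^2+q_{ab}dx^adx^b)+e^{2\gamma}(d\phi+\mathcal A_0dt)^2$, $x^a=(r,\theta)$, so that $e^{2\gamma}=\bar g(\partial_\phi,\partial_\phi)=\Pi\sin^2\theta/\Sigma$, $N=\sqrt\Delta\sin\theta$, $q=\Pi\sin^2\theta\,(dr^2/\Delta+d\theta^2)$, $\mathcal A_0=-2amr/\Pi$. Let $\mu=\sqrt{\det q}$ and let $\omega=2am(3\cos\theta-\cos^3\theta)+2a^3m\cos\theta\sin^4\theta/\Sigma$ be the twist potential, which satisfies $\partial_a\mathcal A_0+Ne^{-4\gamma}\epsilon_{ab}\mu q^{bc}\partial_c\omega=0$ with $\epsilon_{r\theta}=1$. Write $X\cdot Y=q^{ab}X_aY_b$ and $|X|^2=X\cdot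 X$. Let the phase space $X=\{(\lambda,v),(\eta,u)\}$ consist of functions that are smooth and compactly supported on the orbit space $\{r>r_+,\ 0\le\theta\le\pi\}$, with $\lambda=\eta=0$, $\partial_\theta\lambda=\partial_\theta\eta=0$ and $u=v=0$ on the axis $\theta\in\{0,\pi\}$; $(\lambda,v)$ and $(\eta,u)$ are canonical pairs. For $s\in[0,1]$ let $H^{Alt}_S(s)=\int \mathbf e_s\,dr\,d\theta$ with $$\begin{aligned}\mathbf e_s=\;&\tfrac12Ne^{2\gamma}\mu^{-1}(u^2+v^2)+\tfrac14N\mu e^{-2\gamma}\Big(|\partial\eta-4(1-s)\eta\,\partial\gamma|^2+|\partial\lambda-4s\lambda\,\partial\gamma|^2\\&+|\partial\eta+2s\lambda e^{-2\gamma}\partial\omega|^2+|\partial\lambda-2(1-s)\eta e^{-2\gamma}\partial\omega|^2\Big)\\&+2N\mu e^{-2\gamma}\big(|\partial\gamma|^2+\tfrac14e^{-4\gamma}|\partial\omega|^2\big)\big(s(1-2s)\lambda^2+(1-s)(2s-1)\eta^2\big),\end{aligned}$$ and let $J_S(s)$ be the vector density with $J^t=\mathbf e_s$ and $$J^a=-N^2q^{ab}\Big(u\big(\partial_b\eta-2(1-s)\eta\,\partial_b\gamma+s\lambda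 e^{-2\gamma}\partial_b\omega\big)+v\big(\partial_b\lambda-2s\lambda\,\partial_b\gamma-(1-s)\eta e^{-2\gamma}\partial_b\omega\big)\Big).$$ Then the following hold. (1) For every $s\in[0,1]$ and every point of $X$: the generalized Robinson identity $$\begin{aligned}\mathbf e_s=\;&\tfrac12Ne^{2\gamma}\mu^{-1}(u^2+v^2)+\tfrac12N\mu e^{-2\gamma}(|\partial\lambda|^2+|\partial\eta|^2)+sN\mu e^{-4\gamma}\lambda\,\partial\omega\cdot\partial\eta\\&-(1-s)N\mu e^{-4\gamma}\eta\,\partial\omega\cdot\partial\lambda-\partial_b\big(N\mu q^{ab}e^{-2\gamma}\partial_a\gamma\,(s\lambda^2+(1-s)\eta^2)\big)\end{aligned}$$ holds off the axis; $\mathbf e_s\ge0$ there and $\mathbf e_s$ is integrable; $H^{Alt}_S(s)\ge0$, with equality only at the zero point of $X$; and $H^{Alt}_S(s)$ has the variational derivatives $$D_u\cdot H=Ne^{2\gamma}\mu^{-1}u,\qquad D_v\cdot H=Ne^{2\gamma}\mu^{-1}v,$$ $$D_\lambda\cdot H=-\partial_b(Ne^{-2\gamma}\mu q^{ab}\partial_a\lambda)+N\mu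 e^{-4\gamma}\,\partial\omega\cdot\partial\eta,\qquad D_\eta\cdot H=-\partial_b(Ne^{-2\gamma}\mu q^{ab}\partial_a\eta)-N\mu e^{-4\gamma}\,\partial\omega\cdot\partial\lambda,$$ the same for all $s$, so that all members generate the same dynamics. (2) The Hamiltonians are in involution: $\{H^{Alt}_S(s),H^{Alt}_S(\tau)\}=0$ at every point of $X$, for all $s,\tau\in[0,1]$. (3) Let $A$ be a smooth one-form on the exterior with $\mathcal L_{\partial_\phi}A=0$ such that $F=dA$ solves Maxwell's equations and $F|_{t=0}$ is compactly supported in the exterior. Let $\mathfrak E^i=\sqrt{-\det\bar g}\,F^{ti}$. Then there is a smooth $\eta$ with $\mathfrak E^a=\epsilon^{ab}\partial_b\eta$ and $\eta=0$ on the axis, and for any such $\eta$ the quadruple $\lambda=A_\phi$, $v=-\mathfrak E^\phi$, $\eta$, $u=F_{r\theta}$ lies in $X$ at each time $t$. For every $s\in[0,1]$ it satisfies Hamilton's equations $\partial_t\lambda=D_v\cdot H$, $\partial_tv=-D_\lambda\cdot H$, $\partial_t\eta=D_u\cdot H$, $\partial_tu=-D_\eta\cdot H$ with $H=H^{Alt}_S(s)$;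 the density $J_S(s)$ is divergence-free, $\partial_tJ^t+\partial_aJ^a=0$ off the axis; and its flux $\int J^t\,dr\,d\theta$ through each hypersurface $t=\mathrm{const}$ is finite, nonnegative, and zero if and only if $F$ vanishes on that hypersurface. -/

import Mathlib

open Set MeasureTheory
open scoped ContDiff

noncomputable section

namespace KerrMaxwell

/-! ### The Kerr background

`a` is the rotation parameter and `m` the mass.  A point of the orbit space is a pair `p = (r, θ)`;
a point of a Boyer-Lindquist chart is `q = (t, r, θ, φ) : Fin 4 → ℝ`. -/

/-- The outer root `r₊` of `Δ`. -/
def rPlus (a m : ℝ) : ℝ := m + √(m ^ 2 - a ^ 2)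

/-- `Δ = r² - 2 m r + a²`. -/
def kDelta (a m : ℝ) (p : ℝ × ℝ) : ℝ := p.1 ^ 2 - 2 * m * p.1 + a ^ 2

/-- `Σ = r² + a² cos² θ`. -/
def kSigma (a : ℝ) (p : ℝ × ℝ) : ℝ := p.1 ^ 2 + a ^ 2 * Real.cos p.2 ^ 2

/-- `Π = (r² + a²)² - a² Δ sin² θ`. -/
def kPi (a m : ℝ) (p : ℝ × ℝ) : ℝ :=
  (p.1 ^ 2 + a ^ 2) ^ 2 - a ^ 2 * kDelta a m p * Real.sin p.2 ^ 2

/-- The Kerr metric in Boyer-Lindquist coordinates `(t, r, θ, φ)`, as a function of `(r, θ)`. -/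
def kerrMetric (a m : ℝ) (p : ℝ × ℝ) : Matrix (Fin 4) (Fin 4) ℝ :=
  let gtt := -((kDelta a m p - a ^ 2 * Real.sin p.2 ^ 2) / kSigma a p)
  let gtφ := -(a * Real.sin p.2 ^ 2 * (p.1 ^ 2 + a ^ 2 - kDelta a m p) / kSigma a p)
  let grr := kSigma a p / kDelta a m p
  let gθθ := kSigma a p
  let gφφ := ((p.1 ^ 2 + a ^ 2) ^ 2 - kDelta a m p * a ^ 2 * Real.sin p.2 ^ 2) / kSigma a p
    * Real.sin p.2 ^ 2
  !![gtt, 0, 0, gtφ;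
     0, grr, 0, 0;
     0, 0, gθθ, 0;
     gtφ, 0, 0, gφφ]

/-- The interior of the orbit space: `r > r₊`, `0 < θ < π`. -/
def orbitInt (a m : ℝ) : Set (ℝ × ℝ) := Ioi (rPlus a m) ×ˢ Ioo 0 Real.pi

/-- The orbit space, the two components `θ = 0` and `θ = π` of the axis included. -/
def orbit (a m : ℝ) : Set (ℝ × ℝ) := Ioi (rPlus a m) ×ˢ Icc 0 Real.pi

/-! Data of the Weyl-Papapetrou form
`ḡ = e^{-2γ} (-N² dt² + q_ab dx^a dx^b) + e^{2γ} (dφ + 𝒜₀ dt)²`; the metric `q` is diagonal in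
`(r, θ)`.  See `kerrMetric_eq_weylPapapetrou`. -/

/-- `γ`, defined by `e^{2γ} = ḡ(∂_φ, ∂_φ)`. -/
def kGamma (a m : ℝ) (p : ℝ × ℝ) : ℝ := Real.log (kerrMetric a m p 3 3) / 2

/-- The function `𝒜₀`. -/
def kA0 (a m : ℝ) (p : ℝ × ℝ) : ℝ := -(2 * a * m * p.1 / kPi a m p)

/-- The lapse `N`. -/
def kLapse (a m : ℝ) (p : ℝ × ℝ) : ℝ := √(kDelta a m p) * Real.sin p.2

/-- The component `q_rr`. -/
def qrr (a m : ℝ) (p : ℝ × ℝ) : ℝ := Real.sin p.2 ^ 2 * kPi a m p / kDelta a m p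

/-- The component `q_θθ`. -/
def qthth (a m : ℝ) (p : ℝ × ℝ) : ℝ := Real.sin p.2 ^ 2 * kPi a m p

/-- The density `μ_q = √(det q)`. -/
def muq (a m : ℝ) (p : ℝ × ℝ) : ℝ := √(qrr a m p * qthth a m p)

/-- The gravitational twist potential `ω` of Kerr.  It satisfies the defining equation
`∂_a 𝒜₀ + N e^{-4γ} ε_ab μ_q q^{bc} ∂_c ω = 0`; see `kerr_twist_r` and `kerr_twist_theta`. -/
def kOmega (a m : ℝ) (p : ℝ × ℝ) : ℝ :=
  2 * a * m * (3 * Real.cos p.2 - Real.cos p.2 ^ 3)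
    + 2 * a ^ 3 * m * Real.cos p.2 * Real.sin p.2 ^ 4 / kSigma a p

/-- `e^{c γ}`. -/
def expGamma (a m c : ℝ) (p : ℝ × ℝ) : ℝ := Real.exp (c * kGamma a m p)

/-! ### Calculus on the orbit space -/

/-- `∂_r f`. -/
def dr (f : ℝ × ℝ → ℝ) (p : ℝ × ℝ) : ℝ := deriv (fun r => f (r, p.2)) p.1

/-- `∂_θ f`. -/
def dth (f : ℝ × ℝ → ℝ) (p : ℝ × ℝ) : ℝ := deriv (fun θ => f (p.1, θ)) p.2

/-- The differential `(∂_r f, ∂_θ f)`. -/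
def grad (f : ℝ × ℝ → ℝ) (p : ℝ × ℝ) : ℝ × ℝ := (dr f p, dth f p)

/-- `∂_b V^b` for a vector density `V`. -/
def dvg (V : ℝ × ℝ → ℝ × ℝ) (p : ℝ × ℝ) : ℝ :=
  dr (fun x => (V x).1) p + dth (fun x => (V x).2) p

/-- `q^{ab} X_b`. -/
def qUp (a m : ℝ) (p X : ℝ × ℝ) : ℝ × ℝ := (X.1 / qrr a m p, X.2 / qthth a m p)

/-- `q^{ab} X_a Y_b`. -/
def qIn (a m : ℝ) (p X Y : ℝ × ℝ) : ℝ := X.1 * Y.1 / qrr a m p + X.2 * Y.2 / qthth a m p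

/-! ### The phase space -/

/-- Quadruples `((λ, v), (η, u))` of functions of `(r, θ)`. -/
structure PhasePt where
  lam : ℝ × ℝ → ℝ
  v : ℝ × ℝ → ℝ
  eta : ℝ × ℝ → ℝ
  u : ℝ × ℝ → ℝ

/-- `x + ε δ`. -/
def PhasePt.perturb (x : PhasePt) (ε : ℝ) (δ : PhasePt) : PhasePt where
  lam := fun p => x.lam p + ε * δ.lam p
  v := fun p => x.v p + ε * δ.v p
  eta := fun p => x.eta p + ε * δ.eta p
  u := fun p => x.u p + ε * δ.u p

/-- The phase-space point is the zero point. -/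
def PhasePt.Vanishes (a m : ℝ) (x : PhasePt) : Prop :=
  ∀ p ∈ orbit a m, x.lam p = 0 ∧ x.v p = 0 ∧ x.eta p = 0 ∧ x.u p = 0

/-- `f` vanishes on the axis. -/
def ZeroOnAxis (a m : ℝ) (f : ℝ × ℝ → ℝ) : Prop :=
  ∀ r, rPlus a m < r → f (r, 0) = 0 ∧ f (r, Real.pi) = 0

/-- The normal derivative of `f` vanishes on the axis. -/
def NormalDerivZeroOnAxis (a m : ℝ) (f : ℝ × ℝ → ℝ) : Prop :=
  ∀ r, rPlus a m < r →
    derivWithin (fun θ => f (r, θ)) (Icc 0 Real.pi) 0 = 0 ∧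
    derivWithin (fun θ => f (r, θ)) (Icc 0 Real.pi) Real.pi = 0

/-- Smooth up to the axis, with compact support in the orbit space (which contains the axis but not
`r = r₊`). -/
def SmoothCompact (a m : ℝ) (f : ℝ × ℝ → ℝ) : Prop :=
  ContDiffOn ℝ ∞ f (orbit a m) ∧
  ∃ r₁ r₂, rPlus a m < r₁ ∧ ∀ p ∈ orbit a m, p.1 ∉ Icc r₁ r₂ → f p = 0

/-- The phase space `X`: smooth compactly supported `(λ, v), (η, u)` with `λ = η = 0`,
`∂_n λ = ∂_n η = 0` and `u = v = 0` on the axis. -/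
structure InPhaseSpace (a m : ℝ) (x : PhasePt) : Prop where
  lam_smooth : SmoothCompact a m x.lam
  v_smooth : SmoothCompact a m x.v
  eta_smooth : SmoothCompact a m x.eta
  u_smooth : SmoothCompact a m x.u
  lam_axis : ZeroOnAxis a m x.lam
  eta_axis : ZeroOnAxis a m x.eta
  v_axis : ZeroOnAxis a m x.v
  u_axis : ZeroOnAxis a m x.u
  lam_normal : NormalDerivZeroOnAxis a m x.lam
  eta_normal : NormalDerivZeroOnAxis a m x.eta

/-- `⟨g, δ⟩`, the density of the `L²` pairing. -/
def pairing (g δ : PhasePt) (p : ℝ × ℝ) : ℝ :=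
  g.lam p * δ.lam p + g.v p * δ.v p + g.eta p * δ.eta p + g.u p * δ.u p

/-- `g = (D_λ·H, D_v·H, D_η·H, D_u·H)` at `x`: `g` is continuous off the axis and represents the
directional derivatives of `H` at `x` in all phase-space directions.  Such a `g` is unique on
`orbitInt a m`. -/
structure IsVarGrad (a m : ℝ) (H : PhasePt → ℝ) (x g : PhasePt) : Prop where
  cont_lam : ContinuousOn g.lam (orbitInt a m)
  cont_v : ContinuousOn g.v (orbitInt a m)
  cont_eta : ContinuousOn g.eta (orbitInt a m)
  cont_u : ContinuousOn g.u (orbitInt a m)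
  integrable : ∀ δ, InPhaseSpace a m δ → IntegrableOn (pairing g δ) (orbitInt a m)
  hasDeriv : ∀ δ, InPhaseSpace a m δ →
    HasDerivAt (fun ε : ℝ => H (x.perturb ε δ)) (∫ p in orbitInt a m, pairing g δ p) 0

/-- The density of the canonical Poisson bracket, for functionals with gradients `f` and `g`; the
canonical pairs are `(λ, v)` and `(η, u)`. -/
def bracketDensity (f g : PhasePt) (p : ℝ × ℝ) : ℝ :=
  f.lam p * g.v p - f.v p * g.lam p + (f.eta p * g.u p - f.u p * g.eta p)

/-- The functionals `F`, `G` have variational gradients at `x`, and their Poisson bracket exists at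
`x` and has the value `c`. -/
def HasPoissonBracket (a m : ℝ) (F G : PhasePt → ℝ) (x : PhasePt) (c : ℝ) : Prop :=
  ∃ f g : PhasePt, IsVarGrad a m F x f ∧ IsVarGrad a m G x g ∧
    IntegrableOn (bracketDensity f g) (orbitInt a m) ∧
    ∫ p in orbitInt a m, bracketDensity f g p = c

/-! ### The Hamiltonians -/

/-- The density of the sub-Hamiltonian `H_S(s)`, a combination of the two original forms of the
Hamiltonian. -/
def subDensity (a m s : ℝ) (x : PhasePt) (p : ℝ × ℝ) : ℝ :=
  1 / 2 * kLapse a m p * expGamma a m 2 p / muq a m p * (x.u p ^ 2 + x.v p ^ 2)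
  + 1 / 2 * kLapse a m p * muq a m p * expGamma a m (-2) p *
      (qIn a m p (grad x.lam p) (grad x.lam p) + qIn a m p (grad x.eta p) (grad x.eta p))
  + s * kLapse a m p * expGamma a m (-4) p * muq a m p *
      qIn a m p (grad (kOmega a m) p) (grad x.eta p) * x.lam p
  - (1 - s) * kLapse a m p * expGamma a m (-4) p * muq a m p *
      qIn a m p (grad (kOmega a m) p) (grad x.lam p) * x.eta p

/-- The density of `H^Alt_S(s)`. -/
def altDensity (a m s : ℝ) (x : PhasePt) (p : ℝ × ℝ) : ℝ :=
  let dγ := grad (kGamma a m) p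
  let dω := grad (kOmega a m) p
  let sq := fun X : ℝ × ℝ => qIn a m p X X
  1 / 2 * kLapse a m p * expGamma a m 2 p / muq a m p * (x.u p ^ 2 + x.v p ^ 2)
  + 1 / 4 * kLapse a m p * muq a m p * expGamma a m (-2) p *
      (sq (grad x.eta p - (4 * (1 - s) * x.eta p) • dγ)
        + sq (grad x.lam p - (4 * s * x.lam p) • dγ)
        + sq (grad x.eta p + (2 * s * x.lam p * expGamma a m (-2) p) • dω)
        + sq (grad x.lam p - (2 * (1 - s) * x.eta p * expGamma a m (-2) p) • dω))
  + 2 * kLapse a m p * muq a m p * expGamma a m (-2) p *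
      (sq dγ + 1 / 4 * expGamma a m (-4) p * sq dω) *
      (s * (1 - 2 * s) * x.lam p ^ 2 + (1 - s) * (1 - 2 * (1 - s)) * x.eta p ^ 2)

/-- The functional `H^Alt_S(s)`. -/
def HAlt (a m s : ℝ) (x : PhasePt) : ℝ := ∫ p in orbitInt a m, altDensity a m s x p

/-- The vector density `N μ_q q^{ab} e^{-2γ} ∂_a γ (s λ² + (1 - s) η²)` of the generalized Robinson
identity. -/
def robinsonFlux (a m s : ℝ) (x : PhasePt) (p : ℝ × ℝ) : ℝ × ℝ :=
  (kLapse a m p * muq a m p * expGamma a m (-2) p * (s * x.lam p ^ 2 + (1 - s) * x.eta p ^ 2)) •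
    qUp a m p (grad (kGamma a m) p)

/-- The common gradient of the Hamiltonians, i.e.
`D_λ·H = -∂_b(N e^{-2γ} μ_q q^{ab} ∂_a λ) + N μ_q q^{ab} e^{-4γ} ∂_a ω ∂_b η`,
`D_v·H = N e^{2γ} μ_q⁻¹ v`,
`D_η·H = -∂_b(N e^{-2γ} μ_q q^{ab} ∂_a η) - N μ_q q^{ab} e^{-4γ} ∂_a ω ∂_b λ`,
`D_u·H = N e^{2γ} μ_q⁻¹ u`. -/
def hamGrad (a m : ℝ) (x : PhasePt) : PhasePt where
  lam := fun p =>
    -dvg (fun y => (kLapse a m y * expGamma a m (-2) y * muq a m y) • qUp a m y (grad x.lam y)) p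
    + kLapse a m p * muq a m p * expGamma a m (-4) p *
        qIn a m p (grad (kOmega a m) p) (grad x.eta p)
  v := fun p => kLapse a m p * expGamma a m 2 p / muq a m p * x.v p
  eta := fun p =>
    -dvg (fun y => (kLapse a m y * expGamma a m (-2) y * muq a m y) • qUp a m y (grad x.eta y)) p
    - kLapse a m p * muq a m p * expGamma a m (-4) p *
        qIn a m p (grad (kOmega a m) p) (grad x.lam p)
  u := fun p => kLapse a m p * expGamma a m 2 p / muq a m p * x.u p

/-! ### The vector densities `J_S(s)` -/

/-- The time component of `J_S(s)`: the energy density. -/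
def currentT (a m s : ℝ) (x : PhasePt) (p : ℝ × ℝ) : ℝ := altDensity a m s x p

/-- The spatial components of `J_S(s)`:
`J^a = -N² q^{ab} (u (∂_b η - 2 (1 - s) η ∂_b γ + s λ e^{-2γ} ∂_b ω)
  + v (∂_b λ - 2 s λ ∂_b γ - (1 - s) η e^{-2γ} ∂_b ω))`. -/
def currentS (a m s : ℝ) (x : PhasePt) (p : ℝ × ℝ) : ℝ × ℝ :=
  let dγ := grad (kGamma a m) p
  let dω := grad (kOmega a m) p
  (-kLapse a m p ^ 2) • qUp a m p
    (x.u p • (grad x.eta p - (2 * (1 - s) * x.eta p) • dγ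
        + (s * x.lam p * expGamma a m (-2) p) • dω)
      + x.v p • (grad x.lam p - (2 * s * x.lam p) • dγ
        - ((1 - s) * x.eta p * expGamma a m (-2) p) • dω))

/-! ### Maxwell fields on the Kerr exterior

The exterior is `ℝ × {x ∈ ℝ³ : |x| > r₊}`, the manifold on which the Boyer-Lindquist coordinates
`(t, r, θ, φ)` are the time and the spherical coordinates of `x`.  In this way the axis is included
and smoothness across it has its usual meaning. -/

/-- The Kerr exterior, as an open subset of `ℝ⁴` with coordinates `(t, x, y, z)`. -/
def exterior (a m : ℝ) : Set (Fin 4 → ℝ) :=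
  {y | rPlus a m < √(y 1 ^ 2 + y 2 ^ 2 + y 3 ^ 2)}

/-- Boyer-Lindquist coordinates `(t, r, θ, φ)`, off the axis. -/
def blChart (a m : ℝ) : Set (Fin 4 → ℝ) :=
  {q | rPlus a m < q 1 ∧ 0 < q 2 ∧ q 2 < Real.pi}

/-- `(t, r, θ, φ) ↦ (t, r sin θ cos φ, r sin θ sin φ, r cos θ)`. -/
def blMap (q : Fin 4 → ℝ) : Fin 4 → ℝ :=
  ![q 0, q 1 * Real.sin (q 2) * Real.cos (q 3), q 1 * Real.sin (q 2) * Real.sin (q 3),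
    q 1 * Real.cos (q 2)]

/-- `∂_μ f` on `ℝ⁴`. -/
def pd (μ : Fin 4) (f : (Fin 4 → ℝ) → ℝ) (q : Fin 4 → ℝ) : ℝ :=
  fderiv ℝ f q (Pi.single μ 1)

/-- The components `A_μ` in Boyer-Lindquist coordinates (the pull-back under `blMap`) of the
one-form with components `A` in the coordinates `(t, x, y, z)`. -/
def blPot (A : (Fin 4 → ℝ) → Fin 4 → ℝ) (q : Fin 4 → ℝ) (μ : Fin 4) : ℝ :=
  ∑ ν, A (blMap q) ν * pd μ (fun q' => blMap q' ν) q

/-- The components `F_{μν} = ∂_μ A_ν - ∂_ν A_μ` of the Faraday tensor `F = dA`. -/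
def faraday (A : (Fin 4 → ℝ) → Fin 4 → ℝ) (μ ν : Fin 4) (q : Fin 4 → ℝ) : ℝ :=
  pd μ (fun q' => blPot A q' ν) q - pd ν (fun q' => blPot A q' μ) q

/-- The tensor density `√(-det ḡ) F^{μν}`. -/
def faradayUp (a m : ℝ) (A : (Fin 4 → ℝ) → Fin 4 → ℝ) (μ ν : Fin 4) (q : Fin 4 → ℝ) : ℝ :=
  √(-(kerrMetric a m (q 1, q 2)).det) *
    ∑ α, ∑ β, (kerrMetric a m (q 1, q 2))⁻¹ μ α * (kerrMetric a m (q 1, q 2))⁻¹ ν β *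
      faraday A α β q

/-- `A` is a smooth axially symmetric vector potential on the Kerr exterior whose Faraday tensor
`F = dA` solves Maxwell's equations `∇^μ F_{μν} = 0`, written as `∂_μ (√(-det ḡ) F^{μν}) = 0`, with
initial data at `t = 0` that are compactly supported in the exterior. -/
structure IsAxisymMaxwell (a m : ℝ) (A : (Fin 4 → ℝ) → Fin 4 → ℝ) : Prop where
  smooth : ContDiffOn ℝ ∞ A (exterior a m)
  axisym : ∀ q ∈ blChart a m, ∀ μ, pd 3 (fun q' => blPot A q' μ) q = 0
  maxwell : ∀ q ∈ blChart a m, ∀ ν, ∑ μ, pd μ (faradayUp a m A μ ν) q = 0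
  compact_data : ∃ r₁ r₂, rPlus a m < r₁ ∧
    ∀ q ∈ blChart a m, q 0 = 0 → q 1 ∉ Icc r₁ r₂ → ∀ μ ν, faraday A μ ν q = 0

/-- The point `(t, r, θ, 0)`. -/
def lift (t : ℝ) (p : ℝ × ℝ) : Fin 4 → ℝ := ![t, p.1, p.2, 0]

/-- `η` is the electric twist potential: `𝔈^a = ε^{ab} ∂_b η` with `ε^{rθ} = 1`, where
`𝔈^i = √(-det ḡ) F^{ti}` is the electric field density, normalized by `η = 0` on the axis. -/
structure IsElectricTwist (a m : ℝ) (A : (Fin 4 → ℝ) → Fin 4 → ℝ) (η : ℝ → ℝ × ℝ → ℝ) : Prop where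
  smooth : ContDiffOn ℝ ∞ (fun z : ℝ × (ℝ × ℝ) => η z.1 z.2) (univ ×ˢ orbit a m)
  eq_r : ∀ t, ∀ p ∈ orbitInt a m, faradayUp a m A 0 1 (lift t p) = dth (η t) p
  eq_theta : ∀ t, ∀ p ∈ orbitInt a m, faradayUp a m A 0 2 (lift t p) = -dr (η t) p
  axis : ∀ t, ZeroOnAxis a m (η t)

/-- The point of phase space at time `t`: `λ = A_φ`, `v = -𝔈^φ`, `η`, and `u = 𝔅^φ = F_{rθ}`. -/
def phaseCurve (a m : ℝ) (A : (Fin 4 → ℝ) → Fin 4 → ℝ) (η : ℝ → ℝ × ℝ → ℝ) (t : ℝ) : PhasePt where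
  lam := fun p => blPot A (lift t p) 3
  v := fun p => -faradayUp a m A 0 3 (lift t p)
  eta := η t
  u := fun p => faraday A 1 2 (lift t p)

/-- Hamilton's equations at time `t` for the Hamiltonian `H` along the curve `x`:
`D_v·H = ∂_t λ`, `D_λ·H = -∂_t v`, `D_u·H = ∂_t η`, `D_η·H = -∂_t u`. -/
def HamiltonEqs (a m : ℝ) (H : PhasePt → ℝ) (x : ℝ → PhasePt) (t : ℝ) : Prop :=
  IsVarGrad a m H (x t)
    { lam := fun p => -deriv (fun τ => (x τ).v p) t
      v := fun p => deriv (fun τ => (x τ).lam p) t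
      eta := fun p => -deriv (fun τ => (x τ).u p) t
      u := fun p => deriv (fun τ => (x τ).eta p) t }

/-- The spacetime divergence `∂_t J^t + ∂_r J^r + ∂_θ J^θ` of `J_S(s)` along the curve `x`. -/
def spacetimeDiv (a m s : ℝ) (x : ℝ → PhasePt) (t : ℝ) (p : ℝ × ℝ) : ℝ :=
  deriv (fun τ => currentT a m s (x τ) p) t + dvg (currentS a m s (x t)) p

/-- The flux of `J_S(s)` through the hypersurface of constant `t`, for the state `x` at time `t`. -/
def flux (a m s : ℝ) (x : PhasePt) : ℝ := ∫ p in orbitInt a m, currentT a m s x p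

/-- The Faraday tensor vanishes on the hypersurface of constant `t`. -/
def FieldVanishesAt (a m : ℝ) (A : (Fin 4 → ℝ) → Fin 4 → ℝ) (t : ℝ) : Prop :=
  ∀ q ∈ blChart a m, q 0 = t → ∀ μ ν, faraday A μ ν q = 0

/-! ### The background data belong to the Kerr metric -/

theorem delta_pos {a m : ℝ} (h : |a| < m) {p : ℝ × ℝ} (hp : rPlus a m < p.1) :
    0 < p.1 ∧ 0 < kDelta a m p := by
  have hm : 0 < m := lt_of_le_of_lt (abs_nonneg a) h
  have h2 : 0 ≤ m ^ 2 - a ^ 2 := by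
    have := sq_lt_sq' (by linarith [neg_abs_le a]) (lt_of_le_of_lt (le_abs_self a) h)
    linarith
  have hs := Real.sqrt_nonneg (m ^ 2 - a ^ 2)
  have hq := Real.sq_sqrt h2
  unfold rPlus at hp
  refine ⟨by linarith, ?_⟩
  unfold kDelta
  nlinarith

theorem sigma_pos {a : ℝ} {p : ℝ × ℝ} (hp : 0 < p.1) : 0 < kSigma a p := by
  unfold kSigma; positivity

theorem pi_eq (a m : ℝ) (p : ℝ × ℝ) :
    kPi a m p = kSigma a p * kDelta a m p + 2 * m * p.1 * (p.1 ^ 2 + a ^ 2) := by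
  have h := Real.sin_sq_add_cos_sq p.2
  have h' : Real.cos p.2 ^ 2 = 1 - Real.sin p.2 ^ 2 := by linarith
  simp only [kPi, kSigma, kDelta, h']
  ring

theorem pi_pos {a m : ℝ} (h : |a| < m) {p : ℝ × ℝ} (hp : rPlus a m < p.1) : 0 < kPi a m p := by
  have hm : 0 < m := lt_of_le_of_lt (abs_nonneg a) h
  obtain ⟨h1, h2⟩ := delta_pos h hp
  have h3 := sigma_pos (a := a) h1
  rw [pi_eq]
  positivity

theorem expGamma_two {a m : ℝ} (h : |a| < m) {p : ℝ × ℝ} (hp : p ∈ orbitInt a m) :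
    expGamma a m 2 p = Real.sin p.2 ^ 2 * kPi a m p / kSigma a p := by
  have hs : 0 < Real.sin p.2 := Real.sin_pos_of_pos_of_lt_pi hp.2.1 hp.2.2
  have h1 := sigma_pos (a := a) (delta_pos h hp.1).1
  have h2 := pi_pos h hp.1
  have e : kerrMetric a m p 3 3 = Real.sin p.2 ^ 2 * kPi a m p / kSigma a p := by
    simp [kerrMetric, kPi]; ring
  rw [expGamma, kGamma, e, mul_div_cancel₀ _ (two_ne_zero), Real.exp_log (by positivity)]

/-- The Weyl-Papapetrou form of the Kerr metric. -/
theorem kerrMetric_eq_weylPapapetrou {a m : ℝ} (h : |a| < m) {p : ℝ × ℝ} (hp : p ∈ orbitInt a m) :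
    kerrMetric a m p =
      !![-(expGamma a m 2 p)⁻¹ * kLapse a m p ^ 2 + expGamma a m 2 p * kA0 a m p ^ 2, 0, 0,
          expGamma a m 2 p * kA0 a m p;
        0, (expGamma a m 2 p)⁻¹ * qrr a m p, 0, 0;
        0, 0, (expGamma a m 2 p)⁻¹ * qthth a m p, 0;
        expGamma a m 2 p * kA0 a m p, 0, 0, expGamma a m 2 p] := by
  have hs : 0 < Real.sin p.2 := Real.sin_pos_of_pos_of_lt_pi hp.2.1 hp.2.2
  obtain ⟨h0, hD⟩ := delta_pos h hp.1
  have h1 := sigma_pos (a := a) h0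
  have h2 := pi_pos h hp.1
  have hN : kLapse a m p ^ 2 = kDelta a m p * Real.sin p.2 ^ 2 := by
    rw [kLapse, mul_pow, Real.sq_sqrt hD.le]
  have hrel : kDelta a m p = p.1 ^ 2 - 2 * m * p.1 + a ^ 2 := rfl
  have htt : -((kDelta a m p - a ^ 2 * Real.sin p.2 ^ 2) / kSigma a p) =
      -(Real.sin p.2 ^ 2 * kPi a m p / kSigma a p)⁻¹ * (kDelta a m p * Real.sin p.2 ^ 2)
      + Real.sin p.2 ^ 2 * kPi a m p / kSigma a p * (-(2 * a * m * p.1 / kPi a m p)) ^ 2 := by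
    field_simp
    have h' : Real.cos p.2 ^ 2 = 1 - Real.sin p.2 ^ 2 := by
      linarith [Real.sin_sq_add_cos_sq p.2]
    simp only [kPi, kSigma, kDelta, h']
    ring
  ext i j
  fin_cases i <;> fin_cases j <;>
    simp [kerrMetric, expGamma_two h hp, hN, kA0, qrr, qthth]
  · simpa using htt
  · rw [hrel]; field_simp; ring
  · field_simp
  · field_simp
  · rw [hrel]; field_simp; ring
  · rw [kPi]; ring

theorem expGamma_neg_four {a m : ℝ} (p : ℝ × ℝ) :
    expGamma a m (-4) p = ((expGamma a m 2 p) ^ 2)⁻¹ := by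
  rw [expGamma, expGamma, ← Real.exp_nat_mul, ← Real.exp_neg]
  congr 1
  push_cast
  ring

theorem muq_eq {a m : ℝ} (h : |a| < m) {p : ℝ × ℝ} (hp : p ∈ orbitInt a m) :
    muq a m p = Real.sin p.2 ^ 2 * kPi a m p / √(kDelta a m p) := by
  have hs : 0 < Real.sin p.2 := Real.sin_pos_of_pos_of_lt_pi hp.2.1 hp.2.2
  have hD := (delta_pos h hp.1).2
  have h2 := pi_pos h hp.1
  have e : qrr a m p * qthth a m p = (Real.sin p.2 ^ 2 * kPi a m p) ^ 2 / kDelta a m p := by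
    rw [qrr, qthth]; ring
  rw [muq, e, Real.sqrt_div (by positivity), Real.sqrt_sq (by positivity)]

theorem hasDerivAt_omega_r {a m : ℝ} (h : |a| < m) {p : ℝ × ℝ} (hp : p ∈ orbitInt a m) :
    HasDerivAt (fun r => kOmega a m (r, p.2))
      (-(2 * a ^ 3 * m * Real.cos p.2 * Real.sin p.2 ^ 4 * (2 * p.1) / kSigma a p ^ 2)) p.1 := by
  have h1 := sigma_pos (a := a) (delta_pos h hp.1).1
  have hS : HasDerivAt (fun r : ℝ => kSigma a (r, p.2)) (2 * p.1) p.1 := by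
    simpa [kSigma] using (hasDerivAt_pow 2 p.1).add_const (a ^ 2 * Real.cos p.2 ^ 2)
  have := (((hasDerivAt_const p.1 (2 * a ^ 3 * m * Real.cos p.2 * Real.sin p.2 ^ 4)).div hS
    h1.ne').const_add (2 * a * m * (3 * Real.cos p.2 - Real.cos p.2 ^ 3)))
  refine this.congr_deriv ?_
  ring

theorem hasDerivAt_omega_theta {a m : ℝ} (h : |a| < m) {p : ℝ × ℝ} (hp : p ∈ orbitInt a m) :
    HasDerivAt (fun θ => kOmega a m (p.1, θ))
      (-(6 * a * m * Real.sin p.2 ^ 3)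
        + ((2 * a ^ 3 * m * (4 * Real.cos p.2 ^ 2 * Real.sin p.2 ^ 3 - Real.sin p.2 ^ 5))
              * kSigma a p
            + 4 * a ^ 5 * m * Real.cos p.2 ^ 2 * Real.sin p.2 ^ 5) / kSigma a p ^ 2) p.2 := by
  have h1 := sigma_pos (a := a) (delta_pos h hp.1).1
  have hc := Real.hasDerivAt_cos p.2
  have hs := Real.hasDerivAt_sin p.2
  have hS : HasDerivAt (fun θ : ℝ => kSigma a (p.1, θ))
      (a ^ 2 * (2 * Real.cos p.2 * (-Real.sin p.2))) p.2 := by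
    simpa [kSigma] using ((hc.pow 2).const_mul (a ^ 2)).const_add (p.1 ^ 2)
  have := (((hc.const_mul 3).sub (hc.pow 3)).const_mul (2 * a * m)).add
    (((hc.const_mul (2 * a ^ 3 * m)).mul (hs.pow 4)).div hS h1.ne')
  refine this.congr_deriv ?_
  have h' : Real.cos p.2 ^ 2 = 1 - Real.sin p.2 ^ 2 := by
    linarith [Real.sin_sq_add_cos_sq p.2]
  have e1 : 2 * a * m * (3 * -Real.sin p.2 - (3 : ℕ) * Real.cos p.2 ^ (3 - 1) * -Real.sin p.2)
      = -(6 * a * m * Real.sin p.2 ^ 3) := by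
    norm_num; rw [h']; ring
  rw [e1]
  congr 1
  simp
  ring

/-- The `r`-component of the defining equation of the twist potential. -/
theorem kerr_twist_r {a m : ℝ} (h : |a| < m) {p : ℝ × ℝ} (hp : p ∈ orbitInt a m) :
    dr (kA0 a m) p + kLapse a m p * expGamma a m (-4) p * muq a m p *
      (qUp a m p (grad (kOmega a m) p)).2 = 0 := by
  have hs : 0 < Real.sin p.2 := Real.sin_pos_of_pos_of_lt_pi hp.2.1 hp.2.2
  obtain ⟨h0, hD⟩ := delta_pos h hp.1
  have h1 := sigma_pos (a := a) h0
  have h2 := pi_pos h hp.1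
  have hsD : 0 < √(kDelta a m p) := Real.sqrt_pos.2 hD
  have hP : HasDerivAt (fun r : ℝ => kPi a m (r, p.2))
      (4 * p.1 * (p.1 ^ 2 + a ^ 2) - a ^ 2 * (2 * p.1 - 2 * m) * Real.sin p.2 ^ 2) p.1 := by
    have hx := hasDerivAt_id' p.1
    have hx2 := hasDerivAt_pow 2 p.1
    have := ((hx2.add_const (a ^ 2)).pow 2).sub
      (((((hx2.sub (hx.const_mul (2 * m))).add_const (a ^ 2)).const_mul (a ^ 2)).mul_const
        (Real.sin p.2 ^ 2)))
    refine this.congr_deriv ?_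
    simp
    ring
  have hA := ((((hasDerivAt_id' p.1).const_mul (2 * a * m)).div hP h2.ne').neg).deriv
  have hA' : dr (kA0 a m) p = _ := hA
  have hO : dth (kOmega a m) p = _ := (hasDerivAt_omega_theta h hp).deriv
  simp only [qUp, grad]
  rw [hA', hO, expGamma_neg_four, expGamma_two h hp, muq_eq h hp, kLapse, qthth]
  have h' : Real.cos p.2 ^ 2 = 1 - Real.sin p.2 ^ 2 := by
    linarith [Real.sin_sq_add_cos_sq p.2]
  simp only [Prod.mk.eta]
  field_simp
  simp only [kPi, kSigma, kDelta, h']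
  ring

/-- The `θ`-component of the defining equation of the twist potential. -/
theorem kerr_twist_theta {a m : ℝ} (h : |a| < m) {p : ℝ × ℝ} (hp : p ∈ orbitInt a m) :
    dth (kA0 a m) p - kLapse a m p * expGamma a m (-4) p * muq a m p *
      (qUp a m p (grad (kOmega a m) p)).1 = 0 := by
  have hs : 0 < Real.sin p.2 := Real.sin_pos_of_pos_of_lt_pi hp.2.1 hp.2.2
  obtain ⟨h0, hD⟩ := delta_pos h hp.1
  have h1 := sigma_pos (a := a) h0
  have h2 := pi_pos h hp.1
  have hsD : 0 < √(kDelta a m p) := Real.sqrt_pos.2 hD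
  have hsq : √(kDelta a m p) ^ 2 = kDelta a m p := Real.sq_sqrt hD.le
  have hP : HasDerivAt (fun θ : ℝ => kPi a m (p.1, θ))
      (-(a ^ 2 * kDelta a m p * (2 * Real.sin p.2 * Real.cos p.2))) p.2 := by
    have := (((Real.hasDerivAt_sin p.2).pow 2).const_mul (a ^ 2 * kDelta a m p)).const_sub
      ((p.1 ^ 2 + a ^ 2) ^ 2)
    refine this.congr_deriv ?_
    simp
  have hA := (((hasDerivAt_const p.2 (2 * a * m * p.1)).div hP h2.ne').neg).deriv
  have hA' : dth (kA0 a m) p = _ := hA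
  have hO : dr (kOmega a m) p = _ := (hasDerivAt_omega_r h hp).deriv
  simp only [qUp, grad]
  rw [hA', hO, expGamma_neg_four, expGamma_two h hp, muq_eq h hp, kLapse, qrr]
  simp only [Prod.mk.eta]
  field_simp
  ring

end KerrMaxwell

end

open KerrMaxwell

noncomputable section

namespace KerrMaxwell


/-! ### Explicit background coefficients -/

/-! Write P^{ab} = N μ e^{-2γ} q^{ab}, K = N e^{2γ}/μ and W = e^{-2γ} ∂ω. The background enters
through two field equations, ∂_b(P^{ab} ∂_aγ) = -P^{ab}(2 ∂_aγ ∂_bγ + ½ W_a W_b) and ∂_b(P^{ab} W_a)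
= 0 (`dvg_gamma`, `dvg_tw`). With P, K, ∂γ and W made explicit, both are identities between rational
functions of r, sin θ, cos θ.

Put Y_η = ∂η - 2(1-s)η∂γ + sλW and Y_λ = ∂λ - 2sλ∂γ - (1-s)ηW. Completing squares (`altDensity_eq`)
makes 2e_s the sum of K(u²+v²), of P(Y_η,Y_η) + P(Y_λ,Y_λ), and of the mass term 4s(1-s)(P(∂γ,∂γ) +
¼P(W,W))(λ²+η²), so e_s ≥ 0 on [0,1]. Polarizing and inserting the two field equations
(`polar_eq_pairing_add_dvg`) shows that the first variation is a pairing with `hamGrad`, which does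
not contain s, plus a divergence. The weights P blow up like 1/sin θ at the axis, but λ and η are
O(sin²θ), so the energy is integrable and the divergence integrates to zero. This order counting is
done by `Ax`. All H(s) therefore have the same gradient, and their Poisson brackets vanish
pointwise. If H(s) = 0, the density vanishes. For 0 < s < 1 the mass term kills λ and η because ∂_rγ
> 0 (`gamR_pos`). At the endpoints Y = 0 is a linear equation along r, and compact support forces
its solution to vanish.

For a Maxwell field, smoothness across the axis together with axial symmetry gives parities under
reflection in θ. They yield the axis conditions: A_φ/sin θ and F_{rθ} are odd and hence zero there.
Gauss's law and the r- and θ-components of Ampère's law say that K u dt - 𝔈^θ dr + 𝔈^r dθ is closed,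
so it has a potential η. It is constant on each component of the axis, and the two constants agree
since no field lies far out at t = 0. Solving for F_{tr} and F_{tθ} in terms of η and λ introduces
𝒜₀, and the twist equation turns ∂𝒜₀ into the ω-terms of Hamilton's equations (`isFlow_phaseCurve`).

The first-variation identity applied to the velocity of the motion is the local conservation law:
the pairing cancels by antisymmetry and the flux is -J^a.

Membership in the phase space at every t needs finite propagation speed (`IsFlow.suppIn`). The
radial speed is at most (r - r₊)/m, so log(r - r₊) moves at bounded rate and neither the horizon nor
infinity is reached in finite time. An energy estimate for e_{1/2} in cones proves this. The value s
= 1/2 is convenient because its mass term controls λ and η themselves. -/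

/-- `∂_r Π`. -/
def piR (a m : ℝ) (p : ℝ × ℝ) : ℝ :=
  4 * p.1 * (p.1 ^ 2 + a ^ 2) - a ^ 2 * (2 * p.1 - 2 * m) * Real.sin p.2 ^ 2

/-- `∂_θ Π`. -/
def piTh (a m : ℝ) (p : ℝ × ℝ) : ℝ :=
  -(a ^ 2 * kDelta a m p * (2 * Real.sin p.2 * Real.cos p.2))

/-- `∂_θ Σ`. -/
def sigTh (a : ℝ) (p : ℝ × ℝ) : ℝ := -(2 * a ^ 2 * Real.cos p.2 * Real.sin p.2)

/-- `∂_r γ`. -/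
def gamR (a m : ℝ) (p : ℝ × ℝ) : ℝ := (piR a m p / kPi a m p - 2 * p.1 / kSigma a p) / 2

/-- `∂_θ γ`. -/
def gamTh (a m : ℝ) (p : ℝ × ℝ) : ℝ :=
  Real.cos p.2 / Real.sin p.2 + (piTh a m p / kPi a m p - sigTh a p / kSigma a p) / 2

/-- `e^{-2γ} ∂_r ω`. -/
def twR (a m : ℝ) (p : ℝ × ℝ) : ℝ :=
  -(4 * a ^ 3 * m * Real.cos p.2 * Real.sin p.2 ^ 2 * p.1) / (kSigma a p * kPi a m p)

/-- `e^{-2γ} ∂_θ ω`. -/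
def twTh (a m : ℝ) (p : ℝ × ℝ) : ℝ :=
  2 * a * m * Real.sin p.2 * (kPi a m p - p.1 * piR a m p) / (kSigma a p * kPi a m p)

/-- `N μ_q q^{rr} e^{-2γ}`. -/
def coR (a m : ℝ) (p : ℝ × ℝ) : ℝ := kDelta a m p * kSigma a p / (Real.sin p.2 * kPi a m p)

/-- `N μ_q q^{θθ} e^{-2γ}`. -/
def coTh (a m : ℝ) (p : ℝ × ℝ) : ℝ := kSigma a p / (Real.sin p.2 * kPi a m p)

/-- `N e^{2γ} μ_q⁻¹`. -/
def coK (a m : ℝ) (p : ℝ × ℝ) : ℝ := kDelta a m p * Real.sin p.2 / kSigma a p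

theorem isOpen_orbitInt (a m : ℝ) : IsOpen (orbitInt a m) := isOpen_Ioi.prod isOpen_Ioo

theorem sin_pos_of_mem {a m : ℝ} {p : ℝ × ℝ} (hp : p ∈ orbitInt a m) : 0 < Real.sin p.2 :=
  Real.sin_pos_of_pos_of_lt_pi hp.2.1 hp.2.2

theorem rPlus_pos {a m : ℝ} (h : |a| < m) : 0 < rPlus a m := by
  have hm : 0 < m := lt_of_le_of_lt (abs_nonneg a) h
  have := Real.sqrt_nonneg (m ^ 2 - a ^ 2)
  unfold rPlus; linarith

theorem hasDerivAt_sigma_r (a : ℝ) (p : ℝ × ℝ) :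
    HasDerivAt (fun r => kSigma a (r, p.2)) (2 * p.1) p.1 := by
  simpa [kSigma] using (hasDerivAt_pow 2 p.1).add_const (a ^ 2 * Real.cos p.2 ^ 2)

theorem hasDerivAt_sigma_th (a : ℝ) (p : ℝ × ℝ) :
    HasDerivAt (fun θ => kSigma a (p.1, θ)) (sigTh a p) p.2 := by
  have := (((Real.hasDerivAt_cos p.2).pow 2).const_mul (a ^ 2)).const_add (p.1 ^ 2)
  refine this.congr_deriv ?_
  simp [sigTh]; ring

theorem hasDerivAt_delta_r (a m : ℝ) (p : ℝ × ℝ) :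
    HasDerivAt (fun r => kDelta a m (r, p.2)) (2 * p.1 - 2 * m) p.1 := by
  have := ((hasDerivAt_pow 2 p.1).sub ((hasDerivAt_id' p.1).const_mul (2 * m))).add_const (a ^ 2)
  refine this.congr_deriv ?_
  simp

theorem hasDerivAt_pi_r (a m : ℝ) (p : ℝ × ℝ) :
    HasDerivAt (fun r => kPi a m (r, p.2)) (piR a m p) p.1 := by
  have := (((hasDerivAt_pow 2 p.1).add_const (a ^ 2)).pow 2).sub
    (((hasDerivAt_delta_r a m p).const_mul (a ^ 2)).mul_const (Real.sin p.2 ^ 2))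
  refine this.congr_deriv ?_
  simp [piR]; ring

theorem hasDerivAt_pi_th (a m : ℝ) (p : ℝ × ℝ) :
    HasDerivAt (fun θ => kPi a m (p.1, θ)) (piTh a m p) p.2 := by
  have := (((Real.hasDerivAt_sin p.2).pow 2).const_mul (a ^ 2 * kDelta a m p)).const_sub
    ((p.1 ^ 2 + a ^ 2) ^ 2)
  refine this.congr_deriv ?_
  simp [piTh]

theorem hasDerivAt_piR_r (a m : ℝ) (p : ℝ × ℝ) :
    HasDerivAt (fun r => piR a m (r, p.2))
      (12 * p.1 ^ 2 + 4 * a ^ 2 - 2 * a ^ 2 * Real.sin p.2 ^ 2) p.1 := by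
  have := (((hasDerivAt_id' p.1).const_mul 4).mul ((hasDerivAt_pow 2 p.1).add_const (a ^ 2))).sub
    (((((hasDerivAt_id' p.1).const_mul 2).sub_const (2 * m)).const_mul (a ^ 2)).mul_const
      (Real.sin p.2 ^ 2))
  refine this.congr_deriv ?_
  simp; ring

theorem hasDerivAt_piR_th (a m : ℝ) (p : ℝ × ℝ) :
    HasDerivAt (fun θ => piR a m (p.1, θ))
      (-(a ^ 2 * (2 * p.1 - 2 * m) * (2 * Real.sin p.2 * Real.cos p.2))) p.2 := by
  have := (((Real.hasDerivAt_sin p.2).pow 2).const_mul (a ^ 2 * (2 * p.1 - 2 * m))).const_sub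
    (4 * p.1 * (p.1 ^ 2 + a ^ 2))
  refine this.congr_deriv ?_
  simp

theorem hasDerivAt_piTh_th (a m : ℝ) (p : ℝ × ℝ) :
    HasDerivAt (fun θ => piTh a m (p.1, θ))
      (-(a ^ 2 * kDelta a m p * (2 * (Real.cos p.2 ^ 2 - Real.sin p.2 ^ 2)))) p.2 := by
  have := ((((Real.hasDerivAt_sin p.2).const_mul 2).mul (Real.hasDerivAt_cos p.2)).const_mul
    (a ^ 2 * kDelta a m p)).neg
  refine this.congr_deriv ?_
  ring

theorem hasDerivAt_sigTh_th (a : ℝ) (p : ℝ × ℝ) :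
    HasDerivAt (fun θ => sigTh a (p.1, θ))
      (-(2 * a ^ 2 * (Real.cos p.2 ^ 2 - Real.sin p.2 ^ 2))) p.2 := by
  have := (((Real.hasDerivAt_cos p.2).const_mul (2 * a ^ 2)).mul (Real.hasDerivAt_sin p.2)).neg
  refine this.congr_deriv ?_
  ring

/-! ### The background one-forms and weights in closed form. -/

theorem kerrMetric_phi_phi (a m : ℝ) (p : ℝ × ℝ) :
    kerrMetric a m p 3 3 = Real.sin p.2 ^ 2 * kPi a m p / kSigma a p := by
  simp [kerrMetric, kPi]; ring

/-- Since e^{2γ} = sin²θ Π/Σ, half its logarithmic derivative is rational in r, sin θ, cos θ. From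
here on γ is only met through these two components. -/
theorem grad_gamma {a m : ℝ} (h : |a| < m) {p : ℝ × ℝ} (hp : p ∈ orbitInt a m) :
    grad (kGamma a m) p = (gamR a m p, gamTh a m p) := by
  have hs := sin_pos_of_mem hp
  have h1 := sigma_pos (a := a) (delta_pos h hp.1).1
  have h2 := pi_pos h hp.1
  have hne : Real.sin p.2 ^ 2 * kPi a m p / kSigma a p ≠ 0 := by positivity
  refine Prod.ext ?_ ?_
  · have := (((((hasDerivAt_pi_r a m p).const_mul (Real.sin p.2 ^ 2)).div
      (hasDerivAt_sigma_r a p) h1.ne').log hne).div_const 2).deriv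
    simp only [grad, dr, kGamma, kerrMetric_phi_phi]
    refine this.trans ?_
    simp only [gamR, Prod.mk.eta, Pi.div_apply]
    field_simp
  · have := ((((((Real.hasDerivAt_sin p.2).pow 2).mul (hasDerivAt_pi_th a m p)).div
      (hasDerivAt_sigma_th a p) h1.ne').log hne).div_const 2).deriv
    simp only [grad, dth, kGamma, kerrMetric_phi_phi]
    refine this.trans ?_
    simp only [gamTh, Prod.mk.eta, Pi.mul_apply, Pi.pow_apply, Pi.div_apply]
    push_cast
    field_simp
    ring

theorem expGamma_neg_two {a m : ℝ} (p : ℝ × ℝ) :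
    expGamma a m (-2) p = (expGamma a m 2 p)⁻¹ := by
  rw [expGamma, expGamma, ← Real.exp_neg]; congr 1; ring

/-- Multiplication by e^{-2γ} cancels one power of Σ and two of sin θ. What remains is still O(sin
θ), which makes the twist terms harmless at the axis. -/
theorem grad_omega {a m : ℝ} (h : |a| < m) {p : ℝ × ℝ} (hp : p ∈ orbitInt a m) :
    expGamma a m (-2) p * (grad (kOmega a m) p).1 = twR a m p ∧
    expGamma a m (-2) p * (grad (kOmega a m) p).2 = twTh a m p := by
  have hs := sin_pos_of_mem hp
  have h1 := sigma_pos (a := a) (delta_pos h hp.1).1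
  have h2 := pi_pos h hp.1
  have e1 : (grad (kOmega a m) p).1 = _ := (hasDerivAt_omega_r h hp).deriv
  have e2 : (grad (kOmega a m) p).2 = _ := (hasDerivAt_omega_theta h hp).deriv
  rw [expGamma_neg_two, expGamma_two h hp, e1, e2]
  constructor
  · simp only [twR]
    field_simp
    ring
  · simp only [twTh]
    field_simp
    have h' : Real.cos p.2 ^ 2 = 1 - Real.sin p.2 ^ 2 := by
      linarith [Real.sin_sq_add_cos_sq p.2]
    simp only [kPi, piR, kSigma, kDelta, h']
    ring

theorem coK_eq {a m : ℝ} (h : |a| < m) {p : ℝ × ℝ} (hp : p ∈ orbitInt a m) :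
    kLapse a m p * expGamma a m 2 p / muq a m p = coK a m p := by
  have hs := sin_pos_of_mem hp
  have hD := (delta_pos h hp.1).2
  have h1 := sigma_pos (a := a) (delta_pos h hp.1).1
  have h2 := pi_pos h hp.1
  have hsD : 0 < √(kDelta a m p) := Real.sqrt_pos.2 hD
  rw [muq_eq h hp, expGamma_two h hp, kLapse, coK]
  field_simp
  rw [Real.sq_sqrt hD.le]

/-- The square roots of Δ in N and μ cancel, so the gradient weights are rational. -/
theorem lapse_muq {a m : ℝ} (h : |a| < m) {p : ℝ × ℝ} (hp : p ∈ orbitInt a m) :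
    kLapse a m p * muq a m p = Real.sin p.2 ^ 3 * kPi a m p := by
  have hD := (delta_pos h hp.1).2
  have hsD : 0 < √(kDelta a m p) := Real.sqrt_pos.2 hD
  rw [muq_eq h hp, kLapse]
  field_simp

theorem coR_eq {a m : ℝ} (h : |a| < m) {p : ℝ × ℝ} (hp : p ∈ orbitInt a m) :
    kLapse a m p * muq a m p * expGamma a m (-2) p / qrr a m p = coR a m p := by
  have hs := sin_pos_of_mem hp
  have hD := (delta_pos h hp.1).2
  have h1 := sigma_pos (a := a) (delta_pos h hp.1).1
  have h2 := pi_pos h hp.1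
  rw [lapse_muq h hp, expGamma_neg_two, expGamma_two h hp, qrr, coR]
  field_simp

theorem coTh_eq {a m : ℝ} (h : |a| < m) {p : ℝ × ℝ} (hp : p ∈ orbitInt a m) :
    kLapse a m p * muq a m p * expGamma a m (-2) p / qthth a m p = coTh a m p := by
  have hs := sin_pos_of_mem hp
  have h1 := sigma_pos (a := a) (delta_pos h hp.1).1
  have h2 := pi_pos h hp.1
  rw [lapse_muq h hp, expGamma_neg_two, expGamma_two h hp, qthth, coTh]
  field_simp

/-- N² q^{rr} is the squared radial coordinate speed of light. Its factorization into the weights of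
the gradient and momentum terms identifies J^a with the first-variation flux along the motion, and
later bounds that flux by the energy. -/
theorem lapse_sq_div_qrr {a m : ℝ} (h : |a| < m) {p : ℝ × ℝ} (hp : p ∈ orbitInt a m) :
    kLapse a m p ^ 2 / qrr a m p = coR a m p * coK a m p := by
  have hs := sin_pos_of_mem hp
  have hD := (delta_pos h hp.1).2
  have h1 := sigma_pos (a := a) (delta_pos h hp.1).1
  have h2 := pi_pos h hp.1
  rw [kLapse, mul_pow, Real.sq_sqrt hD.le, qrr, coR, coK]
  field_simp

theorem lapse_sq_div_qthth {a m : ℝ} (h : |a| < m) {p : ℝ × ℝ} (hp : p ∈ orbitInt a m) :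
    kLapse a m p ^ 2 / qthth a m p = coTh a m p * coK a m p := by
  have hs := sin_pos_of_mem hp
  have hD := (delta_pos h hp.1).2
  have h1 := sigma_pos (a := a) (delta_pos h hp.1).1
  have h2 := pi_pos h hp.1
  rw [kLapse, mul_pow, Real.sq_sqrt hD.le, qthth, coTh, coK]
  field_simp

/-! ### The field equations of the background -/

/-- `coTh` equals e^{-2γ} sin θ, so its logarithmic derivative is -2∂_θγ + cot θ. Likewise `coR` is
Δ e^{-2γ} sin θ. Keeping ∂γ in these derivatives exposes the cancellation in `dvg_gamma`. -/
theorem hasDerivAt_coTh_th {a m : ℝ} (h : |a| < m) {p : ℝ × ℝ} (hp : p ∈ orbitInt a m) :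
    HasDerivAt (fun θ => coTh a m (p.1, θ)) (-(2 * coTh a m p * gamTh a m p)
      + Real.cos p.2 / Real.sin p.2 * coTh a m p) p.2 := by
  have hs := sin_pos_of_mem hp
  have h1 := sigma_pos (a := a) (delta_pos h hp.1).1
  have h2 := pi_pos h hp.1
  have := (hasDerivAt_sigma_th a p).div
    ((Real.hasDerivAt_sin p.2).mul (hasDerivAt_pi_th a m p)) (mul_pos hs h2).ne'
  refine this.congr_deriv ?_
  simp only [coTh, gamTh, Prod.mk.eta, Pi.mul_apply]
  field_simp
  ring

theorem hasDerivAt_coR_r {a m : ℝ} (h : |a| < m) {p : ℝ × ℝ} (hp : p ∈ orbitInt a m) :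
    HasDerivAt (fun r => coR a m (r, p.2)) (-(2 * coR a m p * gamR a m p)
      + (2 * p.1 - 2 * m) * coTh a m p) p.1 := by
  have hs := sin_pos_of_mem hp
  have h1 := sigma_pos (a := a) (delta_pos h hp.1).1
  have h2 := pi_pos h hp.1
  have := ((hasDerivAt_delta_r a m p).mul (hasDerivAt_sigma_r a p)).div
    ((hasDerivAt_pi_r a m p).const_mul (Real.sin p.2)) (mul_pos hs h2).ne'
  refine this.congr_deriv ?_
  simp only [coTh, coR, gamR, Prod.mk.eta, Pi.mul_apply]
  field_simp
  ring

theorem hasDerivAt_gamR_r {a m : ℝ} (h : |a| < m) {p : ℝ × ℝ} (hp : p ∈ orbitInt a m) :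
    HasDerivAt (fun r => gamR a m (r, p.2))
      ((((12 * p.1 ^ 2 + 4 * a ^ 2 - 2 * a ^ 2 * Real.sin p.2 ^ 2) * kPi a m p - piR a m p ^ 2) /
        kPi a m p ^ 2 - (2 * kSigma a p - (2 * p.1) ^ 2) / kSigma a p ^ 2) / 2) p.1 := by
  have h1 := sigma_pos (a := a) (delta_pos h hp.1).1
  have h2 := pi_pos h hp.1
  have := (((hasDerivAt_piR_r a m p).div (hasDerivAt_pi_r a m p) h2.ne').sub
    (((hasDerivAt_id' p.1).const_mul 2).div (hasDerivAt_sigma_r a p) h1.ne')).div_const 2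
  refine this.congr_deriv ?_
  simp only [Prod.mk.eta]
  ring

theorem hasDerivAt_gamTh_th {a m : ℝ} (h : |a| < m) {p : ℝ × ℝ} (hp : p ∈ orbitInt a m) :
    HasDerivAt (fun θ => gamTh a m (p.1, θ))
      (-1 / Real.sin p.2 ^ 2 +
      ((-(a ^ 2 * kDelta a m p * (2 * (Real.cos p.2 ^ 2 - Real.sin p.2 ^ 2))) * kPi a m p
        - piTh a m p ^ 2) / kPi a m p ^ 2
        - (-(2 * a ^ 2 * (Real.cos p.2 ^ 2 - Real.sin p.2 ^ 2)) * kSigma a p - sigTh a p ^ 2)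
          / kSigma a p ^ 2) / 2) p.2 := by
  have hs := sin_pos_of_mem hp
  have h1 := sigma_pos (a := a) (delta_pos h hp.1).1
  have h2 := pi_pos h hp.1
  have := ((Real.hasDerivAt_cos p.2).div (Real.hasDerivAt_sin p.2) hs.ne').add
    ((((hasDerivAt_piTh_th a m p).div (hasDerivAt_pi_th a m p) h2.ne').sub
    ((hasDerivAt_sigTh_th a p).div (hasDerivAt_sigma_th a p) h1.ne')).div_const 2)
  refine this.congr_deriv ?_
  simp only [Prod.mk.eta]
  have e : -Real.sin p.2 * Real.sin p.2 - Real.cos p.2 * Real.cos p.2 = -1 := by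
    linarith [Real.sin_sq_add_cos_sq p.2]
  rw [e]; ring

/-- The Einstein equation for `γ`. -/
theorem dvg_gamma {a m : ℝ} (h : |a| < m) {p : ℝ × ℝ} (hp : p ∈ orbitInt a m) :
    dr (fun y => coR a m y * gamR a m y) p + dth (fun y => coTh a m y * gamTh a m y) p =
      -(coR a m p * (2 * gamR a m p ^ 2 + twR a m p ^ 2 / 2)
        + coTh a m p * (2 * gamTh a m p ^ 2 + twTh a m p ^ 2 / 2)) := by
  have hs := sin_pos_of_mem hp
  have h1 := sigma_pos (a := a) (delta_pos h hp.1).1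
  have h2 := pi_pos h hp.1
  have e1 : dr (fun y => coR a m y * gamR a m y) p = _ :=
    ((hasDerivAt_coR_r h hp).mul (hasDerivAt_gamR_r h hp)).deriv
  have e2 : dth (fun y => coTh a m y * gamTh a m y) p = _ :=
    ((hasDerivAt_coTh_th h hp).mul (hasDerivAt_gamTh_th h hp)).deriv
  have hc : coR a m p = kDelta a m p * coTh a m p := by rw [coR, coTh]; ring
  have ht : coTh a m p ≠ 0 := by rw [coTh]; positivity
  rw [e1, e2]
  simp only [Prod.mk.eta]
  rw [hc, ← sub_eq_zero]
  -- The terms -2|∂γ|² from differentiating e^{-2γ} match those on the right. After removal of the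
  -- factor `coTh`, an expression linear in ∂γ and its derivatives, plus half the squared twist, has
  -- to vanish.
  refine (?_ : _ = coTh a m p * _).trans (mul_eq_zero_of_right (coTh a m p)
    (b := (2 * p.1 - 2 * m) * gamR a m p + kDelta a m p *
      ((((12 * p.1 ^ 2 + 4 * a ^ 2 - 2 * a ^ 2 * Real.sin p.2 ^ 2) * kPi a m p - piR a m p ^ 2) /
        kPi a m p ^ 2 - (2 * kSigma a p - (2 * p.1) ^ 2) / kSigma a p ^ 2) / 2)
      + Real.cos p.2 / Real.sin p.2 * gamTh a m p + (-1 / Real.sin p.2 ^ 2 +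
      ((-(a ^ 2 * kDelta a m p * (2 * (Real.cos p.2 ^ 2 - Real.sin p.2 ^ 2))) * kPi a m p
        - piTh a m p ^ 2) / kPi a m p ^ 2
        - (-(2 * a ^ 2 * (Real.cos p.2 ^ 2 - Real.sin p.2 ^ 2)) * kSigma a p - sigTh a p ^ 2)
          / kSigma a p ^ 2) / 2)
      + (kDelta a m p * twR a m p ^ 2 + twTh a m p ^ 2) / 2) ?_)
  · ring
  simp only [gamR, gamTh, twR, twTh]
  field_simp
  -- With the even powers of the cosine expressed by the sine, the cleared identity is polynomial in
  -- independent quantities.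
  have h' : Real.cos p.2 ^ 2 = 1 - Real.sin p.2 ^ 2 := by
    linarith [Real.sin_sq_add_cos_sq p.2]
  have h4 : Real.cos p.2 ^ 4 = (1 - Real.sin p.2 ^ 2) ^ 2 := by
    rw [← h']; ring
  have h6 : Real.cos p.2 ^ 6 = (1 - Real.sin p.2 ^ 2) ^ 3 := by
    rw [← h']; ring
  simp only [kPi, piR, piTh, sigTh, kSigma, kDelta]
  ring_nf
  simp only [h', h4, h6]
  ring

/-- The equation `∂_b (N μ_q e^{-4γ} q^{ab} ∂_a ω) = 0`. -/
theorem dvg_tw {a m : ℝ} (h : |a| < m) {p : ℝ × ℝ} (hp : p ∈ orbitInt a m) :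
    dr (fun y => coR a m y * twR a m y) p + dth (fun y => coTh a m y * twTh a m y) p = 0 := by
  have h1 := sigma_pos (a := a) (delta_pos h hp.1).1
  have h2 := pi_pos h hp.1
  -- The products are ∂_θ𝒜₀ and -∂_r𝒜₀, so the equation expresses the equality of mixed derivatives
  -- of 𝒜₀. Here Σ is cancelled from both products before differentiating.
  have e1 : dr (fun y => coR a m y * twR a m y) p =
      deriv (fun r => -(4 * a ^ 3 * m * Real.cos p.2 * Real.sin p.2) *
        (kDelta a m (r, p.2) * r) / kPi a m (r, p.2) ^ 2) p.1 := by
    refine Filter.EventuallyEq.deriv_eq ?_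
    filter_upwards [isOpen_Ioi.mem_nhds hp.1] with r hr
    have hp' : (r, p.2) ∈ orbitInt a m := ⟨hr, hp.2⟩
    have hs := sin_pos_of_mem hp'
    have h1 := sigma_pos (a := a) (delta_pos h hp'.1).1
    have h2 := pi_pos h hp'.1
    simp only [coR, twR] at *
    field_simp
  have e2 : dth (fun y => coTh a m y * twTh a m y) p =
      deriv (fun θ => 2 * a * m * (kPi a m (p.1, θ) - p.1 * piR a m (p.1, θ))
        / kPi a m (p.1, θ) ^ 2) p.2 := by
    refine Filter.EventuallyEq.deriv_eq ?_
    filter_upwards [isOpen_Ioo.mem_nhds hp.2] with θ hθ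
    have hp' : (p.1, θ) ∈ orbitInt a m := ⟨hp.1, hθ⟩
    have hs := sin_pos_of_mem hp'
    have h1 := sigma_pos (a := a) (delta_pos h hp'.1).1
    have h2 := pi_pos h hp'.1
    simp only [coTh, twTh] at *
    field_simp
  rw [e1, e2]
  have d1 := ((((hasDerivAt_delta_r a m p).mul (hasDerivAt_id' p.1)).const_mul
    (-(4 * a ^ 3 * m * Real.cos p.2 * Real.sin p.2))).div
    ((hasDerivAt_pi_r a m p).pow 2) (pow_ne_zero 2 h2.ne')).deriv
  have d2 := ((((hasDerivAt_pi_th a m p).sub ((hasDerivAt_piR_th a m p).const_mul p.1)).const_mul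
    (2 * a * m)).div ((hasDerivAt_pi_th a m p).pow 2) (pow_ne_zero 2 h2.ne')).deriv
  refine (congrArg₂ (· + ·) d1 d2).trans ?_
  simp only [Prod.mk.eta, Pi.pow_apply, Pi.mul_apply, Pi.sub_apply]
  rw [← add_div, div_eq_zero_iff]
  left
  push_cast
  simp only [kPi, piR, piTh, kDelta]
  ring

/-- The numerator is a positive multiple of rΣ² + m a² sin²θ (Σ - 2r²). Since Σ ≥ r² and m a² ≤ m³ <
r³ outside the horizon, the first term wins. This makes the mass term of the energy definite for 0 <
s < 1. -/
theorem gamR_pos {a m : ℝ} (h : |a| < m) {p : ℝ × ℝ} (hp : p ∈ orbitInt a m) :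
    0 < gamR a m p := by
  obtain ⟨hr, hD⟩ := delta_pos h hp.1
  have h1 := sigma_pos (a := a) hr
  have h2 := pi_pos h hp.1
  have ha : a ^ 2 ≤ m ^ 2 := sq_le_sq' (by linarith [neg_abs_le a]) ((le_abs_self a).trans h.le)
  have hm : 0 < m := lt_of_le_of_lt (abs_nonneg a) h
  have hrm : m < p.1 := lt_of_le_of_lt
    (le_add_of_nonneg_right (Real.sqrt_nonneg _)) (show rPlus a m < p.1 from hp.1)
  have e : gamR a m p = (piR a m p * kSigma a p - kPi a m p * (2 * p.1)) /
      (2 * (kPi a m p * kSigma a p)) := by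
    rw [gamR]; field_simp
  rw [e]
  refine div_pos ?_ (by positivity)
  have hs1 := Real.sin_sq_le_one p.2
  have hs0 := sq_nonneg (Real.sin p.2)
  have hc0 := sq_nonneg (Real.cos p.2)
  have h' : Real.cos p.2 ^ 2 = 1 - Real.sin p.2 ^ 2 := by
    linarith [Real.sin_sq_add_cos_sq p.2]
  have key : piR a m p * kSigma a p - kPi a m p * (2 * p.1) =
      2 * (p.1 * kSigma a p ^ 2 + m * a ^ 2 * Real.sin p.2 ^ 2 * (kSigma a p - 2 * p.1 ^ 2)) := by
    simp only [piR, kPi, kSigma, kDelta, h']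
    ring
  rw [key]
  have hS : p.1 ^ 2 ≤ kSigma a p := by
    unfold kSigma; nlinarith [mul_nonneg (sq_nonneg a) hc0]
  have h3 : m * a ^ 2 < p.1 ^ 3 := by
    calc m * a ^ 2 ≤ m * m ^ 2 := by gcongr
      _ = m ^ 3 := by ring
      _ < p.1 ^ 3 := by gcongr
  have h4 : 0 ≤ m * a ^ 2 * Real.sin p.2 ^ 2 := by positivity
  have h5 : m * a ^ 2 * Real.sin p.2 ^ 2 ≤ m * a ^ 2 := mul_le_of_le_one_right (by positivity) hs1
  have h6 : m * a ^ 2 * Real.sin p.2 ^ 2 * (2 * p.1 ^ 2 - kSigma a p) ≤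
      m * a ^ 2 * Real.sin p.2 ^ 2 * p.1 ^ 2 := by gcongr; linarith
  have h7 : m * a ^ 2 * Real.sin p.2 ^ 2 * p.1 ^ 2 < p.1 ^ 3 * p.1 ^ 2 :=
    mul_lt_mul_of_pos_right (h5.trans_lt h3) (by positivity)
  have h8 : p.1 ^ 3 * p.1 ^ 2 ≤ p.1 * kSigma a p ^ 2 := by
    calc p.1 ^ 3 * p.1 ^ 2 = p.1 * (p.1 ^ 2) ^ 2 := by ring
      _ ≤ _ := by gcongr
  nlinarith

theorem coK_pos {a m : ℝ} (h : |a| < m) {p : ℝ × ℝ} (hp : p ∈ orbitInt a m) : 0 < coK a m p := by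
  have hs := sin_pos_of_mem hp
  obtain ⟨hr, hD⟩ := delta_pos h hp.1
  have h1 := sigma_pos (a := a) hr
  rw [coK]; positivity

theorem coR_pos {a m : ℝ} (h : |a| < m) {p : ℝ × ℝ} (hp : p ∈ orbitInt a m) : 0 < coR a m p := by
  have hs := sin_pos_of_mem hp
  obtain ⟨hr, hD⟩ := delta_pos h hp.1
  have h1 := sigma_pos (a := a) hr
  have h2 := pi_pos h hp.1
  rw [coR]; positivity

theorem coTh_pos {a m : ℝ} (h : |a| < m) {p : ℝ × ℝ} (hp : p ∈ orbitInt a m) :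
    0 < coTh a m p := by
  have hs := sin_pos_of_mem hp
  have h1 := sigma_pos (a := a) (delta_pos h hp.1).1
  have h2 := pi_pos h hp.1
  rw [coTh]; positivity


/-! ### The energy density as a quadratic form -/

/-- `r`-component of `∂η - 2(1-s)η∂γ + sλe^{-2γ}∂ω`. -/
def yEtaR (a m s : ℝ) (x : PhasePt) (p : ℝ × ℝ) : ℝ :=
  dr x.eta p - 2 * (1 - s) * x.eta p * gamR a m p + s * x.lam p * twR a m p

/-- `θ`-component of `∂η - 2(1-s)η∂γ + sλe^{-2γ}∂ω`. -/
def yEtaTh (a m s : ℝ) (x : PhasePt) (p : ℝ × ℝ) : ℝ :=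
  dth x.eta p - 2 * (1 - s) * x.eta p * gamTh a m p + s * x.lam p * twTh a m p

/-- `r`-component of `∂λ - 2sλ∂γ - (1-s)ηe^{-2γ}∂ω`. -/
def yLamR (a m s : ℝ) (x : PhasePt) (p : ℝ × ℝ) : ℝ :=
  dr x.lam p - 2 * s * x.lam p * gamR a m p - (1 - s) * x.eta p * twR a m p

/-- `θ`-component of `∂λ - 2sλ∂γ - (1-s)ηe^{-2γ}∂ω`. -/
def yLamTh (a m s : ℝ) (x : PhasePt) (p : ℝ × ℝ) : ℝ :=
  dth x.lam p - 2 * s * x.lam p * gamTh a m p - (1 - s) * x.eta p * twTh a m p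

/-- The symmetric bilinear form whose quadratic form is twice the energy density. -/
def polar (a m s : ℝ) (x δ : PhasePt) (p : ℝ × ℝ) : ℝ :=
  coK a m p * (x.u p * δ.u p + x.v p * δ.v p)
  + coR a m p * (yEtaR a m s x p * yEtaR a m s δ p + yLamR a m s x p * yLamR a m s δ p
      + 4 * (s * (1 - s)) * (gamR a m p ^ 2 + twR a m p ^ 2 / 4)
        * (x.lam p * δ.lam p + x.eta p * δ.eta p))
  + coTh a m p * (yEtaTh a m s x p * yEtaTh a m s δ p + yLamTh a m s x p * yLamTh a m s δ p
      + 4 * (s * (1 - s)) * (gamTh a m p ^ 2 + twTh a m p ^ 2 / 4)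
        * (x.lam p * δ.lam p + x.eta p * δ.eta p))

/-- `P q^{ab} (δη (Y_η)_b + δλ (Y_λ)_b)`. -/
def polarFlux (a m s : ℝ) (x δ : PhasePt) (p : ℝ × ℝ) : ℝ × ℝ :=
  (coR a m p * (δ.eta p * yEtaR a m s x p + δ.lam p * yLamR a m s x p),
   coTh a m p * (δ.eta p * yEtaTh a m s x p + δ.lam p * yLamTh a m s x p))

/-- For the vectors A = ∂η - 4(1-s)η∂γ and B = ∂η + 2sλW one has A² + B² = 2((A+B)/2)² + ½(A-B)²,
and (A+B)/2 is Y_η; the λ-pair is treated alike. In the sum of the two difference terms the products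
∂γ·W cancel, leaving (4|∂γ|² + |W|²)(s²λ² + (1-s)²η²)/2. The explicit mass term changes both
coefficients s² and (1-s)² to s(1-s). -/
theorem altDensity_eq {a m : ℝ} (h : |a| < m) (s : ℝ) (x : PhasePt) {p : ℝ × ℝ}
    (hp : p ∈ orbitInt a m) : altDensity a m s x p = polar a m s x x p / 2 := by
  have hg1 : dr (kGamma a m) p = gamR a m p := congrArg Prod.fst (grad_gamma h hp)
  have hg2 : dth (kGamma a m) p = gamTh a m p := congrArg Prod.snd (grad_gamma h hp)
  obtain ⟨ho1, ho2⟩ := grad_omega h hp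
  have hk := coK_eq h hp
  have hR := coR_eq h hp
  have hT := coTh_eq h hp
  have e4 : expGamma a m (-4) p = expGamma a m (-2) p ^ 2 := by
    rw [expGamma_neg_four, expGamma_neg_two, inv_pow]
  simp only [altDensity, qIn, polar, yEtaR, yEtaTh, yLamR, yLamTh, ← ho1, ← ho2, ← hk, ← hR, ← hT,
    grad, hg1, hg2, Prod.fst_sub, Prod.snd_sub, Prod.fst_add, Prod.snd_add, Prod.smul_fst,
    Prod.smul_snd, smul_eq_mul, e4]
  ring

theorem currentS_eq {a m : ℝ} (h : |a| < m) (s : ℝ) (x : PhasePt) {p : ℝ × ℝ}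
    (hp : p ∈ orbitInt a m) : currentS a m s x p =
      (-(coR a m p * coK a m p * (x.u p * yEtaR a m s x p + x.v p * yLamR a m s x p)),
       -(coTh a m p * coK a m p * (x.u p * yEtaTh a m s x p + x.v p * yLamTh a m s x p))) := by
  have hg1 : dr (kGamma a m) p = gamR a m p := congrArg Prod.fst (grad_gamma h hp)
  have hg2 : dth (kGamma a m) p = gamTh a m p := congrArg Prod.snd (grad_gamma h hp)
  obtain ⟨ho1, ho2⟩ := grad_omega h hp
  have hR := lapse_sq_div_qrr h hp
  have hT := lapse_sq_div_qthth h hp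
  refine Prod.ext ?_ ?_ <;>
  · simp only [currentS, qUp, yEtaR, yEtaTh, yLamR, yLamTh, ← ho1, ← ho2, ← hR, ← hT,
      grad, hg1, hg2, Prod.fst_sub, Prod.snd_sub, Prod.fst_add, Prod.snd_add, Prod.smul_fst,
      Prod.smul_snd, smul_eq_mul]
    ring

theorem polar_self_nonneg {a m : ℝ} (h : |a| < m) {s : ℝ} (hs : s ∈ Icc (0 : ℝ) 1) (x : PhasePt)
    {p : ℝ × ℝ} (hp : p ∈ orbitInt a m) : 0 ≤ polar a m s x x p := by
  have h1 := (coK_pos h hp).le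
  have h2 := (coR_pos h hp).le
  have h3 := (coTh_pos h hp).le
  have h4 : 0 ≤ s * (1 - s) := mul_nonneg hs.1 (sub_nonneg.2 hs.2)
  simp only [polar, ← sq]
  positivity

theorem altDensity_nonneg {a m : ℝ} (h : |a| < m) {s : ℝ} (hs : s ∈ Icc (0 : ℝ) 1) (x : PhasePt)
    {p : ℝ × ℝ} (hp : p ∈ orbitInt a m) : 0 ≤ altDensity a m s x p := by
  rw [altDensity_eq h s x hp]
  exact div_nonneg (polar_self_nonneg h hs x hp) zero_le_two

/-- Where the energy density vanishes, all its squares vanish. -/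
theorem eq_zero_of_polar_self {a m : ℝ} (h : |a| < m) {s : ℝ} (hs : s ∈ Icc (0 : ℝ) 1)
    {x : PhasePt} {p : ℝ × ℝ} (hp : p ∈ orbitInt a m) (h0 : altDensity a m s x p = 0) :
    x.u p = 0 ∧ x.v p = 0 ∧ yEtaR a m s x p = 0 ∧ yEtaTh a m s x p = 0 ∧
    yLamR a m s x p = 0 ∧ yLamTh a m s x p = 0 ∧
    (0 < s * (1 - s) → x.lam p = 0 ∧ x.eta p = 0) := by
  have h1 := coK_pos h hp
  have h2 := coR_pos h hp
  have h3 := coTh_pos h hp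
  have hg := gamR_pos h hp
  have h4 : 0 ≤ s * (1 - s) := mul_nonneg hs.1 (sub_nonneg.2 hs.2)
  rw [altDensity_eq h s x hp] at h0
  simp only [polar, ← sq] at h0
  set k := coK a m p
  set R := coR a m p
  set T := coTh a m p
  have hN1 : 0 ≤ 4 * (s * (1 - s)) * (gamR a m p ^ 2 + twR a m p ^ 2 / 4)
    * (x.lam p ^ 2 + x.eta p ^ 2) := by positivity
  have hN2 : 0 ≤ 4 * (s * (1 - s)) * (gamTh a m p ^ 2 + twTh a m p ^ 2 / 4)
    * (x.lam p ^ 2 + x.eta p ^ 2) := by positivity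
  have a1 : 0 ≤ k * x.u p ^ 2 := by positivity
  have a2 : 0 ≤ k * x.v p ^ 2 := by positivity
  have a3 : 0 ≤ R * yEtaR a m s x p ^ 2 := by positivity
  have a4 : 0 ≤ R * yLamR a m s x p ^ 2 := by positivity
  have a5 : 0 ≤ T * yEtaTh a m s x p ^ 2 := by positivity
  have a6 : 0 ≤ T * yLamTh a m s x p ^ 2 := by positivity
  have a7 := mul_nonneg h2.le hN1
  have a8 := mul_nonneg h3.le hN2
  have key : ∀ {c y : ℝ}, 0 < c → c * y ^ 2 ≤ 0 → y = 0 := by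
    intro c y hc hy
    have : y ^ 2 ≤ 0 := by
      by_contra hcon
      have := mul_pos hc (not_le.1 hcon)
      linarith
    exact pow_eq_zero_iff (two_ne_zero) |>.1 (le_antisymm this (sq_nonneg y))
  refine ⟨key h1 (by linarith), key h1 (by linarith), key h2 (by linarith), key h3 (by linarith),
    key h2 (by linarith), key h3 (by linarith), fun hpos => ?_⟩
  -- Strict positivity uses that ∂_rγ does not vanish; the twist term alone could be zero.
  have hc : 0 < R * (4 * (s * (1 - s)) * (gamR a m p ^ 2 + twR a m p ^ 2 / 4)) := by positivity
  have hle : R * (4 * (s * (1 - s)) * (gamR a m p ^ 2 + twR a m p ^ 2 / 4))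
      * (x.lam p ^ 2 + x.eta p ^ 2) ≤ 0 := by linarith
  have b1 := mul_nonneg hc.le (sq_nonneg (x.lam p))
  have b2 := mul_nonneg hc.le (sq_nonneg (x.eta p))
  rw [mul_add] at hle
  exact ⟨key hc (by linarith), key hc (by linarith)⟩

/-! ### Partial derivatives of smooth functions -/

theorem hasDerivAt_r_of_differentiableAt {f : ℝ × ℝ → ℝ} {p : ℝ × ℝ}
    (hf : DifferentiableAt ℝ f p) : HasDerivAt (fun r => f (r, p.2)) (fderiv ℝ f p (1, 0)) p.1 := by
  have h1 : HasDerivAt (fun r : ℝ => (r, p.2)) ((1 : ℝ), (0 : ℝ)) p.1 :=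
    (hasDerivAt_id' p.1).prodMk (hasDerivAt_const _ _)
  exact HasFDerivAt.comp_hasDerivAt p.1 (f := fun r : ℝ => (r, p.2)) hf.hasFDerivAt h1

theorem hasDerivAt_th_of_differentiableAt {f : ℝ × ℝ → ℝ} {p : ℝ × ℝ}
    (hf : DifferentiableAt ℝ f p) : HasDerivAt (fun θ => f (p.1, θ)) (fderiv ℝ f p (0, 1)) p.2 := by
  have h1 : HasDerivAt (fun θ : ℝ => (p.1, θ)) ((0 : ℝ), (1 : ℝ)) p.2 :=
    (hasDerivAt_const _ _).prodMk (hasDerivAt_id' p.2)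
  exact HasFDerivAt.comp_hasDerivAt p.2 (f := fun θ : ℝ => (p.1, θ)) hf.hasFDerivAt h1

theorem dr_eq_fderiv {f : ℝ × ℝ → ℝ} {p : ℝ × ℝ} (hf : DifferentiableAt ℝ f p) :
    dr f p = fderiv ℝ f p (1, 0) := (hasDerivAt_r_of_differentiableAt hf).deriv

theorem dth_eq_fderiv {f : ℝ × ℝ → ℝ} {p : ℝ × ℝ} (hf : DifferentiableAt ℝ f p) :
    dth f p = fderiv ℝ f p (0, 1) := (hasDerivAt_th_of_differentiableAt hf).deriv

theorem hasDerivAt_dr {f : ℝ × ℝ → ℝ} {p : ℝ × ℝ} (hf : DifferentiableAt ℝ f p) :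
    HasDerivAt (fun r => f (r, p.2)) (dr f p) p.1 :=
  (hasDerivAt_r_of_differentiableAt hf).differentiableAt.hasDerivAt

theorem hasDerivAt_dth {f : ℝ × ℝ → ℝ} {p : ℝ × ℝ} (hf : DifferentiableAt ℝ f p) :
    HasDerivAt (fun θ => f (p.1, θ)) (dth f p) p.2 :=
  (hasDerivAt_th_of_differentiableAt hf).differentiableAt.hasDerivAt

theorem ContDiffOn.diffAt {U : Set (ℝ × ℝ)} (hU : IsOpen U) {f : ℝ × ℝ → ℝ}
    (hf : ContDiffOn ℝ ∞ f U) {p : ℝ × ℝ} (hp : p ∈ U) : DifferentiableAt ℝ f p :=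
  (hf.differentiableOn (by simp)).differentiableAt (hU.mem_nhds hp)

theorem contDiffOn_dr {U : Set (ℝ × ℝ)} (hU : IsOpen U) {f : ℝ × ℝ → ℝ}
    (hf : ContDiffOn ℝ ∞ f U) : ContDiffOn ℝ ∞ (dr f) U :=
  ((hf.fderiv_of_isOpen hU (m := ∞) (by simp)).clm_apply contDiffOn_const).congr
    fun _ hp => dr_eq_fderiv (ContDiffOn.diffAt hU hf hp)

theorem contDiffOn_dth {U : Set (ℝ × ℝ)} (hU : IsOpen U) {f : ℝ × ℝ → ℝ}
    (hf : ContDiffOn ℝ ∞ f U) : ContDiffOn ℝ ∞ (dth f) U :=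
  ((hf.fderiv_of_isOpen hU (m := ∞) (by simp)).clm_apply contDiffOn_const).congr
    fun _ hp => dth_eq_fderiv (ContDiffOn.diffAt hU hf hp)

theorem dr_congr {a m : ℝ} {f g : ℝ × ℝ → ℝ} (hfg : EqOn f g (orbitInt a m)) {p : ℝ × ℝ}
    (hp : p ∈ orbitInt a m) : dr f p = dr g p := by
  refine Filter.EventuallyEq.deriv_eq ?_
  filter_upwards [isOpen_Ioi.mem_nhds hp.1] with r hr
  exact hfg (x := (r, p.2)) ⟨hr, hp.2⟩

theorem dth_congr {a m : ℝ} {f g : ℝ × ℝ → ℝ} (hfg : EqOn f g (orbitInt a m)) {p : ℝ × ℝ}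
    (hp : p ∈ orbitInt a m) : dth f p = dth g p := by
  refine Filter.EventuallyEq.deriv_eq ?_
  filter_upwards [isOpen_Ioo.mem_nhds hp.2] with r hr
  exact hfg (x := (p.1, r)) ⟨hp.1, hr⟩

theorem dvg_congr {a m : ℝ} {f g : ℝ × ℝ → ℝ × ℝ} (hfg : EqOn f g (orbitInt a m)) {p : ℝ × ℝ}
    (hp : p ∈ orbitInt a m) : dvg f p = dvg g p :=
  congrArg₂ (· + ·) (dr_congr (fun _ hx => congrArg Prod.fst (hfg hx)) hp)
    (dth_congr (fun _ hx => congrArg Prod.snd (hfg hx)) hp)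

/-! ### Smoothness of the coefficients -/

theorem contDiff_sigma (a : ℝ) : ContDiff ℝ ∞ (kSigma a) := by unfold kSigma; fun_prop

theorem contDiff_delta (a m : ℝ) : ContDiff ℝ ∞ (kDelta a m) := by unfold kDelta; fun_prop

theorem contDiff_kPi (a m : ℝ) : ContDiff ℝ ∞ (kPi a m) := by
  have := contDiff_delta a m
  unfold kPi; fun_prop

theorem contDiff_kPiR (a m : ℝ) : ContDiff ℝ ∞ (piR a m) := by unfold piR; fun_prop

theorem contDiff_kPiTh (a m : ℝ) : ContDiff ℝ ∞ (piTh a m) := by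
  have := contDiff_delta a m
  unfold piTh; fun_prop

theorem contDiff_sigTh (a : ℝ) : ContDiff ℝ ∞ (sigTh a) := by unfold sigTh; fun_prop

theorem smooth_coR {a m : ℝ} (h : |a| < m) : ContDiffOn ℝ ∞ (coR a m) (orbitInt a m) :=
  ((contDiff_delta a m).mul (contDiff_sigma a)).contDiffOn.div
    ((Real.contDiff_sin.comp contDiff_snd).mul (contDiff_kPi a m)).contDiffOn
    fun _ hp => (mul_pos (sin_pos_of_mem hp) (pi_pos h hp.1)).ne'

theorem smooth_coTh {a m : ℝ} (h : |a| < m) : ContDiffOn ℝ ∞ (coTh a m) (orbitInt a m) :=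
  (contDiff_sigma a).contDiffOn.div
    ((Real.contDiff_sin.comp contDiff_snd).mul (contDiff_kPi a m)).contDiffOn
    fun _ hp => (mul_pos (sin_pos_of_mem hp) (pi_pos h hp.1)).ne'

theorem smooth_coK {a m : ℝ} (h : |a| < m) : ContDiffOn ℝ ∞ (coK a m) (orbitInt a m) :=
  ((contDiff_delta a m).mul (Real.contDiff_sin.comp contDiff_snd)).contDiffOn.div
    (contDiff_sigma a).contDiffOn fun _ hp => (sigma_pos (delta_pos h hp.1).1).ne'

theorem smooth_gamR {a m : ℝ} (h : |a| < m) : ContDiffOn ℝ ∞ (gamR a m) (orbitInt a m) :=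
  (((contDiff_kPiR a m).contDiffOn.div (contDiff_kPi a m).contDiffOn
    fun _ hp => (pi_pos h hp.1).ne').sub
    ((contDiff_const.mul contDiff_fst).contDiffOn.div (contDiff_sigma a).contDiffOn
      fun _ hp => (sigma_pos (delta_pos h hp.1).1).ne')).div_const 2

theorem smooth_gamTh {a m : ℝ} (h : |a| < m) : ContDiffOn ℝ ∞ (gamTh a m) (orbitInt a m) :=
  ((Real.contDiff_cos.comp contDiff_snd).contDiffOn.div
    (Real.contDiff_sin.comp contDiff_snd).contDiffOn fun _ hp => (sin_pos_of_mem hp).ne').add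
  ((((contDiff_kPiTh a m).contDiffOn.div (contDiff_kPi a m).contDiffOn
    fun _ hp => (pi_pos h hp.1).ne').sub
    ((contDiff_sigTh a).contDiffOn.div (contDiff_sigma a).contDiffOn
      fun _ hp => (sigma_pos (delta_pos h hp.1).1).ne')).div_const 2)

theorem smooth_twR {a m : ℝ} (h : |a| < m) : ContDiffOn ℝ ∞ (twR a m) (orbitInt a m) := by
  refine ContDiffOn.div (ContDiff.contDiffOn ?_)
    ((contDiff_sigma a).mul (contDiff_kPi a m)).contDiffOn
    fun _ hp => (mul_pos (sigma_pos (delta_pos h hp.1).1) (pi_pos h hp.1)).ne'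
  fun_prop

theorem smooth_twTh {a m : ℝ} (h : |a| < m) : ContDiffOn ℝ ∞ (twTh a m) (orbitInt a m) := by
  have h1 := contDiff_kPi a m
  have h2 := contDiff_kPiR a m
  refine ContDiffOn.div (ContDiff.contDiffOn ?_)
    ((contDiff_sigma a).mul (contDiff_kPi a m)).contDiffOn
    fun _ hp => (mul_pos (sigma_pos (delta_pos h hp.1).1) (pi_pos h hp.1)).ne'
  fun_prop

/-! ### The divergence identities -/

/-- The state is smooth off the axis. -/
structure PhasePt.SmoothInt (a m : ℝ) (x : PhasePt) : Prop where
  lam : ContDiffOn ℝ ∞ x.lam (orbitInt a m)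
  v : ContDiffOn ℝ ∞ x.v (orbitInt a m)
  eta : ContDiffOn ℝ ∞ x.eta (orbitInt a m)
  u : ContDiffOn ℝ ∞ x.u (orbitInt a m)

theorem hamGrad_flux_eq {a m : ℝ} (h : |a| < m) (f : ℝ × ℝ → ℝ) {p : ℝ × ℝ}
    (hp : p ∈ orbitInt a m) :
    dvg (fun y => (kLapse a m y * expGamma a m (-2) y * muq a m y) • qUp a m y (grad f y)) p =
      dr (fun y => coR a m y * dr f y) p + dth (fun y => coTh a m y * dth f y) p := by
  rw [dvg_congr (g := fun y => (coR a m y * dr f y, coTh a m y * dth f y)) ?_ hp]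
  · rfl
  · intro y hy
    refine Prod.ext ?_ ?_
    · simp only [qUp, grad, Prod.smul_fst, smul_eq_mul, ← coR_eq h hy]; ring
    · simp only [qUp, grad, Prod.smul_snd, smul_eq_mul, ← coTh_eq h hy]; ring

theorem lapse_muq_qIn_omega {a m : ℝ} (h : |a| < m) {p : ℝ × ℝ} (hp : p ∈ orbitInt a m)
    (X : ℝ × ℝ) :
    kLapse a m p * muq a m p * expGamma a m (-4) p * qIn a m p (grad (kOmega a m) p) X =
      coR a m p * twR a m p * X.1 + coTh a m p * twTh a m p * X.2 := by
  obtain ⟨ho1, ho2⟩ := grad_omega h hp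
  have e4 : expGamma a m (-4) p = expGamma a m (-2) p ^ 2 := by
    rw [expGamma_neg_four, expGamma_neg_two, inv_pow]
  rw [← ho1, ← ho2, ← coR_eq h hp, ← coTh_eq h hp, e4, qIn]
  ring

theorem hamGrad_lam_eq {a m : ℝ} (h : |a| < m) (x : PhasePt) {p : ℝ × ℝ}
    (hp : p ∈ orbitInt a m) : (hamGrad a m x).lam p =
      -(dr (fun y => coR a m y * dr x.lam y) p + dth (fun y => coTh a m y * dth x.lam y) p)
      + (coR a m p * twR a m p * dr x.eta p + coTh a m p * twTh a m p * dth x.eta p) := by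
  simp only [hamGrad, hamGrad_flux_eq h x.lam hp, lapse_muq_qIn_omega h hp]
  rfl

theorem hamGrad_eta_eq {a m : ℝ} (h : |a| < m) (x : PhasePt) {p : ℝ × ℝ}
    (hp : p ∈ orbitInt a m) : (hamGrad a m x).eta p =
      -(dr (fun y => coR a m y * dr x.eta y) p + dth (fun y => coTh a m y * dth x.eta y) p)
      - (coR a m p * twR a m p * dr x.lam p + coTh a m p * twTh a m p * dth x.lam p) := by
  simp only [hamGrad, hamGrad_flux_eq h x.eta hp, lapse_muq_qIn_omega h hp]
  rfl

theorem hamGrad_u_eq {a m : ℝ} (h : |a| < m) (x : PhasePt) {p : ℝ × ℝ}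
    (hp : p ∈ orbitInt a m) : (hamGrad a m x).u p = coK a m p * x.u p := by
  simp only [hamGrad, coK_eq h hp]

theorem hamGrad_v_eq {a m : ℝ} (h : |a| < m) (x : PhasePt) {p : ℝ × ℝ}
    (hp : p ∈ orbitInt a m) : (hamGrad a m x).v p = coK a m p * x.v p := by
  simp only [hamGrad, coK_eq h hp]

/-- First variation of the energy density. -/
theorem polar_eq_pairing_add_dvg {a m : ℝ} (h : |a| < m) (s : ℝ) {x δ : PhasePt}
    (hx : x.SmoothInt a m) (hδ₁ : ContDiffOn ℝ ∞ δ.lam (orbitInt a m))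
    (hδ₂ : ContDiffOn ℝ ∞ δ.eta (orbitInt a m)) {p : ℝ × ℝ} (hp : p ∈ orbitInt a m) :
    polar a m s x δ p = pairing (hamGrad a m x) δ p + dvg (polarFlux a m s x δ) p := by
  have hO := isOpen_orbitInt a m
  have d : ∀ {f : ℝ × ℝ → ℝ}, ContDiffOn ℝ ∞ f (orbitInt a m) → DifferentiableAt ℝ f p :=
    fun hf => ContDiffOn.diffAt hO hf hp
  have r1 := hasDerivAt_dr (d hδ₁)
  have r2 := hasDerivAt_dr (d hδ₂)
  have r3 := hasDerivAt_dr (d hx.lam)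
  have r4 := hasDerivAt_dr (d hx.eta)
  -- Each weight is kept together with ∂λ, ∂η, ∂γ or W. Then the divergences of P∂λ and P∂η appear
  -- as in `hamGrad`, and those of P∂γ and PW as in the two background equations.
  have r5 := hasDerivAt_dr (d ((smooth_coR h).mul (contDiffOn_dr hO hx.lam)))
  have r6 := hasDerivAt_dr (d ((smooth_coR h).mul (contDiffOn_dr hO hx.eta)))
  have r7 := hasDerivAt_dr (d ((smooth_coR h).mul (smooth_gamR h)))
  have r8 := hasDerivAt_dr (d ((smooth_coR h).mul (smooth_twR h)))
  have t1 := hasDerivAt_dth (d hδ₁)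
  have t2 := hasDerivAt_dth (d hδ₂)
  have t3 := hasDerivAt_dth (d hx.lam)
  have t4 := hasDerivAt_dth (d hx.eta)
  have t5 := hasDerivAt_dth (d ((smooth_coTh h).mul (contDiffOn_dth hO hx.lam)))
  have t6 := hasDerivAt_dth (d ((smooth_coTh h).mul (contDiffOn_dth hO hx.eta)))
  have t7 := hasDerivAt_dth (d ((smooth_coTh h).mul (smooth_gamTh h)))
  have t8 := hasDerivAt_dth (d ((smooth_coTh h).mul (smooth_twTh h)))
  have eR : dr (fun y => (polarFlux a m s x δ y).1) p = _ :=
    (((r2.mul ((r6.sub ((r4.mul r7).const_mul (2 * (1 - s)))).add ((r3.mul r8).const_mul s))).add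
      (r1.mul ((r5.sub ((r3.mul r7).const_mul (2 * s))).sub
        ((r4.mul r8).const_mul (1 - s))))).congr_of_eventuallyEq
      (Filter.Eventually.of_forall fun r => by
        simp only [polarFlux, yEtaR, yLamR, Pi.add_apply, Pi.mul_apply, Pi.sub_apply]; ring)).deriv
  have eT : dth (fun y => (polarFlux a m s x δ y).2) p = _ :=
    (((t2.mul ((t6.sub ((t4.mul t7).const_mul (2 * (1 - s)))).add ((t3.mul t8).const_mul s))).add
      (t1.mul ((t5.sub ((t3.mul t7).const_mul (2 * s))).sub
        ((t4.mul t8).const_mul (1 - s))))).congr_of_eventuallyEq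
      (Filter.Eventually.of_forall fun r => by
        simp only [polarFlux, yEtaTh, yLamTh, Pi.add_apply, Pi.mul_apply, Pi.sub_apply];
        ring)).deriv
  have hg := dvg_gamma h hp
  have hw := dvg_tw h hp
  rw [dvg, eR, eT, pairing, hamGrad_lam_eq h x hp, hamGrad_eta_eq h x hp, hamGrad_u_eq h x hp,
    hamGrad_v_eq h x hp]
  simp only [Pi.add_apply, Pi.mul_apply, Pi.sub_apply, Prod.mk.eta] at *
  simp only [polar, yEtaR, yEtaTh, yLamR, yLamTh]
  change dr (coR a m * gamR a m) p + dth (coTh a m * gamTh a m) p = _ at hg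
  change dr (coR a m * twR a m) p + dth (coTh a m * twTh a m) p = _ at hw
  change _ = ((-(dr (coR a m * dr x.lam) p + dth (coTh a m * dth x.lam) p) + _) * _ + _
    + (-(dr (coR a m * dr x.eta) p + dth (coTh a m * dth x.eta) p) - _) * _ + _) + _
  -- The coefficients are, up to sign, those with which P∂γ and PW enter `polarFlux`. Inserting the
  -- background equations removes s from the remainder.
  linear_combination (2 * (1 - s) * x.eta p * δ.eta p + 2 * s * x.lam p * δ.lam p) * hg
    - (s * x.lam p * δ.eta p - (1 - s) * x.eta p * δ.lam p) * hw

/-- The generalized Robinson identity. -/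
theorem robinson_identity {a m : ℝ} (h : |a| < m) (s : ℝ) {x : PhasePt}
    (hx : x.SmoothInt a m) {p : ℝ × ℝ} (hp : p ∈ orbitInt a m) :
    altDensity a m s x p = subDensity a m s x p - dvg (robinsonFlux a m s x) p := by
  have hO := isOpen_orbitInt a m
  have d : ∀ {f : ℝ × ℝ → ℝ}, ContDiffOn ℝ ∞ f (orbitInt a m) → DifferentiableAt ℝ f p :=
    fun hf => ContDiffOn.diffAt hO hf hp
  have hF : EqOn (robinsonFlux a m s x) (fun y =>
      (coR a m y * gamR a m y * (s * x.lam y ^ 2 + (1 - s) * x.eta y ^ 2),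
       coTh a m y * gamTh a m y * (s * x.lam y ^ 2 + (1 - s) * x.eta y ^ 2))) (orbitInt a m) := by
    intro y hy
    refine Prod.ext ?_ ?_
    · simp only [robinsonFlux, grad_gamma h hy, qUp, Prod.smul_fst, smul_eq_mul, ← coR_eq h hy]
      ring
    · simp only [robinsonFlux, grad_gamma h hy, qUp, Prod.smul_snd, smul_eq_mul, ← coTh_eq h hy]
      ring
  have r3 := hasDerivAt_dr (d hx.lam)
  have r4 := hasDerivAt_dr (d hx.eta)
  have r7 := hasDerivAt_dr (d ((smooth_coR h).mul (smooth_gamR h)))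
  have t3 := hasDerivAt_dth (d hx.lam)
  have t4 := hasDerivAt_dth (d hx.eta)
  have t7 := hasDerivAt_dth (d ((smooth_coTh h).mul (smooth_gamTh h)))
  have eR : dr (fun y => coR a m y * gamR a m y * (s * x.lam y ^ 2 + (1 - s) * x.eta y ^ 2)) p = _
    := (r7.mul (((r3.pow 2).const_mul s).add ((r4.pow 2).const_mul (1 - s)))).deriv
  have eT : dth (fun y => coTh a m y * gamTh a m y * (s * x.lam y ^ 2 + (1 - s) * x.eta y ^ 2)) p
    = _ := (t7.mul (((t3.pow 2).const_mul s).add ((t4.pow 2).const_mul (1 - s)))).deriv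
  have hg := dvg_gamma h hp
  have hq1 := lapse_muq_qIn_omega h hp (grad x.eta p)
  have hq2 := lapse_muq_qIn_omega h hp (grad x.lam p)
  rw [dvg_congr hF hp, dvg, eR, eT, altDensity_eq h s x hp]
  simp only [Pi.add_apply, Pi.pow_apply, Prod.mk.eta] at *
  change dr (coR a m * gamR a m) p + dth (coTh a m * gamTh a m) p = _ at hg
  have e : subDensity a m s x p = coK a m p * (x.u p ^ 2 + x.v p ^ 2) / 2
      + (coR a m p * (dr x.lam p ^ 2 + dr x.eta p ^ 2)
        + coTh a m p * (dth x.lam p ^ 2 + dth x.eta p ^ 2)) / 2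
      + s * x.lam p * (coR a m p * twR a m p * dr x.eta p + coTh a m p * twTh a m p * dth x.eta p)
      - (1 - s) * x.eta p *
        (coR a m p * twR a m p * dr x.lam p + coTh a m p * twTh a m p * dth x.lam p) := by
    simp only [grad] at hq1 hq2
    rw [← hq1, ← hq2, ← coK_eq h hp, ← coR_eq h hp, ← coTh_eq h hp]
    simp only [subDensity, qIn, grad]
    ring
  rw [e]
  simp only [polar, yEtaR, yEtaTh, yLamR, yLamTh]
  push_cast
  -- Only the equation for γ is needed: the coupling terms of `subDensity` are not integrated by
  -- parts.
  linear_combination (s * x.lam p ^ 2 + (1 - s) * x.eta p ^ 2) * hg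


/-! ### Functions of `(t, r, θ)` with prescribed order at the axis -/

/-- Space-time points off the axis. -/
def stInt (a m : ℝ) : Set (ℝ × (ℝ × ℝ)) := univ ×ˢ orbitInt a m

/-- Space-time points, the axis included. -/
def stOrb (a m : ℝ) : Set (ℝ × (ℝ × ℝ)) := univ ×ˢ orbit a m

/-- The direction `∂_t`. -/
def dirT : ℝ × (ℝ × ℝ) := (1, (0, 0))

/-- The direction `∂_r`. -/
def dirR : ℝ × (ℝ × ℝ) := (0, (1, 0))

/-- The direction `∂_θ`. -/
def dirTh : ℝ × (ℝ × ℝ) := (0, (0, 1))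

theorem isOpen_stInt (a m : ℝ) : IsOpen (stInt a m) := isOpen_univ.prod (isOpen_orbitInt a m)

theorem orbitInt_subset_orbit (a m : ℝ) : orbitInt a m ⊆ orbit a m :=
  prod_mono_right Ioo_subset_Icc_self

theorem stInt_subset_stOrb (a m : ℝ) : stInt a m ⊆ stOrb a m :=
  prod_mono_right (orbitInt_subset_orbit a m)

theorem stOrb_mem_nhds {a m : ℝ} {z : ℝ × (ℝ × ℝ)} (hz : z ∈ stInt a m) : stOrb a m ∈ nhds z :=
  Filter.mem_of_superset ((isOpen_stInt a m).mem_nhds hz) (stInt_subset_stOrb a m)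

theorem uniqueDiffOn_orbit (a m : ℝ) : UniqueDiffOn ℝ (orbit a m) :=
  (isOpen_Ioi.uniqueDiffOn).prod (uniqueDiffOn_Icc Real.pi_pos)

theorem uniqueDiffOn_stOrb (a m : ℝ) : UniqueDiffOn ℝ (stOrb a m) :=
  uniqueDiffOn_univ.prod (uniqueDiffOn_orbit a m)

theorem differentiableAt_of_stInt {a m : ℝ} {f : ℝ × (ℝ × ℝ) → ℝ}
    (hf : ContDiffOn ℝ ∞ f (stInt a m)) {z : ℝ × (ℝ × ℝ)} (hz : z ∈ stInt a m) :
    DifferentiableAt ℝ f z :=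
  (hf.differentiableOn (by simp)).differentiableAt ((isOpen_stInt a m).mem_nhds hz)

theorem contDiffOn_fderiv_dir {a m : ℝ} {f : ℝ × (ℝ × ℝ) → ℝ}
    (hf : ContDiffOn ℝ ∞ f (stInt a m)) (e : ℝ × (ℝ × ℝ)) :
    ContDiffOn ℝ ∞ (fun z => fderiv ℝ f z e) (stInt a m) :=
  (hf.fderiv_of_isOpen (isOpen_stInt a m) (m := ∞) (by simp)).clm_apply contDiffOn_const

theorem contDiffOn_fderivWithin_dir {a m : ℝ} {f : ℝ × (ℝ × ℝ) → ℝ}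
    (hf : ContDiffOn ℝ ∞ f (stOrb a m)) (e : ℝ × (ℝ × ℝ)) :
    ContDiffOn ℝ ∞ (fun z => fderivWithin ℝ f (stOrb a m) z e) (stOrb a m) :=
  (hf.fderivWithin (uniqueDiffOn_stOrb a m) (m := ∞) (by simp)).clm_apply contDiffOn_const

theorem fderivWithin_stOrb {a m : ℝ} {f : ℝ × (ℝ × ℝ) → ℝ} {z : ℝ × (ℝ × ℝ)}
    (hz : z ∈ stInt a m) : fderivWithin ℝ f (stOrb a m) z = fderiv ℝ f z :=
  fderivWithin_of_mem_nhds (stOrb_mem_nhds hz)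

theorem fderiv_comm {a m : ℝ} {f : ℝ × (ℝ × ℝ) → ℝ} (hf : ContDiffOn ℝ ∞ f (stInt a m))
    {z : ℝ × (ℝ × ℝ)} (hz : z ∈ stInt a m) (e e' : ℝ × (ℝ × ℝ)) :
    fderiv ℝ (fun z => fderiv ℝ f z e) z e' = fderiv ℝ (fun z => fderiv ℝ f z e') z e := by
  have hc : ContDiffAt ℝ ∞ f z := hf.contDiffAt ((isOpen_stInt a m).mem_nhds hz)
  have hs : IsSymmSndFDerivAt ℝ f z := hc.isSymmSndFDerivAt
    (by simpa using (WithTop.coe_le_coe.2 le_top : ((2 : ℕ∞) : WithTop ℕ∞) ≤ ∞))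
  have hd : DifferentiableAt ℝ (fderiv ℝ f) z :=
    (hc.fderiv_right (m := ∞) (by simp)).differentiableAt (by simp)
  rw [fderiv_clm_apply hd (differentiableAt_const _), fderiv_clm_apply hd (differentiableAt_const _)]
  simpa using hs e' e

theorem hasDerivAt_dirT {f : ℝ × (ℝ × ℝ) → ℝ} {z : ℝ × (ℝ × ℝ)} (hf : DifferentiableAt ℝ f z) :
    HasDerivAt (fun t => f (t, z.2)) (fderiv ℝ f z dirT) z.1 := by
  have h1 : HasDerivAt (fun t : ℝ => (t, z.2)) dirT z.1 :=
    (hasDerivAt_id' z.1).prodMk (hasDerivAt_const _ _)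
  exact HasFDerivAt.comp_hasDerivAt z.1 (f := fun t : ℝ => (t, z.2)) hf.hasFDerivAt h1

theorem hasDerivAt_dirR {f : ℝ × (ℝ × ℝ) → ℝ} {z : ℝ × (ℝ × ℝ)} (hf : DifferentiableAt ℝ f z) :
    HasDerivAt (fun r => f (z.1, (r, z.2.2))) (fderiv ℝ f z dirR) z.2.1 := by
  have h1 : HasDerivAt (fun r : ℝ => (z.1, (r, z.2.2))) dirR z.2.1 :=
    (hasDerivAt_const _ _).prodMk ((hasDerivAt_id' _).prodMk (hasDerivAt_const _ _))
  exact HasFDerivAt.comp_hasDerivAt z.2.1 (f := fun r : ℝ => (z.1, (r, z.2.2))) hf.hasFDerivAt h1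

theorem hasDerivAt_dirTh {f : ℝ × (ℝ × ℝ) → ℝ} {z : ℝ × (ℝ × ℝ)} (hf : DifferentiableAt ℝ f z) :
    HasDerivAt (fun θ => f (z.1, (z.2.1, θ))) (fderiv ℝ f z dirTh) z.2.2 := by
  have h1 : HasDerivAt (fun θ : ℝ => (z.1, (z.2.1, θ))) dirTh z.2.2 :=
    (hasDerivAt_const _ _).prodMk ((hasDerivAt_const _ _).prodMk (hasDerivAt_id' _))
  exact HasFDerivAt.comp_hasDerivAt z.2.2 (f := fun θ : ℝ => (z.1, (z.2.1, θ))) hf.hasFDerivAt h1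

/-- `f = O(sin^n θ)`, locally uniformly in `(t, r)`. -/
def AxBdd (a m : ℝ) (n : ℤ) (f : ℝ × (ℝ × ℝ) → ℝ) : Prop :=
  ∀ T r₁ r₂, rPlus a m < r₁ → ∃ C, 0 ≤ C ∧ ∀ t p, |t| ≤ T → p ∈ orbitInt a m →
    p.1 ∈ Icc r₁ r₂ → |f (t, p)| ≤ C * Real.sin p.2 ^ n

theorem AxBdd.add {a m : ℝ} {n : ℤ} {f g : ℝ × (ℝ × ℝ) → ℝ} (hf : AxBdd a m n f)
    (hg : AxBdd a m n g) : AxBdd a m n (fun z => f z + g z) := by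
  intro T r₁ r₂ hr
  obtain ⟨C, hC, h1⟩ := hf T r₁ r₂ hr
  obtain ⟨D, hD, h2⟩ := hg T r₁ r₂ hr
  refine ⟨C + D, add_nonneg hC hD, fun t p ht hp hpr => ?_⟩
  rw [add_mul]
  exact (abs_add_le _ _).trans (add_le_add (h1 t p ht hp hpr) (h2 t p ht hp hpr))

theorem AxBdd.mul {a m : ℝ} {n k : ℤ} {f g : ℝ × (ℝ × ℝ) → ℝ} (hf : AxBdd a m n f)
    (hg : AxBdd a m k g) : AxBdd a m (n + k) (fun z => f z * g z) := by
  intro T r₁ r₂ hr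
  obtain ⟨C, hC, h1⟩ := hf T r₁ r₂ hr
  obtain ⟨D, hD, h2⟩ := hg T r₁ r₂ hr
  refine ⟨C * D, mul_nonneg hC hD, fun t p ht hp hpr => ?_⟩
  have hs := sin_pos_of_mem hp
  rw [abs_mul, zpow_add₀ hs.ne']
  calc |f (t, p)| * |g (t, p)| ≤ (C * Real.sin p.2 ^ n) * (D * Real.sin p.2 ^ k) :=
        mul_le_mul (h1 t p ht hp hpr) (h2 t p ht hp hpr) (abs_nonneg _) (by positivity)
    _ = _ := by ring

theorem AxBdd.mono {a m : ℝ} {n k : ℤ} {f : ℝ × (ℝ × ℝ) → ℝ} (hf : AxBdd a m n f)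
    (hk : k ≤ n) : AxBdd a m k f := by
  intro T r₁ r₂ hr
  obtain ⟨C, hC, h1⟩ := hf T r₁ r₂ hr
  refine ⟨C, hC, fun t p ht hp hpr => (h1 t p ht hp hpr).trans ?_⟩
  have hs := sin_pos_of_mem hp
  exact mul_le_mul_of_nonneg_left
    (zpow_le_zpow_right_of_le_one₀ hs (Real.sin_le_one _) hk) hC

theorem AxBdd.congr {a m : ℝ} {n : ℤ} {f g : ℝ × (ℝ × ℝ) → ℝ} (hf : AxBdd a m n f)
    (hfg : EqOn g f (stInt a m)) : AxBdd a m n g := by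
  intro T r₁ r₂ hr
  obtain ⟨C, hC, h1⟩ := hf T r₁ r₂ hr
  refine ⟨C, hC, fun t p ht hp hpr => ?_⟩
  rw [hfg (x := (t, p)) ⟨mem_univ _, hp⟩]
  exact h1 t p ht hp hpr

/-- `f` is smooth off the axis, `f`, `∂_t f`, `∂_r f` are `O(sin^n θ)` and `∂_θ f` is
`O(sin^(n-1) θ)`. -/
structure Ax (a m : ℝ) (n : ℤ) (f : ℝ × (ℝ × ℝ) → ℝ) : Prop where
  smooth : ContDiffOn ℝ ∞ f (stInt a m)
  bdd : AxBdd a m n f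
  bddT : AxBdd a m n (fun z => fderiv ℝ f z dirT)
  bddR : AxBdd a m n (fun z => fderiv ℝ f z dirR)
  bddTh : AxBdd a m (n - 1) (fun z => fderiv ℝ f z dirTh)

theorem Ax.diff {a m : ℝ} {n : ℤ} {f : ℝ × (ℝ × ℝ) → ℝ} (hf : Ax a m n f) {z : ℝ × (ℝ × ℝ)}
    (hz : z ∈ stInt a m) : DifferentiableAt ℝ f z := differentiableAt_of_stInt hf.smooth hz

theorem Ax.add {a m : ℝ} {n : ℤ} {f g : ℝ × (ℝ × ℝ) → ℝ} (hf : Ax a m n f)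
    (hg : Ax a m n g) : Ax a m n (fun z => f z + g z) := by
  have key : ∀ e z, z ∈ stInt a m → fderiv ℝ (fun z => f z + g z) z e =
      fderiv ℝ f z e + fderiv ℝ g z e := fun e z hz => by
    rw [fderiv_fun_add (hf.diff hz) (hg.diff hz)]; rfl
  exact ⟨hf.smooth.add hg.smooth, hf.bdd.add hg.bdd, (hf.bddT.add hg.bddT).congr (key _),
    (hf.bddR.add hg.bddR).congr (key _), (hf.bddTh.add hg.bddTh).congr (key _)⟩

theorem Ax.mul {a m : ℝ} {n k : ℤ} {f g : ℝ × (ℝ × ℝ) → ℝ} (hf : Ax a m n f)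
    (hg : Ax a m k g) : Ax a m (n + k) (fun z => f z * g z) := by
  have key : ∀ e z, z ∈ stInt a m → fderiv ℝ (fun z => f z * g z) z e =
      f z * fderiv ℝ g z e + g z * fderiv ℝ f z e := fun e z hz => by
    rw [fderiv_fun_mul (hf.diff hz) (hg.diff hz)]; simp
  refine ⟨hf.smooth.mul hg.smooth, hf.bdd.mul hg.bdd, AxBdd.congr ?_ (key _),
    AxBdd.congr ?_ (key _), AxBdd.congr ?_ (key _)⟩
  · exact (hf.bdd.mul hg.bddT).add ((hg.bdd.mul hf.bddT).mono (by omega))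
  · exact (hf.bdd.mul hg.bddR).add ((hg.bdd.mul hf.bddR).mono (by omega))
  · exact ((hf.bdd.mul hg.bddTh).mono (by omega)).add ((hg.bdd.mul hf.bddTh).mono (by omega))

theorem Ax.mono {a m : ℝ} {n k : ℤ} {f : ℝ × (ℝ × ℝ) → ℝ} (hf : Ax a m n f)
    (hk : k ≤ n) : Ax a m k f :=
  ⟨hf.smooth, hf.bdd.mono hk, hf.bddT.mono hk, hf.bddR.mono hk, hf.bddTh.mono (by omega)⟩

theorem Ax.congr {a m : ℝ} {n : ℤ} {f g : ℝ × (ℝ × ℝ) → ℝ} (hf : Ax a m n f)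
    (hfg : EqOn g f (stInt a m)) : Ax a m n g := by
  have key : ∀ e, EqOn (fun z => fderiv ℝ g z e) (fun z => fderiv ℝ f z e) (stInt a m) :=
    fun e z hz => by
      have : g =ᶠ[nhds z] f := hfg.eventuallyEq_of_mem ((isOpen_stInt a m).mem_nhds hz)
      simp only [this.fderiv_eq]
  exact ⟨hf.smooth.congr hfg, hf.bdd.congr hfg, hf.bddT.congr (key _), hf.bddR.congr (key _),
    hf.bddTh.congr (key _)⟩

theorem axBdd_of_continuousOn {a m : ℝ} {f : ℝ × (ℝ × ℝ) → ℝ} (hf : ContinuousOn f (stOrb a m)) :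
    AxBdd a m 0 f := by
  intro T r₁ r₂ hr
  have hK : IsCompact ((Icc (-T) T) ×ˢ ((Icc r₁ r₂) ×ˢ (Icc 0 Real.pi))) :=
    isCompact_Icc.prod (isCompact_Icc.prod isCompact_Icc)
  have hsub : (Icc (-T) T) ×ˢ ((Icc r₁ r₂) ×ˢ (Icc 0 Real.pi)) ⊆ stOrb a m :=
    fun z hz => ⟨mem_univ _, lt_of_lt_of_le hr hz.2.1.1, hz.2.2⟩
  obtain ⟨C, hC⟩ := hK.exists_bound_of_continuousOn (hf.mono hsub)
  refine ⟨|C|, abs_nonneg _, fun t p ht hp hpr => ?_⟩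
  rw [zpow_zero, mul_one]
  exact (hC (t, p) ⟨abs_le.1 ht, hpr, hp.2.1.le, hp.2.2.le⟩).trans (le_abs_self C)

/-- The values on the axis vanish. -/
def AxisZero (a m : ℝ) (f : ℝ × (ℝ × ℝ) → ℝ) : Prop :=
  ∀ t r, rPlus a m < r → f (t, (r, 0)) = 0 ∧ f (t, (r, Real.pi)) = 0

/-- The mean value theorem, applied from the nearer pole, gains the distance to that pole. Jordan's
inequality bounds the distance by (π/2) sin θ. The equator separates the cases because the sine is
monotone on each half. -/
theorem AxBdd.integrate {a m : ℝ} {n : ℕ} {f : ℝ × (ℝ × ℝ) → ℝ}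
    (hf : ContDiffOn ℝ ∞ f (stOrb a m)) (h0 : AxisZero a m f)
    (hb : AxBdd a m n (fun z => fderiv ℝ f z dirTh)) : AxBdd a m (n + 1) f := by
  intro T r₁ r₂ hr
  obtain ⟨C, hC, h1⟩ := hb T r₁ r₂ hr
  refine ⟨C * (Real.pi / 2), by positivity, fun t p ht hp hpr => ?_⟩
  have hpi := Real.pi_pos
  have hcont : ContinuousOn (fun θ => f (t, (p.1, θ))) (Icc 0 Real.pi) :=
    hf.continuousOn.comp (by fun_prop) fun θ hθ => ⟨mem_univ _, hp.1, hθ⟩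
  have hd : ∀ θ ∈ Ioo 0 Real.pi,
      HasDerivAt (fun θ => f (t, (p.1, θ))) (fderiv ℝ f (t, (p.1, θ)) dirTh) θ := fun θ hθ =>
    hasDerivAt_dirTh (z := (t, (p.1, θ)))
      (differentiableAt_of_stInt (hf.mono (stInt_subset_stOrb a m)) ⟨mem_univ _, hp.1, hθ⟩)
  have hs := sin_pos_of_mem hp
  rw [zpow_add_one₀ hs.ne', zpow_natCast]
  have hbd : ∀ θ ∈ Ioo 0 Real.pi, |fderiv ℝ f (t, (p.1, θ)) dirTh| ≤ C * Real.sin θ ^ n :=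
    fun θ hθ => by simpa using h1 t (p.1, θ) ht ⟨hp.1, hθ⟩ hpr
  rcases le_total p.2 (Real.pi / 2) with hle | hle
  · obtain ⟨c, hc, he⟩ := exists_hasDerivAt_eq_slope _ _ hp.2.1
      (hcont.mono (Icc_subset_Icc_right hp.2.2.le))
      fun θ hθ => hd θ ⟨hθ.1, hθ.2.trans hp.2.2⟩
    rw [(h0 t p.1 hp.1).1, sub_zero, sub_zero, eq_div_iff hp.2.1.ne'] at he
    have hcs : Real.sin c ≤ Real.sin p.2 :=
      Real.sin_le_sin_of_le_of_le_pi_div_two (by linarith [hc.1]) hle hc.2.le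
    have hcs0 : 0 ≤ Real.sin c :=
      (Real.sin_pos_of_pos_of_lt_pi hc.1 (hc.2.trans hp.2.2)).le
    have hj := Real.mul_le_sin hp.2.1.le hle
    have hj' : p.2 ≤ Real.pi / 2 * Real.sin p.2 := by
      have := mul_le_mul_of_nonneg_left hj (by positivity : 0 ≤ Real.pi / 2)
      calc p.2 = Real.pi / 2 * (2 / Real.pi * p.2) := by field_simp
        _ ≤ _ := this
    calc |f (t, p)| = |fderiv ℝ f (t, (p.1, c)) dirTh| * p.2 := by
          change |f (t, (p.1, p.2))| = _
          rw [← he, abs_mul, abs_of_pos hp.2.1]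
      _ ≤ (C * Real.sin p.2 ^ n) * (Real.pi / 2 * Real.sin p.2) := by
          refine mul_le_mul ((hbd c ⟨hc.1, hc.2.trans hp.2.2⟩).trans ?_) hj' hp.2.1.le
            (by positivity)
          gcongr
      _ = _ := by ring
  · obtain ⟨c, hc, he⟩ := exists_hasDerivAt_eq_slope _ _ hp.2.2
      (hcont.mono (Icc_subset_Icc_left hp.2.1.le))
      fun θ hθ => hd θ ⟨hp.2.1.trans hθ.1, hθ.2⟩
    have hpos : 0 < Real.pi - p.2 := sub_pos.2 hp.2.2
    rw [(h0 t p.1 hp.1).2, zero_sub, eq_div_iff hpos.ne'] at he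
    have hcs : Real.sin c ≤ Real.sin p.2 := by
      rw [← Real.sin_pi_sub c, ← Real.sin_pi_sub p.2]
      exact Real.sin_le_sin_of_le_of_le_pi_div_two (by linarith [hc.2]) (by linarith)
        (by linarith [hc.1])
    have hcs0 : 0 ≤ Real.sin c :=
      (Real.sin_pos_of_pos_of_lt_pi (hp.2.1.trans hc.1) hc.2).le
    have hj := Real.mul_le_sin hpos.le (by linarith)
    rw [Real.sin_pi_sub] at hj
    have hj' : Real.pi - p.2 ≤ Real.pi / 2 * Real.sin p.2 := by
      have := mul_le_mul_of_nonneg_left hj (by positivity : 0 ≤ Real.pi / 2)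
      calc Real.pi - p.2 = Real.pi / 2 * (2 / Real.pi * (Real.pi - p.2)) := by field_simp
        _ ≤ _ := this
    calc |f (t, p)| = |fderiv ℝ f (t, (p.1, c)) dirTh| * (Real.pi - p.2) := by
          change |f (t, (p.1, p.2))| = _
          rw [← abs_neg, ← he, abs_mul, abs_of_pos hpos]
      _ ≤ (C * Real.sin p.2 ^ n) * (Real.pi / 2 * Real.sin p.2) := by
          refine mul_le_mul ((hbd c ⟨hp.2.1.trans hc.1, hc.2⟩).trans ?_) hj' hpos.le
            (by positivity)
          gcongr
      _ = _ := by ring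

theorem axBdd_fderiv {a m : ℝ} {f : ℝ × (ℝ × ℝ) → ℝ} (hf : ContDiffOn ℝ ∞ f (stOrb a m))
    (e : ℝ × (ℝ × ℝ)) : AxBdd a m 0 (fun z => fderiv ℝ f z e) :=
  (axBdd_of_continuousOn (contDiffOn_fderivWithin_dir hf e).continuousOn).congr
    fun _ hz => by simp only [fderivWithin_stOrb hz]

theorem ax_zero {a m : ℝ} {f : ℝ × (ℝ × ℝ) → ℝ} (hf : ContDiffOn ℝ ∞ f (stOrb a m)) :
    Ax a m 0 f :=
  ⟨hf.mono (stInt_subset_stOrb a m), axBdd_of_continuousOn hf.continuousOn, axBdd_fderiv hf _,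
    axBdd_fderiv hf _, (axBdd_fderiv hf _).mono (by omega)⟩

/-- ∂_t is tangential to the axis, so it preserves the vanishing there. Smoothness is assumed only
up to the axis, hence derivatives within the closed region. -/
theorem AxisZero.fderivWithin_dirT {a m : ℝ} {f : ℝ × (ℝ × ℝ) → ℝ}
    (hf : ContDiffOn ℝ ∞ f (stOrb a m)) (h0 : AxisZero a m f) :
    AxisZero a m (fun z => fderivWithin ℝ f (stOrb a m) z dirT) := by
  have key : ∀ θ ∈ Icc 0 Real.pi, (∀ t r, rPlus a m < r → f (t, (r, θ)) = 0) → ∀ t r,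
      rPlus a m < r → fderivWithin ℝ f (stOrb a m) (t, (r, θ)) dirT = 0 := by
    intro θ hθ hz t r hr
    have hd := (hf.differentiableOn (by simp) (t, (r, θ)) ⟨mem_univ _, hr, hθ⟩).hasFDerivWithinAt
    have h1 : HasDerivWithinAt (fun t : ℝ => (t, (r, θ))) dirT univ t :=
      ((hasDerivAt_id' t).prodMk (hasDerivAt_const _ _)).hasDerivWithinAt
    have h2 := hd.comp_hasDerivWithinAt t (f := fun t : ℝ => (t, (r, θ))) h1
      fun x _ => ⟨mem_univ _, hr, hθ⟩
    have h3 : f ∘ (fun t : ℝ => (t, (r, θ))) = fun _ => 0 := funext fun x => hz x r hr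
    rw [h3, hasDerivWithinAt_univ] at h2
    exact h2.unique (hasDerivAt_const _ _)
  exact fun t r hr => ⟨key 0 ⟨le_rfl, Real.pi_pos.le⟩ (fun t r hr => (h0 t r hr).1) t r hr,
    key Real.pi ⟨Real.pi_pos.le, le_rfl⟩ (fun t r hr => (h0 t r hr).2) t r hr⟩

theorem AxisZero.fderivWithin_dirR {a m : ℝ} {f : ℝ × (ℝ × ℝ) → ℝ}
    (hf : ContDiffOn ℝ ∞ f (stOrb a m)) (h0 : AxisZero a m f) :
    AxisZero a m (fun z => fderivWithin ℝ f (stOrb a m) z dirR) := by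
  have key : ∀ θ ∈ Icc 0 Real.pi, (∀ t r, rPlus a m < r → f (t, (r, θ)) = 0) → ∀ t r,
      rPlus a m < r → fderivWithin ℝ f (stOrb a m) (t, (r, θ)) dirR = 0 := by
    intro θ hθ hz t r hr
    have hd := (hf.differentiableOn (by simp) (t, (r, θ)) ⟨mem_univ _, hr, hθ⟩).hasFDerivWithinAt
    have h1 : HasDerivWithinAt (fun r : ℝ => (t, (r, θ))) dirR (Ioi (rPlus a m)) r :=
      ((hasDerivAt_const _ _).prodMk
        ((hasDerivAt_id' r).prodMk (hasDerivAt_const _ _))).hasDerivWithinAt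
    have h2 := hd.comp_hasDerivWithinAt r (f := fun r : ℝ => (t, (r, θ))) h1
      fun x hx => ⟨mem_univ _, hx, hθ⟩
    have h3 := (h2.hasDerivAt (Ioi_mem_nhds hr)).congr_of_eventuallyEq (f₁ := fun _ => 0) (by
      filter_upwards [Ioi_mem_nhds hr] with x hx using (hz t x hx).symm)
    exact h3.unique (hasDerivAt_const _ _)
  exact fun t r hr => ⟨key 0 ⟨le_rfl, Real.pi_pos.le⟩ (fun t r hr => (h0 t r hr).1) t r hr,
    key Real.pi ⟨Real.pi_pos.le, le_rfl⟩ (fun t r hr => (h0 t r hr).2) t r hr⟩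

theorem axBdd_one {a m : ℝ} {f : ℝ × (ℝ × ℝ) → ℝ} (hf : ContDiffOn ℝ ∞ f (stOrb a m))
    (h0 : AxisZero a m f) : AxBdd a m 1 f :=
  AxBdd.integrate (n := 0) hf h0 (axBdd_fderiv hf _)

theorem ax_one {a m : ℝ} {f : ℝ × (ℝ × ℝ) → ℝ} (hf : ContDiffOn ℝ ∞ f (stOrb a m))
    (h0 : AxisZero a m f) : Ax a m 1 f := by
  refine ⟨hf.mono (stInt_subset_stOrb a m), axBdd_one hf h0,
    (axBdd_one (contDiffOn_fderivWithin_dir hf _) (h0.fderivWithin_dirT hf)).congr ?_,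
    (axBdd_one (contDiffOn_fderivWithin_dir hf _) (h0.fderivWithin_dirR hf)).congr ?_,
    axBdd_fderiv hf _⟩ <;>
  exact fun _ hz => by simp only [fderivWithin_stOrb hz]

theorem fderiv_fderivWithin {a m : ℝ} {f : ℝ × (ℝ × ℝ) → ℝ} {z : ℝ × (ℝ × ℝ)}
    (hz : z ∈ stInt a m) (e e' : ℝ × (ℝ × ℝ)) :
    fderiv ℝ (fun z => fderivWithin ℝ f (stOrb a m) z e) z e' =
      fderiv ℝ (fun z => fderiv ℝ f z e) z e' := by
  have : (fun z => fderivWithin ℝ f (stOrb a m) z e) =ᶠ[nhds z] fun z => fderiv ℝ f z e := by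
    filter_upwards [(isOpen_stInt a m).mem_nhds hz] with w hw
    rw [fderivWithin_stOrb hw]
  rw [this.fderiv_eq]

/-- A double zero gives order sin²θ: ∂_θf is O(sin θ) by `ax_one`, and integration in θ raises the
order. The same argument serves ∂_tf and ∂_rf, since their θ-derivatives are ∂_t and ∂_r of ∂_θf. -/
theorem ax_two {a m : ℝ} {f : ℝ × (ℝ × ℝ) → ℝ} (hf : ContDiffOn ℝ ∞ f (stOrb a m))
    (h0 : AxisZero a m f) (h1 : AxisZero a m (fun z => fderivWithin ℝ f (stOrb a m) z dirTh)) :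
    Ax a m 2 f := by
  have hth := ax_one (contDiffOn_fderivWithin_dir hf dirTh) h1
  have hfi := hf.mono (stInt_subset_stOrb a m)
  have hE : ∀ e, EqOn (fun z => fderiv ℝ f z e) (fun z => fderivWithin ℝ f (stOrb a m) z e)
    (stInt a m) := fun e _ hz => by simp only [fderivWithin_stOrb hz]
  refine ⟨hfi, AxBdd.integrate (n := 1) hf h0 (hth.bdd.congr (hE _)), AxBdd.congr ?_ (hE _),
    AxBdd.congr ?_ (hE _), hth.bdd.congr (hE _)⟩
  · refine AxBdd.integrate (n := 1) (contDiffOn_fderivWithin_dir hf _) (h0.fderivWithin_dirT hf)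
      (hth.bddT.congr fun z hz => ?_)
    simp only [fderiv_fderivWithin hz, fderiv_comm hfi hz dirT dirTh]
  · refine AxBdd.integrate (n := 1) (contDiffOn_fderivWithin_dir hf _) (h0.fderivWithin_dirR hf)
      (hth.bddR.congr fun z hz => ?_)
    simp only [fderiv_fderivWithin hz, fderiv_comm hfi hz dirR dirTh]

theorem ax_const {a m : ℝ} (c : ℝ) : Ax a m 0 (fun _ => c) := ax_zero contDiffOn_const

theorem Ax.const_mul {a m : ℝ} {n : ℤ} {f : ℝ × (ℝ × ℝ) → ℝ} (hf : Ax a m n f) (c : ℝ) :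
    Ax a m n (fun z => c * f z) := by
  simpa using (ax_const c).mul hf

theorem Ax.neg {a m : ℝ} {n : ℤ} {f : ℝ × (ℝ × ℝ) → ℝ} (hf : Ax a m n f) :
    Ax a m n (fun z => -f z) := by
  simpa using hf.const_mul (-1)

theorem Ax.sub {a m : ℝ} {n : ℤ} {f g : ℝ × (ℝ × ℝ) → ℝ} (hf : Ax a m n f)
    (hg : Ax a m n g) : Ax a m n (fun z => f z - g z) := by
  simpa [sub_eq_add_neg] using hf.add hg.neg

/-! ### Order of the background coefficients at the axis -/

theorem ax_sin {a m : ℝ} : Ax a m 1 (fun z => Real.sin z.2.2) :=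
  ax_one (by fun_prop) fun t r _ => by simp

/-- This is the sole source of negative order: every singular background coefficient is 1/sin θ
times a function smooth up to the axis, possibly plus such a function. -/
theorem ax_inv_sin {a m : ℝ} : Ax a m (-1) (fun z => (Real.sin z.2.2)⁻¹) := by
  have hne : ∀ z ∈ stInt a m, Real.sin z.2.2 ≠ 0 := fun z hz => (sin_pos_of_mem hz.2).ne'
  have hb : AxBdd a m (-1) (fun z => (Real.sin z.2.2)⁻¹) := fun T r₁ r₂ _ =>
    ⟨1, zero_le_one, fun t p _ hp _ => by
      rw [one_mul, zpow_neg_one, abs_of_pos (inv_pos.2 (sin_pos_of_mem hp))]⟩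
  have key : ∀ e z, z ∈ stInt a m → fderiv ℝ (fun z => (Real.sin z.2.2)⁻¹) z e =
      -1 * (((Real.sin z.2.2)⁻¹ * (Real.sin z.2.2)⁻¹) *
        fderiv ℝ (fun z : ℝ × (ℝ × ℝ) => Real.sin z.2.2) z e) := fun e z hz => by
    have hd : DifferentiableAt ℝ (fun z : ℝ × (ℝ × ℝ) => Real.sin z.2.2) z := ax_sin.diff hz
    have := (hasDerivAt_inv (hne z hz)).comp_hasFDerivAt z hd.hasFDerivAt
    have h2 : fderiv ℝ (fun z : ℝ × (ℝ × ℝ) => (Real.sin z.2.2)⁻¹) z = _ := this.fderiv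
    rw [h2]
    simp only [smul_apply, smul_eq_mul]
    field_simp
  have hc : AxBdd a m 0 (fun _ => (-1 : ℝ)) := (ax_const (-1)).bdd
  have hbb := hb.mul hb
  refine ⟨(ContDiff.contDiffOn (by fun_prop)).inv hne, hb,
    AxBdd.congr ((hc.mul (hbb.mul ax_sin.bddT)).mono ?_) (key _),
    AxBdd.congr ((hc.mul (hbb.mul ax_sin.bddR)).mono ?_) (key _),
    AxBdd.congr ((hc.mul (hbb.mul ax_sin.bddTh)).mono ?_) (key _)⟩ <;> norm_num

theorem ax_static {a m : ℝ} {f : ℝ × ℝ → ℝ} (hf : ContDiffOn ℝ ∞ f (orbit a m)) :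
    Ax a m 0 (fun z => f z.2) :=
  ax_zero (hf.comp contDiffOn_snd fun _ hz => hz.2)

theorem smooth_inv_sigma {a m : ℝ} (h : |a| < m) :
    ContDiffOn ℝ ∞ (fun p => (kSigma a p)⁻¹) (orbit a m) :=
  (contDiff_sigma a).contDiffOn.inv fun _ hp => (sigma_pos (delta_pos h hp.1).1).ne'

theorem smooth_inv_pi {a m : ℝ} (h : |a| < m) :
    ContDiffOn ℝ ∞ (fun p => (kPi a m p)⁻¹) (orbit a m) :=
  (contDiff_kPi a m).contDiffOn.inv fun _ hp => (pi_pos h hp.1).ne'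

theorem ax_coTh {a m : ℝ} (h : |a| < m) : Ax a m (-1) (fun z => coTh a m z.2) := by
  refine (ax_inv_sin.mul (ax_static ((contDiff_sigma a).contDiffOn.mul
    (smooth_inv_pi h)))).congr fun z _ => ?_
  simp only [coTh, div_eq_mul_inv, mul_inv]; ring

theorem ax_coR {a m : ℝ} (h : |a| < m) : Ax a m (-1) (fun z => coR a m z.2) := by
  refine (ax_inv_sin.mul (ax_static (((contDiff_delta a m).mul (contDiff_sigma a)).contDiffOn.mul
    (smooth_inv_pi h)))).congr fun z _ => ?_
  simp only [coR, div_eq_mul_inv, mul_inv]; ring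

theorem ax_coK {a m : ℝ} (h : |a| < m) : Ax a m 1 (fun z => coK a m z.2) := by
  refine (ax_sin.mul (ax_static ((contDiff_delta a m).contDiffOn.mul
    (smooth_inv_sigma h)))).congr fun z _ => ?_
  simp only [coK, div_eq_mul_inv]; ring

theorem ax_gamR {a m : ℝ} (h : |a| < m) : Ax a m 0 (fun z => gamR a m z.2) := by
  refine (ax_static ((((contDiff_kPiR a m).contDiffOn.mul (smooth_inv_pi h)).sub
    ((contDiff_const (c := (2 : ℝ)).mul contDiff_fst).contDiffOn.mul
      (smooth_inv_sigma h))).div_const 2)).congr fun z _ => ?_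
  simp only [gamR, div_eq_mul_inv]

theorem ax_gamTh {a m : ℝ} (h : |a| < m) : Ax a m (-1) (fun z => gamTh a m z.2) := by
  refine ((ax_inv_sin.mul (ax_static (m := m) (a := a) (f := fun p => Real.cos p.2)
    (by fun_prop))).add ((ax_static ((((contDiff_kPiTh a m).contDiffOn.mul (smooth_inv_pi h)).sub
    ((contDiff_sigTh a).contDiffOn.mul (smooth_inv_sigma h))).div_const 2)).mono
      (by norm_num))).congr fun z _ => ?_
  simp only [gamTh, div_eq_mul_inv]; ring

theorem ax_twR {a m : ℝ} (h : |a| < m) : Ax a m 1 (fun z => twR a m z.2) := by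
  refine (ax_sin.mul (ax_static (f := fun p => -(4 * a ^ 3 * m * Real.cos p.2 * Real.sin p.2 * p.1)
    * ((kSigma a p)⁻¹ * (kPi a m p)⁻¹)) ((ContDiff.contDiffOn (by fun_prop)).mul
      ((smooth_inv_sigma h).mul (smooth_inv_pi h))))).congr fun z _ => ?_
  simp only [twR, div_eq_mul_inv, mul_inv]; ring

theorem ax_twTh {a m : ℝ} (h : |a| < m) : Ax a m 1 (fun z => twTh a m z.2) := by
  have h1 := contDiff_kPi a m
  have h2 := contDiff_kPiR a m
  refine (ax_sin.mul (ax_static (f := fun p => 2 * a * m * (kPi a m p - p.1 * piR a m p)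
    * ((kSigma a p)⁻¹ * (kPi a m p)⁻¹)) ((ContDiff.contDiffOn (by fun_prop)).mul
      ((smooth_inv_sigma h).mul (smooth_inv_pi h))))).congr fun z _ => ?_
  simp only [twTh, div_eq_mul_inv, mul_inv]; ring


/-! ### Integration over the orbit space -/

/-- `f` vanishes off the axis outside `r₁ ≤ r ≤ r₂`. -/
def SuppIn (a m r₁ r₂ : ℝ) (f : ℝ × ℝ → ℝ) : Prop :=
  ∀ p ∈ orbitInt a m, p.1 ∉ Icc r₁ r₂ → f p = 0

theorem SuppIn.mono {a m r₁ r₂ r₁' r₂' : ℝ} {f : ℝ × ℝ → ℝ} (hf : SuppIn a m r₁ r₂ f)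
    (h₁ : r₁' ≤ r₁) (h₂ : r₂ ≤ r₂') : SuppIn a m r₁' r₂' f :=
  fun p hp hpr => hf p hp fun hc => hpr ⟨h₁.trans hc.1, hc.2.trans h₂⟩

theorem SuppIn.eventually {a m r₁ r₂ : ℝ} {f : ℝ × ℝ → ℝ} (hf : SuppIn a m r₁ r₂ f)
    {p : ℝ × ℝ} (hp : p ∈ orbitInt a m) (hpr : p.1 ∉ Icc r₁ r₂) : ∀ᶠ q in nhds p, f q = 0 := by
  have : IsOpen {q : ℝ × ℝ | q.1 ∉ Icc r₁ r₂} := isClosed_Icc.isOpen_compl.preimage continuous_fst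
  filter_upwards [(isOpen_orbitInt a m).mem_nhds hp, this.mem_nhds hpr] with q h1 h2
  exact hf q h1 h2

theorem SuppIn.dr {a m r₁ r₂ : ℝ} {f : ℝ × ℝ → ℝ} (hf : SuppIn a m r₁ r₂ f) :
    SuppIn a m r₁ r₂ (dr f) := fun p hp hpr => by
  have h1 : (fun r => f (r, p.2)) =ᶠ[nhds p.1] fun _ => 0 :=
    (Continuous.tendsto' (by fun_prop : Continuous fun r : ℝ => (r, p.2)) p.1 p rfl).eventually
      (hf.eventually hp hpr)
  rw [KerrMaxwell.dr, h1.deriv_eq, deriv_const]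

theorem SuppIn.dth {a m r₁ r₂ : ℝ} {f : ℝ × ℝ → ℝ} (hf : SuppIn a m r₁ r₂ f) :
    SuppIn a m r₁ r₂ (dth f) := fun p hp hpr => by
  have h1 : (fun θ => f (p.1, θ)) =ᶠ[nhds p.2] fun _ => 0 :=
    (Continuous.tendsto' (by fun_prop : Continuous fun θ : ℝ => (p.1, θ)) p.2 p rfl).eventually
      (hf.eventually hp hpr)
  rw [KerrMaxwell.dth, h1.deriv_eq, deriv_const]

theorem integrableOn_of_bounded {a m r₁ r₂ C : ℝ} {f : ℝ × ℝ → ℝ}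
    (hf : ContinuousOn f (orbitInt a m)) (hs : SuppIn a m r₁ r₂ f)
    (hb : ∀ p ∈ orbitInt a m, p.1 ∈ Icc r₁ r₂ → |f p| ≤ C) : IntegrableOn f (orbitInt a m) := by
  have hmeas : MeasurableSet (orbitInt a m) := (isOpen_orbitInt a m).measurableSet
  have hK : MeasurableSet (Icc r₁ r₂ ×ˢ Ioo 0 Real.pi) := measurableSet_Icc.prod measurableSet_Ioo
  have hfin : volume (Icc r₁ r₂ ×ˢ Ioo 0 Real.pi) < ⊤ := by
    rw [Measure.volume_eq_prod, Measure.prod_prod]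
    exact ENNReal.mul_lt_top measure_Icc_lt_top measure_Ioo_lt_top
  have hg : Integrable (indicator (Icc r₁ r₂ ×ˢ Ioo 0 Real.pi) fun _ => C) :=
    (integrable_indicator_iff hK).2 (integrableOn_const hfin.ne)
  refine hg.integrableOn.mono' (hf.aestronglyMeasurable hmeas) ?_
  filter_upwards [ae_restrict_mem hmeas] with p hp
  by_cases hpr : p.1 ∈ Icc r₁ r₂
  · rw [indicator_of_mem (show p ∈ Icc r₁ r₂ ×ˢ Ioo 0 Real.pi from ⟨hpr, hp.2⟩)]
    exact hb p hp hpr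
  · rw [hs p hp hpr, indicator_of_notMem (fun hc => hpr hc.1)]
    simp

/-- The divergence theorem on the orbit space, for densities vanishing on the axis. -/
theorem integral_dvg_eq_zero {a m r₁ r₂ C : ℝ} {V : ℝ × ℝ → ℝ × ℝ} (hr : rPlus a m < r₁)
    (h1 : ContDiffOn ℝ ∞ (fun p => (V p).1) (orbitInt a m))
    (h2 : ContDiffOn ℝ ∞ (fun p => (V p).2) (orbitInt a m))
    (s1 : SuppIn a m r₁ r₂ fun p => (V p).1) (s2 : SuppIn a m r₁ r₂ fun p => (V p).2)
    (b1 : ∀ p ∈ orbitInt a m, p.1 ∈ Icc r₁ r₂ → |dr (fun p => (V p).1) p| ≤ C)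
    (b2 : ∀ p ∈ orbitInt a m, p.1 ∈ Icc r₁ r₂ → |dvg V p| ≤ C)
    (b3 : ∀ p ∈ orbitInt a m, p.1 ∈ Icc r₁ r₂ → |(V p).2| ≤ C * Real.sin p.2) :
    ∫ p in orbitInt a m, dvg V p = 0 := by
  have hO := isOpen_orbitInt a m
  have c1 := contDiffOn_dr hO h1
  have c2 := contDiffOn_dth hO h2
  have i1 : IntegrableOn (dr fun p => (V p).1) (orbitInt a m) :=
    integrableOn_of_bounded c1.continuousOn s1.dr b1
  -- Only the full divergence and ∂_rV^r are assumed bounded; their difference bounds ∂_θV^θ.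
  have i2 : IntegrableOn (dth fun p => (V p).2) (orbitInt a m) := by
    refine integrableOn_of_bounded (C := C + C) c2.continuousOn s2.dth fun p hp hpr => ?_
    have : dth (fun p => (V p).2) p = dvg V p - dr (fun p => (V p).1) p := by
      rw [dvg]; ring
    rw [this]
    exact (abs_sub _ _).trans (add_le_add (b2 p hp hpr) (b1 p hp hpr))
  have z1 : ∫ p in orbitInt a m, dr (fun p => (V p).1) p = 0 := by
    have := integral_prod_symm (μ := volume.restrict (Ioi (rPlus a m)))
      (ν := volume.restrict (Ioo 0 Real.pi)) (dr fun p => (V p).1)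
      (by rw [Measure.prod_restrict]; exact i1)
    rw [Measure.prod_restrict] at this
    refine this.trans (setIntegral_eq_zero_of_forall_eq_zero fun θ hθ => ?_)
    -- Both ends of the radial interval lie outside the support: r₀ halfway between r₊ and r₁, and R
    -- beyond r₁ and r₂.
    set R := max r₁ r₂ + 1
    set r₀ := (rPlus a m + r₁) / 2
    have hr0 : rPlus a m < r₀ := by simp only [r₀]; linarith
    have hr01 : r₀ < r₁ := by simp only [r₀]; linarith
    have hR1 : r₁ < R := by simp only [R]; linarith [le_max_left r₁ r₂]
    have hR2 : r₂ < R := by simp only [R]; linarith [le_max_right r₁ r₂]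
    have e1 : ∫ r in Ioi (rPlus a m), dr (fun p => (V p).1) (r, θ) =
        ∫ r in Ioc r₀ R, dr (fun p => (V p).1) (r, θ) := by
      refine setIntegral_eq_of_subset_of_forall_sdiff_eq_zero measurableSet_Ioi
        (fun r hr => hr0.trans hr.1) fun r hr => ?_
      refine s1.dr (r, θ) ⟨hr.1, hθ⟩ fun hc => hr.2 ⟨hr01.trans_le hc.1, hc.2.trans hR2.le⟩
    rw [e1, ← intervalIntegral.integral_of_le (hr01.trans hR1).le]
    have hsub : ∀ r ∈ uIcc r₀ R, (r, θ) ∈ orbitInt a m := fun r hr => by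
      rw [uIcc_of_le (hr01.trans hR1).le] at hr
      exact ⟨hr0.trans_le hr.1, hθ⟩
    rw [intervalIntegral.integral_eq_sub_of_hasDerivAt (f := fun r => (V (r, θ)).1)
      (fun r hr => hasDerivAt_dr (ContDiffOn.diffAt hO h1 (hsub r hr)))
      (ContinuousOn.intervalIntegrable (c1.continuousOn.comp (by fun_prop) hsub))]
    have z1 : (V (R, θ)).1 = 0 := s1 (R, θ) (hsub R right_mem_uIcc) fun hc => hc.2.not_gt hR2
    have z2 : (V (r₀, θ)).1 = 0 := s1 (r₀, θ) (hsub r₀ left_mem_uIcc) fun hc => hc.1.not_gt hr01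
    rw [z1, z2, sub_zero]
  have z2 : ∫ p in orbitInt a m, dth (fun p => (V p).2) p = 0 := by
    have hi : ∀ᵐ r ∂(volume.restrict (Ioi (rPlus a m))), IntegrableOn
        (fun θ => dth (fun p => (V p).2) (r, θ)) (Ioo 0 Real.pi) := by
      have : Integrable (dth fun p => (V p).2)
        ((volume.restrict (Ioi (rPlus a m))).prod (volume.restrict (Ioo 0 Real.pi))) := by
          rw [Measure.prod_restrict]; exact i2
      exact this.prod_right_ae
    refine (setIntegral_prod (dth fun p => (V p).2) i2).trans (integral_eq_zero_of_ae ?_)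
    filter_upwards [hi, ae_restrict_mem measurableSet_Ioi] with r hir hr
    by_cases hrr : r ∈ Icc r₁ r₂
    · rw [← integral_Ioc_eq_integral_Ioo, ← intervalIntegral.integral_of_le Real.pi_pos.le]
      -- V is not assumed to extend to the axis, so the fundamental theorem is used with one-sided
      -- limits, which vanish by squeezing between multiples of sin θ.
      have hb : ∀ θ ∈ Ioo 0 Real.pi, |(V (r, θ)).2| ≤ C * Real.sin θ := fun θ hθ =>
        b3 (r, θ) ⟨hr, hθ⟩ hrr
      have ht : ∀ x, Real.sin x = 0 → Filter.Tendsto (fun θ => C * Real.sin θ) (nhds x) (nhds 0) :=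
        fun x hx => (by fun_prop : Continuous fun θ => C * Real.sin θ).tendsto' _ _ (by simp [hx])
      have t0 : Filter.Tendsto (fun θ => (V (r, θ)).2) (nhdsWithin 0 (Ioi 0)) (nhds 0) :=
        squeeze_zero_norm' (by
          filter_upwards [Ioo_mem_nhdsGT Real.pi_pos] with θ hθ using hb θ hθ)
          ((ht 0 (by simp)).mono_left nhdsWithin_le_nhds)
      have t1 : Filter.Tendsto (fun θ => (V (r, θ)).2) (nhdsWithin Real.pi (Iio Real.pi))
          (nhds 0) :=
        squeeze_zero_norm' (by
          filter_upwards [Ioo_mem_nhdsLT Real.pi_pos] with θ hθ using hb θ hθ)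
          ((ht _ (by simp)).mono_left nhdsWithin_le_nhds)
      refine (intervalIntegral.integral_eq_sub_of_hasDerivAt_of_tendsto Real.pi_pos
        (fun θ hθ => hasDerivAt_dth (ContDiffOn.diffAt hO h2 (p := (r, θ)) ⟨hr, hθ⟩)) ?_ t0
        t1).trans (sub_zero 0)
      rw [intervalIntegrable_iff_integrableOn_Ioo_of_le Real.pi_pos.le]
      exact hir
    · exact setIntegral_eq_zero_of_forall_eq_zero fun θ hθ => s2.dth (r, θ) ⟨hr, hθ⟩ hrr
  have : ∫ p in orbitInt a m, dvg V p = ∫ p in orbitInt a m,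
      (dr (fun p => (V p).1) p + dth (fun p => (V p).2) p) := rfl
  rw [this, integral_add i1 i2, z1, z2, add_zero]

/-! ### Regular states -/

/-- The state is regular at the axis. -/
structure AxState (a m : ℝ) (x : ℝ → PhasePt) : Prop where
  lam : Ax a m 2 (fun z => (x z.1).lam z.2)
  eta : Ax a m 2 (fun z => (x z.1).eta z.2)
  u : Ax a m 1 (fun z => (x z.1).u z.2)
  v : Ax a m 1 (fun z => (x z.1).v z.2)
  lamR : Ax a m 1 (fun z => dr (x z.1).lam z.2)
  lamTh : Ax a m 1 (fun z => dth (x z.1).lam z.2)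
  etaR : Ax a m 1 (fun z => dr (x z.1).eta z.2)
  etaTh : Ax a m 1 (fun z => dth (x z.1).eta z.2)

theorem slice_dr {a m : ℝ} {f : ℝ × (ℝ × ℝ) → ℝ} (hf : ContDiffOn ℝ ∞ f (stInt a m))
    {z : ℝ × (ℝ × ℝ)} (hz : z ∈ stInt a m) :
    dr (fun p => f (z.1, p)) z.2 = fderiv ℝ f z dirR :=
  (hasDerivAt_dirR (differentiableAt_of_stInt hf hz)).deriv

theorem slice_dth {a m : ℝ} {f : ℝ × (ℝ × ℝ) → ℝ} (hf : ContDiffOn ℝ ∞ f (stInt a m))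
    {z : ℝ × (ℝ × ℝ)} (hz : z ∈ stInt a m) :
    dth (fun p => f (z.1, p)) z.2 = fderiv ℝ f z dirTh :=
  (hasDerivAt_dirTh (differentiableAt_of_stInt hf hz)).deriv

theorem ax_slice_dr {a m : ℝ} {f : ℝ × (ℝ × ℝ) → ℝ} (hf : ContDiffOn ℝ ∞ f (stOrb a m))
    (h0 : AxisZero a m f) : Ax a m 1 (fun z => dr (fun p => f (z.1, p)) z.2) :=
  (ax_one (contDiffOn_fderivWithin_dir hf dirR) (h0.fderivWithin_dirR hf)).congr fun z hz => by
    simp only [slice_dr (hf.mono (stInt_subset_stOrb a m)) hz, fderivWithin_stOrb hz]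

theorem ax_slice_dth {a m : ℝ} {f : ℝ × (ℝ × ℝ) → ℝ} (hf : ContDiffOn ℝ ∞ f (stOrb a m))
    (h1 : AxisZero a m (fun z => fderivWithin ℝ f (stOrb a m) z dirTh)) :
    Ax a m 1 (fun z => dth (fun p => f (z.1, p)) z.2) :=
  (ax_one (contDiffOn_fderivWithin_dir hf dirTh) h1).congr fun z hz => by
    simp only [slice_dth (hf.mono (stInt_subset_stOrb a m)) hz, fderivWithin_stOrb hz]

/-- The derivative normal to the axis vanishes, for every slice. -/
theorem axisZero_dirTh {a m : ℝ} {f : ℝ × (ℝ × ℝ) → ℝ} (hf : ContDiffOn ℝ ∞ f (stOrb a m))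
    (h : ∀ t, NormalDerivZeroOnAxis a m (fun p => f (t, p))) :
    AxisZero a m (fun z => fderivWithin ℝ f (stOrb a m) z dirTh) := by
  have key : ∀ t r, rPlus a m < r → ∀ θ ∈ Icc 0 Real.pi,
      fderivWithin ℝ f (stOrb a m) (t, (r, θ)) dirTh =
        derivWithin (fun θ => f (t, (r, θ))) (Icc 0 Real.pi) θ := by
    intro t r hr θ hθ
    have hd := (hf.differentiableOn (by simp) (t, (r, θ)) ⟨mem_univ _, hr, hθ⟩).hasFDerivWithinAt
    have h1 : HasDerivWithinAt (fun θ : ℝ => (t, (r, θ))) dirTh (Icc 0 Real.pi) θ :=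
      ((hasDerivAt_const _ _).prodMk
        ((hasDerivAt_const _ _).prodMk (hasDerivAt_id' θ))).hasDerivWithinAt
    exact ((hd.comp_hasDerivWithinAt θ (f := fun θ : ℝ => (t, (r, θ))) h1
      fun x hx => ⟨mem_univ _, hr, hx⟩).derivWithin (uniqueDiffOn_Icc Real.pi_pos θ hθ)).symm
  refine fun t r hr => ⟨?_, ?_⟩
  · exact (key t r hr 0 ⟨le_rfl, Real.pi_pos.le⟩).trans (h t r hr).1
  · exact (key t r hr Real.pi ⟨Real.pi_pos.le, le_rfl⟩).trans (h t r hr).2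

/-- A smooth curve of states satisfying the axis conditions is regular. -/
theorem axState_of_smooth {a m : ℝ} {x : ℝ → PhasePt}
    (s1 : ContDiffOn ℝ ∞ (fun z : ℝ × (ℝ × ℝ) => (x z.1).lam z.2) (stOrb a m))
    (s2 : ContDiffOn ℝ ∞ (fun z : ℝ × (ℝ × ℝ) => (x z.1).eta z.2) (stOrb a m))
    (s3 : ContDiffOn ℝ ∞ (fun z : ℝ × (ℝ × ℝ) => (x z.1).u z.2) (stOrb a m))
    (s4 : ContDiffOn ℝ ∞ (fun z : ℝ × (ℝ × ℝ) => (x z.1).v z.2) (stOrb a m))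
    (a1 : ∀ t, ZeroOnAxis a m (x t).lam) (a2 : ∀ t, ZeroOnAxis a m (x t).eta)
    (a3 : ∀ t, ZeroOnAxis a m (x t).u) (a4 : ∀ t, ZeroOnAxis a m (x t).v)
    (n1 : ∀ t, NormalDerivZeroOnAxis a m (x t).lam)
    (n2 : ∀ t, NormalDerivZeroOnAxis a m (x t).eta) : AxState a m x where
  lam := ax_two s1 (fun t r hr => a1 t r hr) (axisZero_dirTh s1 n1)
  eta := ax_two s2 (fun t r hr => a2 t r hr) (axisZero_dirTh s2 n2)
  u := ax_one s3 fun t r hr => a3 t r hr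
  v := ax_one s4 fun t r hr => a4 t r hr
  lamR := ax_slice_dr s1 fun t r hr => a1 t r hr
  lamTh := ax_slice_dth s1 (axisZero_dirTh s1 n1)
  etaR := ax_slice_dr s2 fun t r hr => a2 t r hr
  etaTh := ax_slice_dth s2 (axisZero_dirTh s2 n2)

/-- A phase-space point is treated as a constant curve, so that one order calculus covers both fixed
states and evolutions. -/
theorem InPhaseSpace.axState {a m : ℝ} {x : PhasePt} (hx : InPhaseSpace a m x) :
    AxState a m (fun _ => x) := by
  have key : ∀ {f : ℝ × ℝ → ℝ}, SmoothCompact a m f →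
      ContDiffOn ℝ ∞ (fun z : ℝ × (ℝ × ℝ) => f z.2) (stOrb a m) :=
    fun hf => hf.1.comp contDiffOn_snd fun _ hz => hz.2
  exact axState_of_smooth (key hx.lam_smooth) (key hx.eta_smooth) (key hx.u_smooth)
    (key hx.v_smooth) (fun _ => hx.lam_axis) (fun _ => hx.eta_axis) (fun _ => hx.u_axis)
    (fun _ => hx.v_axis) (fun _ => hx.lam_normal) (fun _ => hx.eta_normal)

theorem InPhaseSpace.smoothInt {a m : ℝ} {x : PhasePt} (hx : InPhaseSpace a m x) :
    x.SmoothInt a m :=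
  ⟨hx.lam_smooth.1.mono (orbitInt_subset_orbit a m), hx.v_smooth.1.mono (orbitInt_subset_orbit a m),
    hx.eta_smooth.1.mono (orbitInt_subset_orbit a m),
    hx.u_smooth.1.mono (orbitInt_subset_orbit a m)⟩

section
variable {a m s : ℝ} {x y : ℝ → PhasePt}

theorem AxState.yEtaR (hx : AxState a m x) (h : |a| < m) :
    Ax a m 1 (fun z => yEtaR a m s (x z.1) z.2) :=
  (hx.etaR.sub (((hx.eta.const_mul (2 * (1 - s))).mul (ax_gamR h)).mono (by norm_num))).add
    (((hx.lam.const_mul s).mul (ax_twR h)).mono (by norm_num))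

theorem AxState.yEtaTh (hx : AxState a m x) (h : |a| < m) :
    Ax a m 1 (fun z => yEtaTh a m s (x z.1) z.2) :=
  (hx.etaTh.sub (((hx.eta.const_mul (2 * (1 - s))).mul (ax_gamTh h)).mono (by norm_num))).add
    (((hx.lam.const_mul s).mul (ax_twTh h)).mono (by norm_num))

theorem AxState.yLamR (hx : AxState a m x) (h : |a| < m) :
    Ax a m 1 (fun z => yLamR a m s (x z.1) z.2) :=
  (hx.lamR.sub (((hx.lam.const_mul (2 * s)).mul (ax_gamR h)).mono (by norm_num))).sub
    (((hx.eta.const_mul (1 - s)).mul (ax_twR h)).mono (by norm_num))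

theorem AxState.yLamTh (hx : AxState a m x) (h : |a| < m) :
    Ax a m 1 (fun z => yLamTh a m s (x z.1) z.2) :=
  (hx.lamTh.sub (((hx.lam.const_mul (2 * s)).mul (ax_gamTh h)).mono (by norm_num))).sub
    (((hx.eta.const_mul (1 - s)).mul (ax_twTh h)).mono (by norm_num))

/-- The exponents: the momentum terms have 1+1+1, the gradient terms -1+1+1, and the worst mass term
-1-2+4, where -2 comes from cot²θ in |∂γ|² and 4 from two factors λ, η of order 2. Hence everything
is O(sin θ). -/
theorem AxState.polar (hx : AxState a m x) (hy : AxState a m y) (h : |a| < m) :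
    Ax a m 1 (fun z => polar a m s (x z.1) (y z.1) z.2) := by
  have hm := (hx.lam.mul hy.lam).add (hx.eta.mul hy.eta)
  have g1 := ((ax_gamR h).mul (ax_gamR h)).add
    ((((ax_twR h).mul (ax_twR h)).const_mul (1 / 4)).mono (by norm_num))
  have g2 := ((ax_gamTh h).mul (ax_gamTh h)).add
    ((((ax_twTh h).mul (ax_twTh h)).const_mul (1 / 4)).mono (by norm_num))
  have t1 := (ax_coK h).mul ((hx.u.mul hy.u).add (hx.v.mul hy.v))
  have t2 := (ax_coR h).mul ((((hx.yEtaR (s := s) h).mul (hy.yEtaR (s := s) h)).add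
    ((hx.yLamR (s := s) h).mul (hy.yLamR (s := s) h))).add
      (((g1.const_mul (4 * (s * (1 - s)))).mul hm).mono (by norm_num)))
  have t3 := (ax_coTh h).mul ((((hx.yEtaTh (s := s) h).mul (hy.yEtaTh (s := s) h)).add
    ((hx.yLamTh (s := s) h).mul (hy.yLamTh (s := s) h))).add
      (((g2.const_mul (4 * (s * (1 - s)))).mul hm).mono (by norm_num)))
  refine (((t1.mono (by norm_num)).add (t2.mono (by norm_num))).add
    (t3.mono (by norm_num))).congr fun z _ => ?_
  simp only [KerrMaxwell.polar]
  ring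

theorem AxState.altDensity (hx : AxState a m x) (h : |a| < m) :
    Ax a m 1 (fun z => altDensity a m s (x z.1) z.2) :=
  ((hx.polar (s := s) hx h).const_mul (1 / 2)).congr fun z hz => by
    simp only [altDensity_eq h s (x z.1) hz.2]; ring

/-- The flux has order -1+2+1 = 2, more than enough for the boundary terms on the axis to vanish. -/
theorem AxState.polarFlux_r (hx : AxState a m x) (hy : AxState a m y) (h : |a| < m) :
    Ax a m 2 (fun z => (polarFlux a m s (x z.1) (y z.1) z.2).1) :=
  ((ax_coR h).mul ((hy.eta.mul (hx.yEtaR h)).add (hy.lam.mul (hx.yLamR h)))).mono (by norm_num)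

theorem AxState.polarFlux_th (hx : AxState a m x) (hy : AxState a m y) (h : |a| < m) :
    Ax a m 2 (fun z => (polarFlux a m s (x z.1) (y z.1) z.2).2) :=
  ((ax_coTh h).mul ((hy.eta.mul (hx.yEtaTh h)).add (hy.lam.mul (hx.yLamTh h)))).mono (by norm_num)

end

theorem Ax.smooth_slice {a m : ℝ} {n : ℤ} {f : ℝ × (ℝ × ℝ) → ℝ} (hf : Ax a m n f) (t : ℝ) :
    ContDiffOn ℝ ∞ (fun p => f (t, p)) (orbitInt a m) :=
  hf.smooth.comp (by fun_prop) fun _ hp => ⟨mem_univ _, hp⟩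


theorem AxBdd.slice {a m : ℝ} {n : ℤ} {f : ℝ × (ℝ × ℝ) → ℝ} (hf : AxBdd a m n f) (hn : 0 ≤ n)
    (t : ℝ) {r₁ r₂ : ℝ} (hr : rPlus a m < r₁) :
    ∃ C, 0 ≤ C ∧ ∀ p ∈ orbitInt a m, p.1 ∈ Icc r₁ r₂ → |f (t, p)| ≤ C := by
  obtain ⟨C, hC, hb⟩ := hf.mono hn |t| r₁ r₂ hr
  exact ⟨C, hC, fun p hp hpr => by simpa using hb t p le_rfl hp hpr⟩

theorem Ax.integrable {a m : ℝ} {n : ℤ} {f : ℝ × (ℝ × ℝ) → ℝ} (hf : Ax a m n f) (hn : 0 ≤ n)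
    (t : ℝ) {r₁ r₂ : ℝ} (hr : rPlus a m < r₁) (hs : SuppIn a m r₁ r₂ fun p => f (t, p)) :
    IntegrableOn (fun p => f (t, p)) (orbitInt a m) := by
  obtain ⟨C, -, hC⟩ := hf.bdd.slice hn t (r₂ := r₂) hr
  exact integrableOn_of_bounded (hf.smooth_slice t).continuousOn hs hC

/-- The divergence of a compactly supported density that is regular at the axis has integral
zero. -/
theorem Ax.integral_dvg {a m : ℝ} {V : ℝ → ℝ × ℝ → ℝ × ℝ}
    (h1 : Ax a m 1 fun z => (V z.1 z.2).1) (h2 : Ax a m 1 fun z => (V z.1 z.2).2) (t : ℝ)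
    {r₁ r₂ : ℝ} (hr : rPlus a m < r₁) (s1 : SuppIn a m r₁ r₂ fun p => (V t p).1)
    (s2 : SuppIn a m r₁ r₂ fun p => (V t p).2) :
    IntegrableOn (dvg (V t)) (orbitInt a m) ∧ ∫ p in orbitInt a m, dvg (V t) p = 0 := by
  have hO := isOpen_orbitInt a m
  have c1 := h1.smooth_slice t
  have c2 := h2.smooth_slice t
  obtain ⟨C1, hC1, b1⟩ := h1.bddR.slice zero_le_one t (r₂ := r₂) hr
  obtain ⟨C2, hC2, b2⟩ := h2.bddTh.slice (by norm_num) t (r₂ := r₂) hr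
  obtain ⟨C3, hC3, b3⟩ := h2.bdd |t| r₁ r₂ hr
  have e1 : ∀ p ∈ orbitInt a m, dr (fun p => (V t p).1) p =
      fderiv ℝ (fun z : ℝ × (ℝ × ℝ) => (V z.1 z.2).1) (t, p) dirR := fun p hp =>
    slice_dr (z := (t, p)) h1.smooth ⟨mem_univ _, hp⟩
  have e2 : ∀ p ∈ orbitInt a m, dth (fun p => (V t p).2) p =
      fderiv ℝ (fun z : ℝ × (ℝ × ℝ) => (V z.1 z.2).2) (t, p) dirTh := fun p hp =>
    slice_dth (z := (t, p)) h2.smooth ⟨mem_univ _, hp⟩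
  have d1 : ∀ p ∈ orbitInt a m, p.1 ∈ Icc r₁ r₂ → |dr (fun p => (V t p).1) p| ≤ C1 :=
    fun p hp hpr => by rw [e1 p hp]; exact b1 p hp hpr
  have d2 : ∀ p ∈ orbitInt a m, p.1 ∈ Icc r₁ r₂ → |dvg (V t) p| ≤ C1 + C2 := by
    intro p hp hpr
    refine (abs_add_le _ _).trans (add_le_add (d1 p hp hpr) ?_)
    rw [e2 p hp]
    exact b2 p hp hpr
  refine ⟨integrableOn_of_bounded (r₁ := r₁) (r₂ := r₂)
    ((contDiffOn_dr hO c1).add (contDiffOn_dth hO c2)).continuousOn (fun p hp hpr => ?_) d2, ?_⟩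
  · rw [dvg, s1.dr p hp hpr, s2.dth p hp hpr, add_zero]
  · refine integral_dvg_eq_zero (C := C1 + C2 + C3) hr c1 c2 s1 s2
      (fun p hp hpr => (d1 p hp hpr).trans (by linarith))
      (fun p hp hpr => (d2 p hp hpr).trans (by linarith)) fun p hp hpr => ?_
    have := b3 t p le_rfl hp hpr
    rw [zpow_one] at this
    exact this.trans (mul_le_mul_of_nonneg_right (by linarith) (sin_pos_of_mem hp).le)

/-! ### Supports -/

/-- The state is supported in `r₁ ≤ r ≤ r₂`. -/
structure PhasePt.SuppIn (a m r₁ r₂ : ℝ) (x : PhasePt) : Prop where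
  lam : KerrMaxwell.SuppIn a m r₁ r₂ x.lam
  v : KerrMaxwell.SuppIn a m r₁ r₂ x.v
  eta : KerrMaxwell.SuppIn a m r₁ r₂ x.eta
  u : KerrMaxwell.SuppIn a m r₁ r₂ x.u

theorem InPhaseSpace.exists_supp {a m : ℝ} {x : PhasePt} (hx : InPhaseSpace a m x) :
    ∃ r₁ r₂, rPlus a m < r₁ ∧ x.SuppIn a m r₁ r₂ := by
  have key : ∀ {f : ℝ × ℝ → ℝ}, SmoothCompact a m f →
      ∃ r₁ r₂, rPlus a m < r₁ ∧ SuppIn a m r₁ r₂ f := fun hf =>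
    let ⟨r₁, r₂, hr, hz⟩ := hf.2
    ⟨r₁, r₂, hr, fun p hp => hz p (orbitInt_subset_orbit a m hp)⟩
  obtain ⟨a1, b1, h1, s1⟩ := key hx.lam_smooth
  obtain ⟨a2, b2, h2, s2⟩ := key hx.v_smooth
  obtain ⟨a3, b3, h3, s3⟩ := key hx.eta_smooth
  obtain ⟨a4, b4, h4, s4⟩ := key hx.u_smooth
  refine ⟨min (min a1 a2) (min a3 a4), max (max b1 b2) (max b3 b4), by simp [*], s1.mono ?_ ?_,
    s2.mono ?_ ?_, s3.mono ?_ ?_, s4.mono ?_ ?_⟩ <;> simp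

theorem PhasePt.SuppIn.polar {a m r₁ r₂ : ℝ} {x : PhasePt} (hx : x.SuppIn a m r₁ r₂) (s : ℝ)
    (δ : PhasePt) : KerrMaxwell.SuppIn a m r₁ r₂ (polar a m s x δ) := fun p hp hpr => by
  simp only [KerrMaxwell.polar, yEtaR, yEtaTh, yLamR, yLamTh, hx.lam p hp hpr, hx.v p hp hpr,
    hx.eta p hp hpr, hx.u p hp hpr, hx.lam.dr p hp hpr, hx.lam.dth p hp hpr, hx.eta.dr p hp hpr,
    hx.eta.dth p hp hpr]
  ring

theorem PhasePt.SuppIn.altDensity {a m r₁ r₂ : ℝ} (h : |a| < m) {x : PhasePt}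
    (hx : x.SuppIn a m r₁ r₂) (s : ℝ) :
    KerrMaxwell.SuppIn a m r₁ r₂ (altDensity a m s x) := fun p hp hpr => by
  rw [altDensity_eq h s x hp, hx.polar s x p hp hpr, zero_div]

theorem PhasePt.SuppIn.polarFlux {a m r₁ r₂ : ℝ} {x : PhasePt} (hx : x.SuppIn a m r₁ r₂) (s : ℝ)
    (δ : PhasePt) (p : ℝ × ℝ) (hp : p ∈ orbitInt a m) (hpr : p.1 ∉ Icc r₁ r₂) :
    polarFlux a m s x δ p = 0 := by
  simp only [KerrMaxwell.polarFlux, yEtaR, yEtaTh, yLamR, yLamTh, hx.lam p hp hpr,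
    hx.eta p hp hpr, hx.lam.dr p hp hpr, hx.lam.dth p hp hpr, hx.eta.dr p hp hpr,
    hx.eta.dth p hp hpr]
  ext <;> simp

theorem AxState.integrable_altDensity {a m r₁ r₂ : ℝ} (h : |a| < m) {x : ℝ → PhasePt}
    (hx : AxState a m x) (s t : ℝ) (hr : rPlus a m < r₁) (hs : (x t).SuppIn a m r₁ r₂) :
    IntegrableOn (KerrMaxwell.altDensity a m s (x t)) (orbitInt a m) :=
  (AxState.altDensity (s := s) hx h).integrable zero_le_one t hr (hs.altDensity h s)

/-! ### The variational gradient -/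

/-- The two densities differ by a divergence whose integral vanishes. Integrability of the pairing
is inherited from the other two terms, so the second-order expressions in `hamGrad` need no separate
estimate. -/
theorem integral_polar {a m : ℝ} (h : |a| < m) (s : ℝ) {x δ : PhasePt} (hx : InPhaseSpace a m x)
    (hδ : InPhaseSpace a m δ) :
    IntegrableOn (polar a m s x δ) (orbitInt a m) ∧
    IntegrableOn (pairing (hamGrad a m x) δ) (orbitInt a m) ∧
    ∫ p in orbitInt a m, polar a m s x δ p =
      ∫ p in orbitInt a m, pairing (hamGrad a m x) δ p := by
  obtain ⟨r₁, r₂, hr, hs⟩ := hx.exists_supp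
  have i1 : IntegrableOn (polar a m s x δ) (orbitInt a m) :=
    (hx.axState.polar (s := s) hδ.axState h).integrable zero_le_one 0 hr (hs.polar s δ)
  obtain ⟨i2, z⟩ := Ax.integral_dvg (V := fun _ => polarFlux a m s x δ)
    ((hx.axState.polarFlux_r (s := s) hδ.axState h).mono (by norm_num))
    ((hx.axState.polarFlux_th (s := s) hδ.axState h).mono (by norm_num)) 0 hr
    (fun p hp hpr => congrArg Prod.fst (hs.polarFlux s δ p hp hpr))
    (fun p hp hpr => congrArg Prod.snd (hs.polarFlux s δ p hp hpr))
  have hmeas : MeasurableSet (orbitInt a m) := (isOpen_orbitInt a m).measurableSet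
  have e : EqOn (pairing (hamGrad a m x) δ)
      (fun p => polar a m s x δ p - dvg (polarFlux a m s x δ) p) (orbitInt a m) := fun p hp => by
    have := polar_eq_pairing_add_dvg h s hx.smoothInt hδ.smoothInt.lam hδ.smoothInt.eta hp
    simp only [this]; ring
  refine ⟨i1, (integrableOn_congr_fun e hmeas).2 (i1.sub i2), ?_⟩
  rw [setIntegral_congr_fun hmeas e, integral_sub i1 i2, z, sub_zero]

/-- The density is half a quadratic form in the state and its first derivatives, and `polar` is the
symmetric bilinear form belonging to it. -/
theorem altDensity_perturb {a m : ℝ} (h : |a| < m) (s : ℝ) {x δ : PhasePt}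
    (hx : x.SmoothInt a m) (hδ : δ.SmoothInt a m) (ε : ℝ) {p : ℝ × ℝ} (hp : p ∈ orbitInt a m) :
    altDensity a m s (x.perturb ε δ) p =
      altDensity a m s x p + ε * polar a m s x δ p + ε ^ 2 * altDensity a m s δ p := by
  have hO := isOpen_orbitInt a m
  have kr : ∀ {f g : ℝ × ℝ → ℝ}, ContDiffOn ℝ ∞ f (orbitInt a m) →
      ContDiffOn ℝ ∞ g (orbitInt a m) → dr (fun p => f p + ε * g p) p = dr f p + ε * dr g p :=
    fun hf hg => ((hasDerivAt_dr (ContDiffOn.diffAt hO hf hp)).add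
      ((hasDerivAt_dr (ContDiffOn.diffAt hO hg hp)).const_mul ε)).deriv
  have kt : ∀ {f g : ℝ × ℝ → ℝ}, ContDiffOn ℝ ∞ f (orbitInt a m) →
      ContDiffOn ℝ ∞ g (orbitInt a m) → dth (fun p => f p + ε * g p) p = dth f p + ε * dth g p :=
    fun hf hg => ((hasDerivAt_dth (ContDiffOn.diffAt hO hf hp)).add
      ((hasDerivAt_dth (ContDiffOn.diffAt hO hg hp)).const_mul ε)).deriv
  rw [altDensity_eq h s _ hp, altDensity_eq h s _ hp, altDensity_eq h s _ hp]
  simp only [polar, yEtaR, yEtaTh, yLamR, yLamTh, PhasePt.perturb, kr hx.lam hδ.lam,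
    kr hx.eta hδ.eta, kt hx.lam hδ.lam, kt hx.eta hδ.eta]
  ring

theorem InPhaseSpace.integrable_altDensity {a m : ℝ} (h : |a| < m) {x : PhasePt}
    (hx : InPhaseSpace a m x) (s : ℝ) : IntegrableOn (altDensity a m s x) (orbitInt a m) :=
  let ⟨_, _, hr, hs⟩ := hx.exists_supp
  hx.axState.integrable_altDensity h s 0 hr hs

theorem isVarGrad_HAlt {a m : ℝ} (h : |a| < m) (s : ℝ) {x : PhasePt} (hx : InPhaseSpace a m x) :
    IsVarGrad a m (HAlt a m s) x (hamGrad a m x) := by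
  have hO := isOpen_orbitInt a m
  have hS := hx.smoothInt
  have cR := smooth_coR h
  have cT := smooth_coTh h
  have wR := smooth_twR h
  have wT := smooth_twTh h
  have lr := contDiffOn_dr hO hS.lam
  have lt := contDiffOn_dth hO hS.lam
  have er := contDiffOn_dr hO hS.eta
  have et := contDiffOn_dth hO hS.eta
  refine ⟨?_, ?_, ?_, ?_, fun δ hδ => (integral_polar h s hx hδ).2.1, fun δ hδ => ?_⟩
  · refine ContinuousOn.congr (ContDiffOn.continuousOn (𝕜 := ℝ) (n := ∞) ?_)
      fun p hp => hamGrad_lam_eq h x hp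
    exact ContDiffOn.add ((contDiffOn_dr hO (cR.mul lr)).add (contDiffOn_dth hO (cT.mul lt))).neg
      (((cR.mul wR).mul er).add ((cT.mul wT).mul et))
  · exact ((smooth_coK h).mul hS.v).continuousOn.congr fun p hp => hamGrad_v_eq h x hp
  · refine ContinuousOn.congr (ContDiffOn.continuousOn (𝕜 := ℝ) (n := ∞) ?_)
      fun p hp => hamGrad_eta_eq h x hp
    exact ContDiffOn.sub ((contDiffOn_dr hO (cR.mul er)).add (contDiffOn_dth hO (cT.mul et))).neg
      (((cR.mul wR).mul lr).add ((cT.mul wT).mul lt))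
  · exact ((smooth_coK h).mul hS.u).continuousOn.congr fun p hp => hamGrad_u_eq h x hp
  · obtain ⟨i1, -, e⟩ := integral_polar h s hx hδ
    have hmeas : MeasurableSet (orbitInt a m) := hO.measurableSet
    have ix := hx.integrable_altDensity h s
    have iδ := hδ.integrable_altDensity h s
    -- Along a line in phase space the functional is exactly a quadratic polynomial in ε, so nothing
    -- is differentiated under the integral.
    have hH : ∀ ε : ℝ, HAlt a m s (x.perturb ε δ) = HAlt a m s x
        + ε * (∫ p in orbitInt a m, polar a m s x δ p) + ε ^ 2 * HAlt a m s δ := fun ε => by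
      simp only [HAlt]
      rw [setIntegral_congr_fun hmeas fun p hp =>
        altDensity_perturb h s hS hδ.smoothInt ε hp,
        integral_add (f := fun p => altDensity a m s x p + ε * polar a m s x δ p)
          (ix.add (i1.const_mul ε)) (iδ.const_mul _), integral_add ix (i1.const_mul ε),
        integral_const_mul, integral_const_mul]
    rw [← e]
    refine HasDerivAt.congr_of_eventuallyEq ?_ (Filter.Eventually.of_forall hH)
    have := (((hasDerivAt_id' (0 : ℝ)).mul_const
      (∫ p in orbitInt a m, polar a m s x δ p)).const_add (HAlt a m s x)).add
      ((hasDerivAt_pow 2 (0 : ℝ)).mul_const (HAlt a m s δ))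
    refine this.congr_deriv ?_
    simp

/-! ### Positivity -/

theorem HAlt_nonneg {a m : ℝ} (h : |a| < m) {s : ℝ} (hs : s ∈ Icc (0 : ℝ) 1) (x : PhasePt) :
    0 ≤ HAlt a m s x :=
  setIntegral_nonneg (isOpen_orbitInt a m).measurableSet fun _ hp => altDensity_nonneg h hs x hp

/-- A function of `r` with zero derivative that vanishes for large `r` is zero. -/
theorem eq_zero_of_hasDerivAt_zero {ρ R : ℝ} {f : ℝ → ℝ} (hf : ∀ r, ρ < r → HasDerivAt f 0 r)
    (h0 : ∀ r, R < r → f r = 0) {r : ℝ} (hr : ρ < r) : f r = 0 := by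
  set b := max r R + 1
  have hb : r < b := by simp only [b]; linarith [le_max_left r R]
  obtain ⟨c, hc, he⟩ := exists_hasDerivAt_eq_slope f (fun _ => 0) hb
    (fun x hx => (hf x (hr.trans_le hx.1)).continuousAt.continuousWithinAt)
    fun x hx => hf x (hr.trans hx.1)
  rw [h0 b (by simp only [b]; linarith [le_max_right r R]), eq_comm, div_eq_zero_iff] at he
  rcases he with he | he
  · linarith
  · exact absurd he (sub_pos.2 hb).ne'

theorem eq_zero_of_dr_eq_zero {a m r₁ r₂ : ℝ} {f : ℝ × ℝ → ℝ}
    (hf : ContDiffOn ℝ ∞ f (orbitInt a m)) (hs : SuppIn a m r₁ r₂ f)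
    (hd : ∀ p ∈ orbitInt a m, dr f p = 0) : ∀ p ∈ orbitInt a m, f p = 0 := by
  intro p hp
  refine eq_zero_of_hasDerivAt_zero (f := fun r => f (r, p.2)) (ρ := rPlus a m)
    (R := max r₂ (rPlus a m)) (fun r hr => ?_) (fun r hr => ?_) hp.1
  · have hp' : (r, p.2) ∈ orbitInt a m := ⟨hr, hp.2⟩
    have := hasDerivAt_dr (ContDiffOn.diffAt (isOpen_orbitInt a m) hf hp')
    rwa [hd _ hp'] at this
  · exact hs (r, p.2) ⟨(le_max_right _ _).trans_lt hr, hp.2⟩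
      fun hc => ((le_max_left _ _).trans_lt hr).not_ge hc.2

/-- The integrating factor is e^{-2γ}. Its multiple `coTh` serves as well, because the extra factor
sin θ does not depend on r. The product is constant in r and zero for large r. -/
theorem eq_zero_of_dr_eq_gam {a m r₁ r₂ : ℝ} (h : |a| < m) {f : ℝ × ℝ → ℝ}
    (hf : ContDiffOn ℝ ∞ f (orbitInt a m)) (hs : SuppIn a m r₁ r₂ f)
    (hd : ∀ p ∈ orbitInt a m, dr f p = 2 * f p * gamR a m p) : ∀ p ∈ orbitInt a m, f p = 0 := by
  have hg : ContDiffOn ℝ ∞ (fun p => coTh a m p) (orbitInt a m) := smooth_coTh h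
  have key := eq_zero_of_dr_eq_zero (f := fun p => f p * coTh a m p) (hf.mul hg)
    (fun p hp hpr => mul_eq_zero_of_left (hs p hp hpr) _) fun p hp => ?_
  · intro p hp
    exact (mul_eq_zero.1 (key p hp)).resolve_right (coTh_pos h hp).ne'
  · have h1 := sigma_pos (a := a) (delta_pos h hp.1).1
    have h2 := pi_pos h hp.1
    have hsn := sin_pos_of_mem hp
    have hc : HasDerivAt (fun r => coTh a m (r, p.2)) (-(2 * coTh a m p * gamR a m p)) p.1 := by
      refine ((hasDerivAt_sigma_r a p).div ((hasDerivAt_pi_r a m p).const_mul (Real.sin p.2))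
        (mul_pos hsn h2).ne').congr_deriv ?_
      simp only [coTh, gamR, Prod.mk.eta]
      field_simp
      ring
    have := ((hasDerivAt_dr (ContDiffOn.diffAt (isOpen_orbitInt a m) hf hp)).mul hc).deriv
    refine this.trans ?_
    rw [hd p hp]
    ring

/-- A continuous nonnegative density with zero integral vanishes identically. For 0 < s < 1 the mass
term finishes. At s = 0 the vanishing of Y_η involves η alone and gives η = 0, after which ∂_rλ = 0;
at s = 1 the roles are exchanged. Values on the axis come from the boundary conditions. -/
theorem HAlt_eq_zero_iff {a m : ℝ} (h : |a| < m) {s : ℝ} (hs : s ∈ Icc (0 : ℝ) 1) {x : PhasePt}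
    (hx : InPhaseSpace a m x) : HAlt a m s x = 0 ↔ x.Vanishes a m := by
  have hO := isOpen_orbitInt a m
  have hS := hx.smoothInt
  constructor
  · intro h0
    have hae : altDensity a m s x =ᵐ[volume.restrict (orbitInt a m)] 0 :=
      (setIntegral_eq_zero_iff_of_nonneg_ae
        (ae_restrict_of_forall_mem hO.measurableSet fun p hp => altDensity_nonneg h hs x hp)
        (hx.integrable_altDensity h s)).1 h0
    have hz : EqOn (altDensity a m s x) 0 (orbitInt a m) :=
      Measure.eqOn_open_of_ae_eq hae hO
        ((hx.axState.altDensity (s := s) h).smooth_slice 0).continuousOn continuousOn_const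
    have hall := fun p (hp : p ∈ orbitInt a m) => eq_zero_of_polar_self h hs hp (hz hp)
    obtain ⟨r₁, r₂, hr, hsupp⟩ := hx.exists_supp
    have hle : ∀ p ∈ orbitInt a m, x.lam p = 0 ∧ x.eta p = 0 := by
      rcases hs.1.eq_or_lt with rfl | hs0
      · have e1 : ∀ p ∈ orbitInt a m, x.eta p = 0 :=
          eq_zero_of_dr_eq_gam h hS.eta hsupp.eta fun p hp => by
            have := (hall p hp).2.2.1
            simp only [yEtaR] at this
            linarith
        have e2 : ∀ p ∈ orbitInt a m, x.lam p = 0 :=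
          eq_zero_of_dr_eq_zero hS.lam hsupp.lam fun p hp => by
            have := (hall p hp).2.2.2.2.1
            simp only [yLamR, e1 p hp] at this
            linarith
        exact fun p hp => ⟨e2 p hp, e1 p hp⟩
      · rcases hs.2.eq_or_lt with rfl | hs1
        · have e1 : ∀ p ∈ orbitInt a m, x.lam p = 0 :=
            eq_zero_of_dr_eq_gam h hS.lam hsupp.lam fun p hp => by
              have := (hall p hp).2.2.2.2.1
              simp only [yLamR] at this
              linarith
          have e2 : ∀ p ∈ orbitInt a m, x.eta p = 0 :=
            eq_zero_of_dr_eq_zero hS.eta hsupp.eta fun p hp => by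
              have := (hall p hp).2.2.1
              simp only [yEtaR, e1 p hp] at this
              linarith
          exact fun p hp => ⟨e1 p hp, e2 p hp⟩
        · exact fun p hp => (hall p hp).2.2.2.2.2.2 (mul_pos hs0 (sub_pos.2 hs1))
    rintro ⟨r, θ⟩ hp
    rcases hp.2.1.eq_or_lt with h0 | h0
    · simp only at h0
      subst h0
      exact ⟨(hx.lam_axis r hp.1).1, (hx.v_axis r hp.1).1, (hx.eta_axis r hp.1).1,
        (hx.u_axis r hp.1).1⟩
    rcases hp.2.2.eq_or_lt with h1 | h1
    · simp only at h1
      subst h1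
      exact ⟨(hx.lam_axis r hp.1).2, (hx.v_axis r hp.1).2, (hx.eta_axis r hp.1).2,
        (hx.u_axis r hp.1).2⟩
    have hp' : (r, θ) ∈ orbitInt a m := ⟨hp.1, h0, h1⟩
    exact ⟨(hle _ hp').1, (hall _ hp').2.1, (hle _ hp').2, (hall _ hp').1⟩
  · intro hv
    -- The interval from 1 to 0 is empty, so this support condition means vanishing everywhere off
    -- the axis.
    have hs0 : x.SuppIn a m 1 0 := ⟨fun p hp _ => (hv p (orbitInt_subset_orbit a m hp)).1,
      fun p hp _ => (hv p (orbitInt_subset_orbit a m hp)).2.1,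
      fun p hp _ => (hv p (orbitInt_subset_orbit a m hp)).2.2.1,
      fun p hp _ => (hv p (orbitInt_subset_orbit a m hp)).2.2.2⟩
    exact setIntegral_eq_zero_of_forall_eq_zero fun p hp =>
      hs0.altDensity h s p hp fun hc => by linarith [hc.1, hc.2]

/-- The Hamiltonians are in involution. -/
theorem hasPoissonBracket_HAlt {a m : ℝ} (h : |a| < m) (s τ : ℝ) {x : PhasePt}
    (hx : InPhaseSpace a m x) : HasPoissonBracket a m (HAlt a m s) (HAlt a m τ) x 0 := by
  -- The gradients of both functionals are the same quadruple, and the bracket density is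
  -- antisymmetric.
  have e : bracketDensity (hamGrad a m x) (hamGrad a m x) = fun _ => 0 := by
    funext p; simp only [bracketDensity]; ring
  exact ⟨_, _, isVarGrad_HAlt h s hx, isVarGrad_HAlt h τ hx, by rw [e]; exact integrableOn_zero,
    by rw [e]; simp⟩


/-! ### Maxwell fields in Boyer-Lindquist coordinates -/

/-- The domain `r > r₊` of the coordinates, without restriction on `θ`. -/
def blDom (a m : ℝ) : Set (Fin 4 → ℝ) := {q | rPlus a m < q 1}

theorem isOpen_blDom (a m : ℝ) : IsOpen (blDom a m) :=
  isOpen_lt continuous_const (continuous_apply 1)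

theorem isOpen_blChart (a m : ℝ) : IsOpen (blChart a m) :=
  (isOpen_lt continuous_const (continuous_apply 1)).inter
    ((isOpen_lt continuous_const (continuous_apply 2)).inter
      (isOpen_lt (continuous_apply 2) continuous_const))

theorem blChart_subset (a m : ℝ) : blChart a m ⊆ blDom a m := fun _ hq => hq.1

theorem mem_orbitInt_of_blChart {a m : ℝ} {q : Fin 4 → ℝ} (hq : q ∈ blChart a m) :
    (q 1, q 2) ∈ orbitInt a m := hq

theorem lift_mem_blChart {a m t : ℝ} {p : ℝ × ℝ} (hp : p ∈ orbitInt a m) :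
    lift t p ∈ blChart a m := hp

theorem contDiff_blMap : ContDiff ℝ ∞ blMap := by
  refine contDiff_pi.2 fun i => ?_
  fin_cases i <;> simp [blMap] <;> fun_prop

theorem blMap_mem_exterior {a m : ℝ} (h : |a| < m) {q : Fin 4 → ℝ} (hq : q ∈ blDom a m) :
    blMap q ∈ exterior a m := by
  have hq' : rPlus a m < q 1 := hq
  have e : (blMap q 1) ^ 2 + (blMap q 2) ^ 2 + (blMap q 3) ^ 2 = (q 1) ^ 2 := by
    simp only [blMap, Matrix.cons_val]
    have h1 := Real.sin_sq_add_cos_sq (q 2)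
    have h2 := Real.sin_sq_add_cos_sq (q 3)
    linear_combination (q 1) ^ 2 * Real.sin (q 2) ^ 2 * h2 + (q 1) ^ 2 * h1
  change rPlus a m < √_
  rw [e, Real.sqrt_sq ((rPlus_pos h).trans hq').le]
  exact hq'

/-- `∂_μ f` is the derivative along the coordinate line. -/
theorem hasDerivAt_pd {f : (Fin 4 → ℝ) → ℝ} {q : Fin 4 → ℝ} (hf : DifferentiableAt ℝ f q)
    (μ : Fin 4) : HasDerivAt (fun τ => f (Function.update q μ τ)) (pd μ f q) (q μ) := by
  have h1 := hasDerivAt_update q μ (q μ)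
  have h2 : HasFDerivAt f (fderiv ℝ f q) (Function.update q μ (q μ)) := by
    rw [Function.update_eq_self]; exact hf.hasFDerivAt
  exact h2.comp_hasDerivAt (q μ) h1

theorem pd_eq_deriv {f : (Fin 4 → ℝ) → ℝ} {q : Fin 4 → ℝ} (hf : DifferentiableAt ℝ f q)
    (μ : Fin 4) : pd μ f q = deriv (fun τ => f (Function.update q μ τ)) (q μ) :=
  (hasDerivAt_pd hf μ).deriv.symm

theorem contDiffOn_pd {U : Set (Fin 4 → ℝ)} (hU : IsOpen U) {f : (Fin 4 → ℝ) → ℝ}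
    (hf : ContDiffOn ℝ ∞ f U) (μ : Fin 4) : ContDiffOn ℝ ∞ (pd μ f) U :=
  (hf.fderiv_of_isOpen hU (m := ∞) (by simp)).clm_apply contDiffOn_const

theorem pd_comm {U : Set (Fin 4 → ℝ)} (hU : IsOpen U) {f : (Fin 4 → ℝ) → ℝ}
    (hf : ContDiffOn ℝ ∞ f U) {q : Fin 4 → ℝ} (hq : q ∈ U) (μ ν : Fin 4) :
    pd μ (pd ν f) q = pd ν (pd μ f) q := by
  have hc : ContDiffAt ℝ ∞ f q := hf.contDiffAt (hU.mem_nhds hq)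
  have hs : IsSymmSndFDerivAt ℝ f q := hc.isSymmSndFDerivAt
    (by simpa using (WithTop.coe_le_coe.2 le_top : ((2 : ℕ∞) : WithTop ℕ∞) ≤ ∞))
  have hd : DifferentiableAt ℝ (fderiv ℝ f) q :=
    (hc.fderiv_right (m := ∞) (by simp)).differentiableAt (by simp)
  unfold pd
  rw [fderiv_clm_apply hd (differentiableAt_const _), fderiv_clm_apply hd (differentiableAt_const _)]
  simpa using hs (Pi.single μ 1) (Pi.single ν 1)

theorem pd_blMap (q : Fin 4 → ℝ) (μ ν : Fin 4) : pd μ (fun q' => blMap q' ν) q =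
    (!![1, 0, 0, 0;
      0, Real.sin (q 2) * Real.cos (q 3), Real.sin (q 2) * Real.sin (q 3), Real.cos (q 2);
      0, q 1 * Real.cos (q 2) * Real.cos (q 3), q 1 * Real.cos (q 2) * Real.sin (q 3),
        -(q 1 * Real.sin (q 2));
      0, -(q 1 * Real.sin (q 2) * Real.sin (q 3)), q 1 * Real.sin (q 2) * Real.cos (q 3), 0] :
      Matrix (Fin 4) (Fin 4) ℝ) μ ν := by
  rw [pd_eq_deriv (((contDiff_pi.1 contDiff_blMap ν).differentiable (by simp)) q)]
  fin_cases μ <;> fin_cases ν <;> simp [blMap]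

theorem blPot_zero (A : (Fin 4 → ℝ) → Fin 4 → ℝ) (q : Fin 4 → ℝ) :
    blPot A q 0 = A (blMap q) 0 := by
  simp [blPot, pd_blMap, Fin.sum_univ_succ]

theorem blPot_one (A : (Fin 4 → ℝ) → Fin 4 → ℝ) (q : Fin 4 → ℝ) :
    blPot A q 1 = A (blMap q) 1 * (Real.sin (q 2) * Real.cos (q 3))
      + A (blMap q) 2 * (Real.sin (q 2) * Real.sin (q 3)) + A (blMap q) 3 * Real.cos (q 2) := by
  simp [blPot, pd_blMap, Fin.sum_univ_succ]; ring

theorem blPot_two (A : (Fin 4 → ℝ) → Fin 4 → ℝ) (q : Fin 4 → ℝ) :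
    blPot A q 2 = A (blMap q) 1 * (q 1 * Real.cos (q 2) * Real.cos (q 3))
      + A (blMap q) 2 * (q 1 * Real.cos (q 2) * Real.sin (q 3))
      - A (blMap q) 3 * (q 1 * Real.sin (q 2)) := by
  simp [blPot, pd_blMap, Fin.sum_univ_succ]; ring

theorem blPot_three (A : (Fin 4 → ℝ) → Fin 4 → ℝ) (q : Fin 4 → ℝ) :
    blPot A q 3 = -(A (blMap q) 1 * (q 1 * Real.sin (q 2) * Real.sin (q 3)))
      + A (blMap q) 2 * (q 1 * Real.sin (q 2) * Real.cos (q 3)) := by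
  simp [blPot, pd_blMap, Fin.sum_univ_succ]

/-- The sign of the component `A_μ` under the reflection `(θ, φ) ↦ (-θ, φ + π)`. -/
def reflSign (μ : Fin 4) : ℝ := if μ = 2 then -1 else 1

/-- `(t, r, -θ, φ)` and `(t, r, θ, φ - π)` are the same point. -/
theorem blPot_refl (A : (Fin 4 → ℝ) → Fin 4 → ℝ) (t r θ φ θ' : ℝ)
    (hs : Real.sin θ' = -Real.sin θ) (hc : Real.cos θ' = Real.cos θ) (μ : Fin 4) :
    blPot A ![t, r, θ', φ] μ = reflSign μ * blPot A ![t, r, θ, φ - Real.pi] μ := by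
  have e : blMap ![t, r, θ', φ] = blMap ![t, r, θ, φ - Real.pi] := by
    funext i
    fin_cases i <;> simp [blMap, hs, hc, Real.sin_sub_pi, Real.cos_sub_pi]
  fin_cases μ
  · simp [blPot_zero, e, reflSign]
  · simp [blPot_one, e, reflSign, hs, hc, Real.sin_sub_pi, Real.cos_sub_pi]
  · simp [blPot_two, e, reflSign, hs, hc, Real.sin_sub_pi, Real.cos_sub_pi]; ring
  · simp [blPot_three, e, reflSign, hs, Real.sin_sub_pi, Real.cos_sub_pi]

theorem contDiffOn_blPot {a m : ℝ} (h : |a| < m) {A : (Fin 4 → ℝ) → Fin 4 → ℝ}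
    (hA : ContDiffOn ℝ ∞ A (exterior a m)) (μ : Fin 4) :
    ContDiffOn ℝ ∞ (fun q => blPot A q μ) (blDom a m) := by
  unfold blPot
  refine ContDiffOn.sum fun ν _ => ContDiffOn.mul ?_ ?_
  · exact (contDiffOn_pi.1 hA ν).comp contDiff_blMap.contDiffOn fun q hq => blMap_mem_exterior h hq
  · exact contDiffOn_pd (isOpen_blDom a m) (contDiff_pi.1 contDiff_blMap ν).contDiffOn μ

theorem contDiffOn_faraday {a m : ℝ} (h : |a| < m) {A : (Fin 4 → ℝ) → Fin 4 → ℝ}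
    (hA : ContDiffOn ℝ ∞ A (exterior a m)) (μ ν : Fin 4) :
    ContDiffOn ℝ ∞ (faraday A μ ν) (blDom a m) :=
  (contDiffOn_pd (isOpen_blDom a m) (contDiffOn_blPot h hA ν) μ).sub
    (contDiffOn_pd (isOpen_blDom a m) (contDiffOn_blPot h hA μ) ν)

theorem differentiableAt_of_contDiffOn {U : Set (Fin 4 → ℝ)} (hU : IsOpen U)
    {f : (Fin 4 → ℝ) → ℝ} (hf : ContDiffOn ℝ ∞ f U) {q : Fin 4 → ℝ} (hq : q ∈ U) :
    DifferentiableAt ℝ f q :=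
  (hf.differentiableOn (by simp)).differentiableAt (hU.mem_nhds hq)

theorem update_three_mem_blChart {a m : ℝ} {q : Fin 4 → ℝ} (hq : q ∈ blChart a m) (τ : ℝ) :
    Function.update q 3 τ ∈ blChart a m := by
  simpa [blChart] using hq

theorem eq_of_pd_three_eq_zero {a m : ℝ} {f : (Fin 4 → ℝ) → ℝ}
    (hf : ContDiffOn ℝ ∞ f (blChart a m)) (h3 : ∀ q ∈ blChart a m, pd 3 f q = 0)
    {q : Fin 4 → ℝ} (hq : q ∈ blChart a m) (τ : ℝ) : f (Function.update q 3 τ) = f q := by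
  have hd : ∀ τ, HasDerivAt (fun τ => f (Function.update q 3 τ)) 0 τ := fun τ => by
    have hm := update_three_mem_blChart hq τ
    have := hasDerivAt_pd (differentiableAt_of_contDiffOn (isOpen_blChart a m) hf hm) 3
    rw [h3 _ hm] at this
    simpa using this
  have := is_const_of_deriv_eq_zero (fun τ => (hd τ).differentiableAt) (fun τ => (hd τ).deriv)
    τ (q 3)
  simpa using this

theorem pd_three_faraday {a m : ℝ} (h : |a| < m) {A : (Fin 4 → ℝ) → Fin 4 → ℝ}
    (hA : IsAxisymMaxwell a m A) (μ ν : Fin 4) {q : Fin 4 → ℝ} (hq : q ∈ blChart a m) :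
    pd 3 (faraday A μ ν) q = 0 := by
  have hO := isOpen_blChart a m
  have hP := fun μ => (contDiffOn_blPot h hA.smooth μ).mono (blChart_subset a m)
  have key : ∀ μ ν, pd 3 (pd μ fun q => blPot A q ν) q = 0 := fun μ ν => by
    rw [pd_comm hO (hP ν) hq]
    have : pd 3 (fun q => blPot A q ν) =ᶠ[nhds q] fun _ => 0 := by
      filter_upwards [hO.mem_nhds hq] with q' hq' using hA.axisym q' hq' ν
    rw [pd, this.fderiv_eq]
    simp
  have hd := fun μ ν => differentiableAt_of_contDiffOn hO (contDiffOn_pd hO (hP ν) μ) hq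
  have e : pd 3 (faraday A μ ν) q = pd 3 (pd μ fun q => blPot A q ν) q
      - pd 3 (pd ν fun q => blPot A q μ) q := by
    change fderiv ℝ (fun q => pd μ (fun q => blPot A q ν) q - pd ν (fun q => blPot A q μ) q) q _ = _
    rw [fderiv_fun_sub (hd μ ν) (hd ν μ)]
    rfl
  rw [e, key, key, sub_zero]

/-- The Faraday tensor is independent of `φ`. -/
theorem faraday_update_three {a m : ℝ} (h : |a| < m) {A : (Fin 4 → ℝ) → Fin 4 → ℝ}
    (hA : IsAxisymMaxwell a m A) (μ ν : Fin 4) {q : Fin 4 → ℝ} (hq : q ∈ blChart a m) (τ : ℝ) :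
    faraday A μ ν (Function.update q 3 τ) = faraday A μ ν q :=
  eq_of_pd_three_eq_zero ((contDiffOn_faraday h hA.smooth μ ν).mono (blChart_subset a m))
    (fun _ hq => pd_three_faraday h hA μ ν hq) hq τ

theorem pd_three_faradayUp {a m : ℝ} (h : |a| < m) {A : (Fin 4 → ℝ) → Fin 4 → ℝ}
    (hA : IsAxisymMaxwell a m A) (μ ν : Fin 4) {q : Fin 4 → ℝ} (hq : q ∈ blChart a m) :
    pd 3 (faradayUp a m A μ ν) q = 0 := by
  by_cases hd : DifferentiableAt ℝ (faradayUp a m A μ ν) q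
  · have e : (fun τ => faradayUp a m A μ ν (Function.update q 3 τ)) =
        fun _ => faradayUp a m A μ ν q := funext fun τ => by
      simp only [faradayUp, faraday_update_three h hA _ _ hq τ]
      simp
    rw [pd_eq_deriv hd, e, deriv_const]
  -- `fderiv` is zero by convention where the derivative does not exist, so no regularity of the
  -- raised tensor is required yet.
  · rw [pd, fderiv_zero_of_not_differentiableAt hd]; simp

theorem faraday_antisymm (A : (Fin 4 → ℝ) → Fin 4 → ℝ) (μ ν : Fin 4) (q : Fin 4 → ℝ) :
    faraday A μ ν q = -faraday A ν μ q := by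
  simp [faraday]

theorem faraday_self (A : (Fin 4 → ℝ) → Fin 4 → ℝ) (μ : Fin 4) (q : Fin 4 → ℝ) :
    faraday A μ μ q = 0 := by
  simp [faraday]

theorem faradayUp_antisymm (a m : ℝ) (A : (Fin 4 → ℝ) → Fin 4 → ℝ) (μ ν : Fin 4) :
    faradayUp a m A μ ν = fun q => -faradayUp a m A ν μ q := by
  funext q
  simp only [faradayUp]
  rw [Finset.sum_comm, ← mul_neg, ← Finset.sum_neg_distrib]
  congr 1
  refine Finset.sum_congr rfl fun β _ => ?_
  rw [← Finset.sum_neg_distrib]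
  refine Finset.sum_congr rfl fun α _ => ?_
  rw [faraday_antisymm A α β]
  ring

/-! ### The inverse metric -/

/-- The inverse of the Kerr metric in Boyer-Lindquist coordinates. -/
def kerrInv (a m : ℝ) (p : ℝ × ℝ) : Matrix (Fin 4) (Fin 4) ℝ :=
  !![-(kPi a m p / (kSigma a p * kDelta a m p)), 0, 0,
      -(2 * a * m * p.1 / (kSigma a p * kDelta a m p));
    0, kDelta a m p / kSigma a p, 0, 0;
    0, 0, 1 / kSigma a p, 0;
    -(2 * a * m * p.1 / (kSigma a p * kDelta a m p)), 0, 0,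
      (kDelta a m p - a ^ 2 * Real.sin p.2 ^ 2) / (kSigma a p * kDelta a m p * Real.sin p.2 ^ 2)]

theorem inv_kerrMetric {a m : ℝ} (h : |a| < m) {p : ℝ × ℝ} (hp : p ∈ orbitInt a m) :
    (kerrMetric a m p)⁻¹ = kerrInv a m p := by
  have h1 := sigma_pos (a := a) (delta_pos h hp.1).1
  have hD := (delta_pos h hp.1).2
  have hs := sin_pos_of_mem hp
  have h' : Real.cos p.2 ^ 2 = 1 - Real.sin p.2 ^ 2 := by
      linarith [Real.sin_sq_add_cos_sq p.2]
  refine Matrix.inv_eq_right_inv ?_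
  ext i j
  fin_cases i <;> fin_cases j <;>
    simp [kerrMetric, kerrInv, Matrix.mul_apply, Fin.sum_univ_succ] <;> field_simp <;>
    simp only [kSigma, kPi, kDelta, h'] <;> ring

/-- The axis is deliberately allowed: the determinant vanishes there, which fixes the values of the
densities on the axis. -/
theorem det_kerrMetric {a m : ℝ} (h : |a| < m) {p : ℝ × ℝ} (hp : rPlus a m < p.1) :
    (kerrMetric a m p).det = -(kSigma a p * Real.sin p.2) ^ 2 := by
  have h1 := sigma_pos (a := a) (delta_pos h hp).1
  have hD := (delta_pos h hp).2
  have h' : Real.cos p.2 ^ 2 = 1 - Real.sin p.2 ^ 2 := by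
      linarith [Real.sin_sq_add_cos_sq p.2]
  simp [kerrMetric, Matrix.det_succ_row_zero, Fin.sum_univ_succ, Fin.succAbove]
  field_simp
  simp only [kSigma, kDelta, h']
  ring

theorem faradayUp_eq {a m : ℝ} (h : |a| < m) (A : (Fin 4 → ℝ) → Fin 4 → ℝ) (μ ν : Fin 4)
    {q : Fin 4 → ℝ} (hq : q ∈ blChart a m) :
    faradayUp a m A μ ν q = kSigma a (q 1, q 2) * Real.sin (q 2) *
      ∑ α, ∑ β, kerrInv a m (q 1, q 2) μ α * kerrInv a m (q 1, q 2) ν β * faraday A α β q := by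
  have hp := mem_orbitInt_of_blChart hq
  have h1 := sigma_pos (a := a) (delta_pos h hp.1).1
  have hs : 0 < Real.sin (q 2) := sin_pos_of_mem (p := (q 1, q 2)) hp
  rw [faradayUp, inv_kerrMetric h hp, det_kerrMetric (p := (q 1, q 2)) h hp.1, neg_neg, Real.sqrt_sq (by positivity)]

section Components
variable {a m : ℝ} {A : (Fin 4 → ℝ) → Fin 4 → ℝ} {q : Fin 4 → ℝ}

theorem faradayUp_zero_one (h : |a| < m) (hq : q ∈ blChart a m) : faradayUp a m A 0 1 q =
    -(Real.sin (q 2) / kSigma a (q 1, q 2)) *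
      (kPi a m (q 1, q 2) * faraday A 0 1 q + 2 * a * m * q 1 * faraday A 3 1 q) := by
  have hp := mem_orbitInt_of_blChart hq
  have h1 := sigma_pos (a := a) (delta_pos h hp.1).1
  have hD := (delta_pos h hp.1).2
  rw [faradayUp_eq h A 0 1 hq]
  simp [kerrInv, Fin.sum_univ_succ]
  field_simp
  ring

theorem faradayUp_zero_two (h : |a| < m) (hq : q ∈ blChart a m) : faradayUp a m A 0 2 q =
    -(Real.sin (q 2) / (kSigma a (q 1, q 2) * kDelta a m (q 1, q 2))) *
      (kPi a m (q 1, q 2) * faraday A 0 2 q + 2 * a * m * q 1 * faraday A 3 2 q) := by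
  have hp := mem_orbitInt_of_blChart hq
  have h1 := sigma_pos (a := a) (delta_pos h hp.1).1
  have hD := (delta_pos h hp.1).2
  rw [faradayUp_eq h A 0 2 hq]
  simp [kerrInv, Fin.sum_univ_succ]
  field_simp
  ring

theorem faradayUp_one_two (h : |a| < m) (hq : q ∈ blChart a m) : faradayUp a m A 1 2 q =
    coK a m (q 1, q 2) * faraday A 1 2 q := by
  have hp := mem_orbitInt_of_blChart hq
  have h1 := sigma_pos (a := a) (delta_pos h hp.1).1
  rw [faradayUp_eq h A 1 2 hq]
  simp [kerrInv, Fin.sum_univ_succ, coK]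
  field_simp

/-- Raising both indices of an antisymmetric tensor within the (t, φ) block multiplies it by the
determinant of the inverse block, -1/(Δ sin²θ). -/
theorem faradayUp_zero_three (h : |a| < m) (hq : q ∈ blChart a m) : faradayUp a m A 0 3 q =
    -(kSigma a (q 1, q 2) / (kDelta a m (q 1, q 2) * Real.sin (q 2))) * faraday A 0 3 q := by
  have hp := mem_orbitInt_of_blChart hq
  have h1 := sigma_pos (a := a) (delta_pos h hp.1).1
  have hD := (delta_pos h hp.1).2
  have hs : 0 < Real.sin (q 2) := sin_pos_of_mem (p := (q 1, q 2)) hp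
  have h' : Real.cos (q 2) ^ 2 = 1 - Real.sin (q 2) ^ 2 := by
      linarith [Real.sin_sq_add_cos_sq (q 2)]
  rw [faradayUp_eq h A 0 3 hq]
  simp [kerrInv, Fin.sum_univ_succ, faraday_self, faraday_antisymm A 3 0]
  field_simp
  simp only [kSigma, kPi, kDelta, h']
  ring

theorem faradayUp_one_three (h : |a| < m) (hq : q ∈ blChart a m) : faradayUp a m A 1 3 q =
    2 * a * m * q 1 * Real.sin (q 2) / kSigma a (q 1, q 2) * faraday A 0 1 q
      + (kDelta a m (q 1, q 2) - a ^ 2 * Real.sin (q 2) ^ 2) /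
        (kSigma a (q 1, q 2) * Real.sin (q 2)) * faraday A 1 3 q := by
  have hp := mem_orbitInt_of_blChart hq
  have h1 := sigma_pos (a := a) (delta_pos h hp.1).1
  have hD := (delta_pos h hp.1).2
  have hs : 0 < Real.sin (q 2) := sin_pos_of_mem (p := (q 1, q 2)) hp
  rw [faradayUp_eq h A 1 3 hq]
  simp [kerrInv, Fin.sum_univ_succ, faraday_antisymm A 1 0]
  field_simp

theorem faradayUp_two_three (h : |a| < m) (hq : q ∈ blChart a m) : faradayUp a m A 2 3 q =
    2 * a * m * q 1 * Real.sin (q 2) / (kSigma a (q 1, q 2) * kDelta a m (q 1, q 2)) *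
      faraday A 0 2 q + (kDelta a m (q 1, q 2) - a ^ 2 * Real.sin (q 2) ^ 2) /
        (kSigma a (q 1, q 2) * kDelta a m (q 1, q 2) * Real.sin (q 2)) * faraday A 2 3 q := by
  have hp := mem_orbitInt_of_blChart hq
  have h1 := sigma_pos (a := a) (delta_pos h hp.1).1
  have hD := (delta_pos h hp.1).2
  have hs : 0 < Real.sin (q 2) := sin_pos_of_mem (p := (q 1, q 2)) hp
  rw [faradayUp_eq h A 2 3 hq]
  simp [kerrInv, Fin.sum_univ_succ, faraday_antisymm A 2 0]
  field_simp

end Components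

theorem contDiffOn_faradayUp {a m : ℝ} (h : |a| < m) {A : (Fin 4 → ℝ) → Fin 4 → ℝ}
    (hA : ContDiffOn ℝ ∞ A (exterior a m)) (μ ν : Fin 4) :
    ContDiffOn ℝ ∞ (faradayUp a m A μ ν) (blChart a m) := by
  have hF := fun μ ν => (contDiffOn_faraday h hA μ ν).mono (blChart_subset a m)
  have c2 : ContDiff ℝ ∞ fun q : Fin 4 → ℝ => (q 1, q 2) := by fun_prop
  have cS : ContDiff ℝ ∞ fun q : Fin 4 → ℝ => kSigma a (q 1, q 2) := (contDiff_sigma a).comp c2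
  have cD : ContDiff ℝ ∞ fun q : Fin 4 → ℝ => kDelta a m (q 1, q 2) := (contDiff_delta a m).comp c2
  have cP : ContDiff ℝ ∞ fun q : Fin 4 → ℝ => kPi a m (q 1, q 2) := (contDiff_kPi a m).comp c2
  have nS : ∀ q ∈ blChart a m, kSigma a (q 1, q 2) ≠ 0 := fun q hq =>
    (sigma_pos (delta_pos (p := (q 1, q 2)) h hq.1).1).ne'
  have nD : ∀ q ∈ blChart a m, kDelta a m (q 1, q 2) ≠ 0 := fun q hq =>
    (delta_pos (p := (q 1, q 2)) h hq.1).2.ne'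
  have ns : ∀ q ∈ blChart a m, Real.sin (q 2) ≠ 0 := fun q hq =>
    (sin_pos_of_mem (p := (q 1, q 2)) hq).ne'
  have cI : ∀ i j, ContDiffOn ℝ ∞ (fun q : Fin 4 → ℝ => kerrInv a m (q 1, q 2) i j)
      (blChart a m) := by
    have z : ContDiffOn ℝ ∞ (fun _ : Fin 4 → ℝ => (0 : ℝ)) (blChart a m) := contDiffOn_const
    have e00 : ContDiffOn ℝ ∞ (fun q : Fin 4 → ℝ => -(kPi a m (q 1, q 2) /
        (kSigma a (q 1, q 2) * kDelta a m (q 1, q 2)))) (blChart a m) :=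
      (cP.contDiffOn.div (cS.mul cD).contDiffOn fun q hq => mul_ne_zero (nS q hq) (nD q hq)).neg
    have e03 : ContDiffOn ℝ ∞ (fun q : Fin 4 → ℝ => -(2 * a * m * q 1 /
        (kSigma a (q 1, q 2) * kDelta a m (q 1, q 2)))) (blChart a m) :=
      (ContDiffOn.div (ContDiff.contDiffOn (by fun_prop)) (cS.mul cD).contDiffOn
        fun q hq => mul_ne_zero (nS q hq) (nD q hq)).neg
    have e11 : ContDiffOn ℝ ∞ (fun q : Fin 4 → ℝ => kDelta a m (q 1, q 2) / kSigma a (q 1, q 2))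
        (blChart a m) := cD.contDiffOn.div cS.contDiffOn nS
    have e22 : ContDiffOn ℝ ∞ (fun q : Fin 4 → ℝ => 1 / kSigma a (q 1, q 2))
        (blChart a m) := contDiffOn_const.div cS.contDiffOn nS
    have e33 : ContDiffOn ℝ ∞ (fun q : Fin 4 → ℝ =>
        (kDelta a m (q 1, q 2) - a ^ 2 * Real.sin (q 2) ^ 2) /
        (kSigma a (q 1, q 2) * kDelta a m (q 1, q 2) * Real.sin (q 2) ^ 2)) (blChart a m) :=
      ContDiffOn.div (ContDiff.contDiffOn (by fun_prop)) (ContDiff.contDiffOn (by fun_prop))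
        fun q hq => mul_ne_zero (mul_ne_zero (nS q hq) (nD q hq)) (pow_ne_zero 2 (ns q hq))
    intro i j
    fin_cases i <;> fin_cases j <;> simp [kerrInv] <;>
      first
        | exact z | exact e00 | exact e03 | exact e11 | exact e33 | simpa using e22
  refine ContDiffOn.congr ?_ fun q hq => faradayUp_eq h A μ ν hq
  refine ContDiffOn.mul (ContDiff.contDiffOn (by fun_prop)) ?_
  exact ContDiffOn.sum fun α _ => ContDiffOn.sum fun β _ =>
    ((cI μ α).mul (cI ν β)).mul (hF α β)


/-! ### The reduced Maxwell system -/

/-- Space-time points with `r > r₊`, without restriction on `θ`. -/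
def stDom (a m : ℝ) : Set (ℝ × (ℝ × ℝ)) := univ ×ˢ (Ioi (rPlus a m) ×ˢ univ)

theorem isOpen_stDom (a m : ℝ) : IsOpen (stDom a m) :=
  isOpen_univ.prod (isOpen_Ioi.prod isOpen_univ)

theorem stOrb_subset_stDom (a m : ℝ) : stOrb a m ⊆ stDom a m :=
  fun _ hz => ⟨mem_univ _, hz.2.1, mem_univ _⟩

theorem stInt_subset_stDom (a m : ℝ) : stInt a m ⊆ stDom a m :=
  (stInt_subset_stOrb a m).trans (stOrb_subset_stDom a m)

/-- The slice `φ = 0`. -/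
def sl (G : (Fin 4 → ℝ) → ℝ) (z : ℝ × (ℝ × ℝ)) : ℝ := G (lift z.1 z.2)

/-- The embedding of the slice `φ = 0`. -/
def liftL : ℝ × (ℝ × ℝ) →L[ℝ] (Fin 4 → ℝ) :=
  ContinuousLinearMap.pi ![ContinuousLinearMap.fst ℝ ℝ (ℝ × ℝ),
    (ContinuousLinearMap.fst ℝ ℝ ℝ).comp (ContinuousLinearMap.snd ℝ ℝ (ℝ × ℝ)),
    (ContinuousLinearMap.snd ℝ ℝ ℝ).comp (ContinuousLinearMap.snd ℝ ℝ (ℝ × ℝ)), 0]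

theorem liftL_apply (z : ℝ × (ℝ × ℝ)) : liftL z = lift z.1 z.2 := by
  funext i; fin_cases i <;> simp [liftL, lift]

theorem hasFDerivAt_sl {G : (Fin 4 → ℝ) → ℝ} {z : ℝ × (ℝ × ℝ)}
    (hG : DifferentiableAt ℝ G (lift z.1 z.2)) :
    HasFDerivAt (sl G) ((fderiv ℝ G (lift z.1 z.2)).comp liftL) z := by
  have e : sl G = G ∘ liftL := funext fun z => by simp [sl, liftL_apply]
  rw [e]
  rw [← liftL_apply] at hG ⊢
  exact hG.hasFDerivAt.comp z liftL.hasFDerivAt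

theorem fderiv_sl_dirT {G : (Fin 4 → ℝ) → ℝ} {z : ℝ × (ℝ × ℝ)}
    (hG : DifferentiableAt ℝ G (lift z.1 z.2)) :
    fderiv ℝ (sl G) z dirT = pd 0 G (lift z.1 z.2) := by
  have e : liftL dirT = Pi.single 0 1 := by
    funext i; fin_cases i <;> simp [liftL, dirT]
  rw [(hasFDerivAt_sl hG).fderiv, ContinuousLinearMap.comp_apply, e, pd]

theorem fderiv_sl_dirR {G : (Fin 4 → ℝ) → ℝ} {z : ℝ × (ℝ × ℝ)}
    (hG : DifferentiableAt ℝ G (lift z.1 z.2)) :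
    fderiv ℝ (sl G) z dirR = pd 1 G (lift z.1 z.2) := by
  have e : liftL dirR = Pi.single 1 1 := by
    funext i; fin_cases i <;> simp [liftL, dirR]
  rw [(hasFDerivAt_sl hG).fderiv, ContinuousLinearMap.comp_apply, e, pd]

theorem fderiv_sl_dirTh {G : (Fin 4 → ℝ) → ℝ} {z : ℝ × (ℝ × ℝ)}
    (hG : DifferentiableAt ℝ G (lift z.1 z.2)) :
    fderiv ℝ (sl G) z dirTh = pd 2 G (lift z.1 z.2) := by
  have e : liftL dirTh = Pi.single 2 1 := by
    funext i; fin_cases i <;> simp [liftL, dirTh]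
  rw [(hasFDerivAt_sl hG).fderiv, ContinuousLinearMap.comp_apply, e, pd]

theorem lift_mem_blDom {a m : ℝ} {z : ℝ × (ℝ × ℝ)} (hz : z ∈ stDom a m) :
    lift z.1 z.2 ∈ blDom a m := hz.2.1

theorem contDiffOn_sl {a m : ℝ} {G : (Fin 4 → ℝ) → ℝ} (hG : ContDiffOn ℝ ∞ G (blDom a m)) :
    ContDiffOn ℝ ∞ (sl G) (stDom a m) := by
  have e : sl G = G ∘ liftL := funext fun z => by simp [sl, liftL_apply]
  rw [e]
  exact hG.comp liftL.contDiff.contDiffOn fun z hz => by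
    rw [liftL_apply]; exact lift_mem_blDom hz

/-- `𝔈^r` in terms of `F_{tr}` and `λ`. -/
def elR (a m : ℝ) (f01 lam : ℝ × (ℝ × ℝ) → ℝ) (z : ℝ × (ℝ × ℝ)) : ℝ :=
  -(Real.sin z.2.2 / kSigma a z.2) *
    (kPi a m z.2 * f01 z - 2 * a * m * z.2.1 * fderiv ℝ lam z dirR)

/-- `𝔈^θ` in terms of `F_{tθ}` and `λ`. -/
def elTh (a m : ℝ) (f02 lam : ℝ × (ℝ × ℝ) → ℝ) (z : ℝ × (ℝ × ℝ)) : ℝ :=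
  -(Real.sin z.2.2 / (kSigma a z.2 * kDelta a m z.2)) *
    (kPi a m z.2 * f02 z - 2 * a * m * z.2.1 * fderiv ℝ lam z dirTh)

/-- `√(-det ḡ) F^{rφ}` in terms of `F_{tr}` and `λ`. -/
def upRPhi (a m : ℝ) (f01 lam : ℝ × (ℝ × ℝ) → ℝ) (z : ℝ × (ℝ × ℝ)) : ℝ :=
  2 * a * m * z.2.1 * Real.sin z.2.2 / kSigma a z.2 * f01 z
    + (kDelta a m z.2 - a ^ 2 * Real.sin z.2.2 ^ 2) /
      (kSigma a z.2 * Real.sin z.2.2) * fderiv ℝ lam z dirR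

/-- `√(-det ḡ) F^{θφ}` in terms of `F_{tθ}` and `λ`. -/
def upThPhi (a m : ℝ) (f02 lam : ℝ × (ℝ × ℝ) → ℝ) (z : ℝ × (ℝ × ℝ)) : ℝ :=
  2 * a * m * z.2.1 * Real.sin z.2.2 / (kSigma a z.2 * kDelta a m z.2) * f02 z
    + (kDelta a m z.2 - a ^ 2 * Real.sin z.2.2 ^ 2) /
      (kSigma a z.2 * kDelta a m z.2 * Real.sin z.2.2) * fderiv ℝ lam z dirTh

/-- `-𝔈^φ`, where `λ = w sin θ`. -/
def momV (a m : ℝ) (w : ℝ × (ℝ × ℝ) → ℝ) (z : ℝ × (ℝ × ℝ)) : ℝ :=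
  kSigma a z.2 / kDelta a m z.2 * fderiv ℝ w z dirT

/-- The Maxwell equations for `w = A_φ / sin θ`, `F_{tr}`, `F_{tθ}`, `u = F_{rθ}`. -/
structure ReducedMaxwell (a m : ℝ) (lam w f01 f02 u : ℝ × (ℝ × ℝ) → ℝ) : Prop where
  smooth_w : ContDiffOn ℝ ∞ w (stDom a m)
  smooth_01 : ContDiffOn ℝ ∞ f01 (stDom a m)
  smooth_02 : ContDiffOn ℝ ∞ f02 (stDom a m)
  smooth_u : ContDiffOn ℝ ∞ u (stDom a m)
  lam_eq : lam = fun z => Real.sin z.2.2 * w z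
  w_axis : AxisZero a m w
  u_axis : AxisZero a m u
  gauss : ∀ z ∈ stInt a m,
    fderiv ℝ (elR a m f01 lam) z dirR + fderiv ℝ (elTh a m f02 lam) z dirTh = 0
  ampere_r : ∀ z ∈ stInt a m, fderiv ℝ (elR a m f01 lam) z dirT =
    fderiv ℝ (fun z => coK a m z.2 * u z) z dirTh
  ampere_th : ∀ z ∈ stInt a m, fderiv ℝ (elTh a m f02 lam) z dirT =
    -fderiv ℝ (fun z => coK a m z.2 * u z) z dirR
  ampere_phi : ∀ z ∈ stInt a m, fderiv ℝ (momV a m w) z dirT =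
    fderiv ℝ (upRPhi a m f01 lam) z dirR + fderiv ℝ (upThPhi a m f02 lam) z dirTh
  bianchi : ∀ z ∈ stInt a m, fderiv ℝ u z dirT = fderiv ℝ f02 z dirR - fderiv ℝ f01 z dirTh

/-- Oddness is asked only along a filter at c: axial symmetry is available for 0 < θ < π, that is,
on one side of each pole, and continuity does the rest. -/
theorem eq_zero_of_odd {f : ℝ → ℝ} {c : ℝ} {F : Filter ℝ} [F.NeBot] (hF : F ≤ nhds c)
    (hf : ContinuousAt f c) (h : ∀ᶠ x in F, f (2 * c - x) = -f x) : f c = 0 := by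
  have h1 : Filter.Tendsto f F (nhds (f c)) := hf.tendsto.mono_left hF
  have h2 : Filter.Tendsto (fun x => f (2 * c - x)) F (nhds (f c)) := by
    refine hf.tendsto.comp (Filter.Tendsto.mono_left ?_ hF)
    exact (by fun_prop : Continuous fun x : ℝ => 2 * c - x).tendsto' _ _ (by ring)
  have h3 := tendsto_nhds_unique (h2.congr' h) h1.neg
  linarith

section Axisymmetric
variable {a m : ℝ} {A : (Fin 4 → ℝ) → Fin 4 → ℝ}

/-- Behaviour of the components `A_μ` under reflections of `θ` at the axis. -/
theorem sl_blPot_refl (h : |a| < m) (hA : IsAxisymMaxwell a m A) (μ : Fin 4) {t r θ θ' : ℝ}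
    (hr : rPlus a m < r) (hθ : θ ∈ Ioo 0 Real.pi) (hs : Real.sin θ' = -Real.sin θ)
    (hc : Real.cos θ' = Real.cos θ) :
    sl (fun q => blPot A q μ) (t, (r, θ')) = reflSign μ * sl (fun q => blPot A q μ) (t, (r, θ)) := by
  have hq : lift t (r, θ) ∈ blChart a m := lift_mem_blChart (p := (r, θ)) ⟨hr, hθ⟩
  have e1 := blPot_refl A t r θ 0 θ' hs hc μ
  have e2 := eq_of_pd_three_eq_zero ((contDiffOn_blPot h hA.smooth μ).mono (blChart_subset a m))
    (fun q hq => hA.axisym q hq μ) hq (0 - Real.pi)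
  have e3 : Function.update (lift t (r, θ)) 3 (0 - Real.pi) = ![t, r, θ, 0 - Real.pi] := by
    funext i; fin_cases i <;> simp [lift]
  rw [e3] at e2
  simp only [sl]
  rw [← e2]
  exact e1

theorem smooth_sl_blPot (h : |a| < m) (hA : IsAxisymMaxwell a m A) (μ : Fin 4) :
    ContDiffOn ℝ ∞ (sl fun q => blPot A q μ) (stDom a m) :=
  contDiffOn_sl (contDiffOn_blPot h hA.smooth μ)

theorem continuousAt_theta {f : ℝ × (ℝ × ℝ) → ℝ} (hf : ContDiffOn ℝ ∞ f (stDom a m)) {t r : ℝ}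
    (hr : rPlus a m < r) (θ : ℝ) : ContinuousAt (fun θ => f (t, (r, θ))) θ := by
  have h1 : ContinuousAt f (t, (r, θ)) :=
    hf.continuousOn.continuousAt ((isOpen_stDom a m).mem_nhds ⟨mem_univ _, hr, mem_univ _⟩)
  exact ContinuousAt.comp (f := fun θ : ℝ => (t, (r, θ))) h1 (by fun_prop)

theorem axisZero_of_odd {f : ℝ × (ℝ × ℝ) → ℝ} (hf : ContDiffOn ℝ ∞ f (stDom a m))
    (h : ∀ t r θ θ', rPlus a m < r → θ ∈ Ioo 0 Real.pi → Real.sin θ' = -Real.sin θ →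
      Real.cos θ' = Real.cos θ → f (t, (r, θ')) = -f (t, (r, θ))) : AxisZero a m f := by
  intro t r hr
  constructor
  · refine eq_zero_of_odd (F := nhdsWithin 0 (Ioi 0)) nhdsWithin_le_nhds
      (continuousAt_theta hf hr 0) ?_
    filter_upwards [Ioo_mem_nhdsGT Real.pi_pos] with θ hθ
    exact h t r θ _ hr hθ (by simp) (by simp)
  · refine eq_zero_of_odd (F := nhdsWithin Real.pi (Iio Real.pi)) nhdsWithin_le_nhds
      (continuousAt_theta hf hr Real.pi) ?_
    filter_upwards [Ioo_mem_nhdsLT Real.pi_pos] with θ hθ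
    exact h t r θ _ hr hθ (Real.sin_two_pi_sub θ) (Real.cos_two_pi_sub θ)

theorem differentiableAt_of_stDom {f : ℝ × (ℝ × ℝ) → ℝ} (hf : ContDiffOn ℝ ∞ f (stDom a m))
    {z : ℝ × (ℝ × ℝ)} (hz : z ∈ stDom a m) : DifferentiableAt ℝ f z :=
  (hf.differentiableOn (by simp)).differentiableAt ((isOpen_stDom a m).mem_nhds hz)

theorem smooth_fderiv_stDom {f : ℝ × (ℝ × ℝ) → ℝ} (hf : ContDiffOn ℝ ∞ f (stDom a m))
    (e : ℝ × (ℝ × ℝ)) : ContDiffOn ℝ ∞ (fun z => fderiv ℝ f z e) (stDom a m) :=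
  (hf.fderiv_of_isOpen (isOpen_stDom a m) (m := ∞) (by simp)).clm_apply contDiffOn_const

theorem axisZero_fderiv_dirR {f : ℝ × (ℝ × ℝ) → ℝ} (hf : ContDiffOn ℝ ∞ f (stDom a m))
    (h0 : AxisZero a m f) : AxisZero a m (fun z => fderiv ℝ f z dirR) := by
  have key : ∀ t r θ, rPlus a m < r → (∀ r, rPlus a m < r → f (t, (r, θ)) = 0) →
      fderiv ℝ f (t, (r, θ)) dirR = 0 := by
    intro t r θ hr hz
    have h1 := hasDerivAt_dirR (z := (t, (r, θ)))
      (differentiableAt_of_stDom hf ⟨mem_univ _, hr, mem_univ _⟩)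
    refine h1.unique ((hasDerivAt_const r (0 : ℝ)).congr_of_eventuallyEq ?_)
    filter_upwards [Ioi_mem_nhds hr] with r' hr' using hz r' hr'
  exact fun t r hr => ⟨key t r 0 hr fun r hr => (h0 t r hr).1,
    key t r Real.pi hr fun r hr => (h0 t r hr).2⟩

theorem axisZero_fderiv_dirT {f : ℝ × (ℝ × ℝ) → ℝ} (hf : ContDiffOn ℝ ∞ f (stDom a m))
    (h0 : AxisZero a m f) : AxisZero a m (fun z => fderiv ℝ f z dirT) := by
  have key : ∀ t r θ, rPlus a m < r → (∀ t, f (t, (r, θ)) = 0) →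
      fderiv ℝ f (t, (r, θ)) dirT = 0 := by
    intro t r θ hr hz
    have h1 := hasDerivAt_dirT (z := (t, (r, θ)))
      (differentiableAt_of_stDom hf ⟨mem_univ _, hr, mem_univ _⟩)
    exact h1.unique ((hasDerivAt_const t (0 : ℝ)).congr_of_eventuallyEq
      (Filter.Eventually.of_forall hz))
  exact fun t r hr => ⟨key t r 0 hr fun t => (h0 t r hr).1,
    key t r Real.pi hr fun t => (h0 t r hr).2⟩

/-- `A_φ / sin θ`. -/
def potW (A : (Fin 4 → ℝ) → Fin 4 → ℝ) (q : Fin 4 → ℝ) : ℝ :=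
  A (blMap q) 2 * q 1 * Real.cos (q 3) - A (blMap q) 1 * q 1 * Real.sin (q 3)

theorem blPot_three_eq (A : (Fin 4 → ℝ) → Fin 4 → ℝ) (q : Fin 4 → ℝ) :
    blPot A q 3 = Real.sin (q 2) * potW A q := by
  rw [blPot_three, potW]; ring

theorem sl_blPot_three (A : (Fin 4 → ℝ) → Fin 4 → ℝ) :
    (sl fun q => blPot A q 3) = fun z => Real.sin z.2.2 * sl (potW A) z := by
  funext z
  simp only [sl, blPot_three_eq]
  rfl

theorem smooth_sl_potW (h : |a| < m) (hA : IsAxisymMaxwell a m A) :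
    ContDiffOn ℝ ∞ (sl (potW A)) (stDom a m) := by
  have key : ∀ ν, ContDiffOn ℝ ∞ (fun q => A (blMap q) ν) (blDom a m) := fun ν =>
    (contDiffOn_pi.1 hA.smooth ν).comp contDiff_blMap.contDiffOn
      fun q hq => blMap_mem_exterior h hq
  refine contDiffOn_sl (((key 2).mul ?_).mul ?_ |>.sub (((key 1).mul ?_).mul ?_)) <;>
  exact ContDiff.contDiffOn (by fun_prop)

/-- A_φ is even under reflection in the axis and sin θ is odd, so the quotient is odd. This gives
the double zero of λ = w sin θ. -/
theorem axisZero_potW (h : |a| < m) (hA : IsAxisymMaxwell a m A) :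
    AxisZero a m (sl (potW A)) := by
  refine axisZero_of_odd (smooth_sl_potW h hA) fun t r θ θ' hr hθ hs hc => ?_
  have := sl_blPot_refl h hA 3 (t := t) hr hθ hs hc
  rw [sl_blPot_three] at this
  simp only [reflSign, hs] at this
  have hne : Real.sin θ ≠ 0 := (Real.sin_pos_of_pos_of_lt_pi hθ.1 hθ.2).ne'
  have h3 : (3 : Fin 4) ≠ 2 := by decide
  rw [if_neg h3, one_mul] at this
  refine mul_left_cancel₀ hne ?_
  linarith

/-- A_θ is odd, so it vanishes on the axis together with ∂_rA_θ; A_r is even, so ∂_θA_r is odd and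
vanishes too. -/
theorem axisZero_faraday_one_two (h : |a| < m) (hA : IsAxisymMaxwell a m A) :
    AxisZero a m (sl (faraday A 1 2)) := by
  have hd := fun μ z (hz : z ∈ stDom a m) => differentiableAt_of_contDiffOn (isOpen_blDom a m)
    (contDiffOn_blPot h hA.smooth μ) (lift_mem_blDom hz)
  have e : ∀ z ∈ stDom a m, sl (faraday A 1 2) z =
      fderiv ℝ (sl fun q => blPot A q 2) z dirR - fderiv ℝ (sl fun q => blPot A q 1) z dirTh :=
    fun z hz => by
      rw [fderiv_sl_dirR (hd 2 z hz), fderiv_sl_dirTh (hd 1 z hz)]; rfl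
  have z2 : AxisZero a m (sl fun q => blPot A q 2) :=
    axisZero_of_odd (smooth_sl_blPot h hA 2) fun t r θ θ' hr hθ hs hc => by
      have := sl_blPot_refl h hA 2 (t := t) hr hθ hs hc
      rw [this]; simp [reflSign]
  have z1 : AxisZero a m (fun z => fderiv ℝ (sl fun q => blPot A q 1) z dirTh) := by
    have hS := smooth_sl_blPot h hA 1
    have hD : ∀ t r, rPlus a m < r → ∀ θ, HasDerivAt
        (fun θ => sl (fun q => blPot A q 1) (t, (r, θ)))
        (fderiv ℝ (sl fun q => blPot A q 1) (t, (r, θ)) dirTh) θ := fun t r hr θ =>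
      hasDerivAt_dirTh (z := (t, (r, θ)))
        (differentiableAt_of_stDom hS ⟨mem_univ _, hr, mem_univ _⟩)
    have key : ∀ t r c, rPlus a m < r → ∀ F : Filter ℝ, F.NeBot → F ≤ nhds c →
        (∀ᶠ θ in F, ∀ᶠ x in nhds θ, x ∈ Ioo 0 Real.pi) →
        (∀ x, Real.sin (2 * c - x) = -Real.sin x) → (∀ x, Real.cos (2 * c - x) = Real.cos x) →
        fderiv ℝ (sl fun q => blPot A q 1) (t, (r, c)) dirTh = 0 := by
      intro t r c hr F _ hF hev hs hc
      refine eq_zero_of_odd (f := fun θ => fderiv ℝ (sl fun q => blPot A q 1) (t, (r, θ)) dirTh)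
        hF (continuousAt_theta (smooth_fderiv_stDom hS dirTh) hr c) ?_
      filter_upwards [hev] with θ hθ
      have h1 : HasDerivAt (fun x => sl (fun q => blPot A q 1) (t, (r, 2 * c - x)))
          (fderiv ℝ (sl fun q => blPot A q 1) (t, (r, 2 * c - θ)) dirTh * -1) θ :=
        (hD t r hr (2 * c - θ)).comp θ ((hasDerivAt_id' θ).const_sub (2 * c))
      have h2 := (hD t r hr θ).congr_of_eventuallyEq
        (f₁ := fun x => sl (fun q => blPot A q 1) (t, (r, 2 * c - x))) (by
          filter_upwards [hθ] with x hx
          rw [sl_blPot_refl h hA 1 hr hx (hs x) (hc x)]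
          simp [reflSign])
      have := h1.unique h2
      linarith
    intro t r hr
    constructor
    · refine key t r 0 hr (nhdsWithin 0 (Ioi 0)) inferInstance nhdsWithin_le_nhds ?_
        (by simp) (by simp)
      filter_upwards [Ioo_mem_nhdsGT Real.pi_pos] with θ hθ using Ioo_mem_nhds hθ.1 hθ.2
    · refine key t r Real.pi hr (nhdsWithin Real.pi (Iio Real.pi)) inferInstance
        nhdsWithin_le_nhds ?_ Real.sin_two_pi_sub Real.cos_two_pi_sub
      filter_upwards [Ioo_mem_nhdsLT Real.pi_pos] with θ hθ using Ioo_mem_nhds hθ.1 hθ.2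
  have z2' := axisZero_fderiv_dirR (smooth_sl_blPot h hA 2) z2
  intro t r hr
  rw [e (t, (r, 0)) ⟨mem_univ _, hr, mem_univ _⟩, e (t, (r, Real.pi)) ⟨mem_univ _, hr, mem_univ _⟩]
  have a1 := z2' t r hr
  have a2 := z1 t r hr
  simp only at a1 a2
  rw [a1.1, a1.2, a2.1, a2.2]
  simp

theorem pd_three_blPot (hA : IsAxisymMaxwell a m A) {z : ℝ × (ℝ × ℝ)} (hz : z ∈ stInt a m)
    (μ : Fin 4) : pd 3 (fun q => blPot A q μ) (lift z.1 z.2) = 0 :=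
  hA.axisym _ (lift_mem_blChart hz.2) μ

theorem faraday_three (h : |a| < m) (hA : IsAxisymMaxwell a m A) {z : ℝ × (ℝ × ℝ)}
    (hz : z ∈ stInt a m) :
    faraday A 0 3 (lift z.1 z.2) = fderiv ℝ (sl fun q => blPot A q 3) z dirT ∧
    faraday A 1 3 (lift z.1 z.2) = fderiv ℝ (sl fun q => blPot A q 3) z dirR ∧
    faraday A 2 3 (lift z.1 z.2) = fderiv ℝ (sl fun q => blPot A q 3) z dirTh := by
  have hd := differentiableAt_of_contDiffOn (isOpen_blDom a m)
    (contDiffOn_blPot h hA.smooth 3) (lift_mem_blDom (stInt_subset_stDom a m hz))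
  rw [fderiv_sl_dirT hd, fderiv_sl_dirR hd, fderiv_sl_dirTh hd]
  simp [faraday, pd_three_blPot hA hz]

theorem sl_faradayUp_zero_one (h : |a| < m) (hA : IsAxisymMaxwell a m A) :
    EqOn (sl (faradayUp a m A 0 1)) (elR a m (sl (faraday A 0 1)) (sl fun q => blPot A q 3))
      (stInt a m) := fun z hz => by
  have e := faradayUp_zero_one (A := A) h (lift_mem_blChart (t := z.1) hz.2)
  rw [faraday_antisymm A 3 1, (faraday_three h hA hz).2.1] at e
  refine e.trans ?_
  simp only [elR, sl, lift, Matrix.cons_val]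
  ring

theorem sl_faradayUp_zero_two (h : |a| < m) (hA : IsAxisymMaxwell a m A) :
    EqOn (sl (faradayUp a m A 0 2)) (elTh a m (sl (faraday A 0 2)) (sl fun q => blPot A q 3))
      (stInt a m) := fun z hz => by
  have e := faradayUp_zero_two (A := A) h (lift_mem_blChart (t := z.1) hz.2)
  rw [faraday_antisymm A 3 2, (faraday_three h hA hz).2.2] at e
  refine e.trans ?_
  simp only [elTh, sl, lift, Matrix.cons_val]
  ring

theorem sl_faradayUp_one_two (h : |a| < m) :
    EqOn (sl (faradayUp a m A 1 2)) (fun z => coK a m z.2 * sl (faraday A 1 2) z)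
      (stInt a m) := fun z hz =>
  faradayUp_one_two (A := A) h (lift_mem_blChart (t := z.1) hz.2)

theorem sl_faradayUp_one_three (h : |a| < m) (hA : IsAxisymMaxwell a m A) :
    EqOn (sl (faradayUp a m A 1 3)) (upRPhi a m (sl (faraday A 0 1)) (sl fun q => blPot A q 3))
      (stInt a m) := fun z hz => by
  have e := faradayUp_one_three (A := A) h (lift_mem_blChart (t := z.1) hz.2)
  rw [(faraday_three h hA hz).2.1] at e
  exact e

theorem sl_faradayUp_two_three (h : |a| < m) (hA : IsAxisymMaxwell a m A) :
    EqOn (sl (faradayUp a m A 2 3)) (upThPhi a m (sl (faraday A 0 2)) (sl fun q => blPot A q 3))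
      (stInt a m) := fun z hz => by
  have e := faradayUp_two_three (A := A) h (lift_mem_blChart (t := z.1) hz.2)
  rw [(faraday_three h hA hz).2.2] at e
  exact e

/-- The factor sin θ in λ = w sin θ cancels the 1/sin θ of the raised component, so v has a form
that is smooth across the axis. -/
theorem sl_faradayUp_zero_three (h : |a| < m) (hA : IsAxisymMaxwell a m A) :
    EqOn (fun z => -sl (faradayUp a m A 0 3) z) (momV a m (sl (potW A))) (stInt a m) :=
  fun z hz => by
  have e := faradayUp_zero_three (A := A) h (lift_mem_blChart (t := z.1) hz.2)
  have hw := differentiableAt_of_stDom (smooth_sl_potW h hA) (stInt_subset_stDom a m hz)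
  have hs := sin_pos_of_mem hz.2
  have hD := (delta_pos h hz.2.1).2
  have e2 : fderiv ℝ (sl fun q => blPot A q 3) z dirT =
      Real.sin z.2.2 * fderiv ℝ (sl (potW A)) z dirT := by
    have h1 := (hasDerivAt_dirT hw).const_mul (Real.sin z.2.2)
    have hB := differentiableAt_of_stDom (smooth_sl_blPot h hA 3) (stInt_subset_stDom a m hz)
    have h2 := hasDerivAt_dirT hB
    rw [sl_blPot_three] at h2 ⊢
    exact h2.unique h1
  rw [(faraday_three h hA hz).1, e2] at e
  change -faradayUp a m A 0 3 (lift z.1 z.2) = _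
  rw [e]
  simp only [momV, lift, Matrix.cons_val]
  field_simp

theorem fderiv_congr_stInt {f g : ℝ × (ℝ × ℝ) → ℝ} (hfg : EqOn f g (stInt a m))
    {z : ℝ × (ℝ × ℝ)} (hz : z ∈ stInt a m) : fderiv ℝ f z = fderiv ℝ g z :=
  (hfg.eventuallyEq_of_mem ((isOpen_stInt a m).mem_nhds hz)).fderiv_eq

/-- Axial symmetry removes the φ-derivatives. The t-component of Maxwell's equations is Gauss's law,
the r-, θ- and φ-components are Ampère's, and antisymmetry removes one term in each. -/
theorem reducedMaxwell (h : |a| < m) (hA : IsAxisymMaxwell a m A) :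
    ReducedMaxwell a m (sl fun q => blPot A q 3) (sl (potW A)) (sl (faraday A 0 1))
      (sl (faraday A 0 2)) (sl (faraday A 1 2)) := by
  have hF := fun μ ν => contDiffOn_faraday h hA.smooth μ ν
  have hU : ∀ μ ν z, z ∈ stInt a m → DifferentiableAt ℝ (faradayUp a m A μ ν) (lift z.1 z.2) :=
    fun μ ν z hz => differentiableAt_of_contDiffOn (isOpen_blChart a m)
      (contDiffOn_faradayUp h hA.smooth μ ν) (lift_mem_blChart hz.2)
  have hM : ∀ ν z, z ∈ stInt a m → fderiv ℝ (sl (faradayUp a m A 0 ν)) z dirT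
      + fderiv ℝ (sl (faradayUp a m A 1 ν)) z dirR
      + fderiv ℝ (sl (faradayUp a m A 2 ν)) z dirTh = 0 := fun ν z hz => by
    have := hA.maxwell _ (lift_mem_blChart (t := z.1) hz.2) ν
    rw [Fin.sum_univ_four, pd_three_faradayUp h hA 3 ν (lift_mem_blChart hz.2), add_zero] at this
    rw [fderiv_sl_dirT (hU 0 ν z hz), fderiv_sl_dirR (hU 1 ν z hz), fderiv_sl_dirTh (hU 2 ν z hz)]
    exact this
  have hneg : ∀ μ ν z e, fderiv ℝ (sl (faradayUp a m A μ ν)) z e =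
      -fderiv ℝ (sl (faradayUp a m A ν μ)) z e := fun μ ν z e => by
    have : sl (faradayUp a m A μ ν) = fun z => -sl (faradayUp a m A ν μ) z := by
      funext z; simp only [sl]; rw [faradayUp_antisymm]
    rw [this, fderiv_fun_neg]; rfl
  have hself : ∀ μ z e, fderiv ℝ (sl (faradayUp a m A μ μ)) z e = 0 := fun μ z e => by
    have := hneg μ μ z e; linarith
  refine ⟨smooth_sl_potW h hA, contDiffOn_sl (hF 0 1), contDiffOn_sl (hF 0 2),
    contDiffOn_sl (hF 1 2), sl_blPot_three A, axisZero_potW h hA, axisZero_faraday_one_two h hA,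
    fun z hz => ?_, fun z hz => ?_, fun z hz => ?_, fun z hz => ?_, fun z hz => ?_⟩
  · have := hM 0 z hz
    rw [hself, hneg 1 0, hneg 2 0, fderiv_congr_stInt (sl_faradayUp_zero_one h hA) hz,
      fderiv_congr_stInt (sl_faradayUp_zero_two h hA) hz] at this
    linarith
  · have := hM 1 z hz
    rw [hself, hneg 2 1, fderiv_congr_stInt (sl_faradayUp_zero_one h hA) hz,
      fderiv_congr_stInt (sl_faradayUp_one_two h) hz] at this
    linarith
  · have := hM 2 z hz
    rw [hself, fderiv_congr_stInt (sl_faradayUp_zero_two h hA) hz,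
      fderiv_congr_stInt (sl_faradayUp_one_two h) hz] at this
    linarith
  · have := hM 3 z hz
    rw [fderiv_congr_stInt (sl_faradayUp_one_three h hA) hz,
      fderiv_congr_stInt (sl_faradayUp_two_three h hA) hz] at this
    rw [← fderiv_congr_stInt (sl_faradayUp_zero_three h hA) hz, fderiv_fun_neg]
    change -fderiv ℝ (sl (faradayUp a m A 0 3)) z dirT = _
    linarith
  -- Faraday's law is no field equation here: it follows from F = dA by commuting second
  -- derivatives.
  · have hq := lift_mem_blDom (stInt_subset_stDom a m hz)
    have hO := isOpen_blDom a m
    have hP := fun μ => contDiffOn_blPot h hA.smooth μ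
    have hd := fun μ ν => differentiableAt_of_contDiffOn hO (contDiffOn_pd hO (hP ν) μ) hq
    have hdF := fun μ ν => differentiableAt_of_contDiffOn hO (hF μ ν) hq
    have e : ∀ κ μ ν, pd κ (faraday A μ ν) (lift z.1 z.2) =
        pd κ (pd μ fun q => blPot A q ν) (lift z.1 z.2)
        - pd κ (pd ν fun q => blPot A q μ) (lift z.1 z.2) := fun κ μ ν => by
      change fderiv ℝ (fun q => pd μ (fun q => blPot A q ν) q - pd ν (fun q => blPot A q μ) q) _ _
        = _
      rw [fderiv_fun_sub (hd μ ν) (hd ν μ)]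
      rfl
    rw [fderiv_sl_dirT (hdF 1 2), fderiv_sl_dirR (hdF 0 2), fderiv_sl_dirTh (hdF 0 1), e, e, e,
      pd_comm hO (hP 2) hq 0 1, pd_comm hO (hP 1) hq 0 2, pd_comm hO (hP 0) hq 1 2]
    ring

end Axisymmetric


/-! ### Potentials on the orbit space -/

/-- The one-form `p dt + q dr + s dθ`. -/
def oneForm (p q s : ℝ × (ℝ × ℝ) → ℝ) (z : ℝ × (ℝ × ℝ)) : ℝ × (ℝ × ℝ) →L[ℝ] ℝ :=
  p z • ContinuousLinearMap.fst ℝ ℝ (ℝ × ℝ)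
    + (q z • (ContinuousLinearMap.fst ℝ ℝ ℝ).comp (ContinuousLinearMap.snd ℝ ℝ (ℝ × ℝ))
    + s z • (ContinuousLinearMap.snd ℝ ℝ ℝ).comp (ContinuousLinearMap.snd ℝ ℝ (ℝ × ℝ)))

theorem oneForm_apply (p q s : ℝ × (ℝ × ℝ) → ℝ) (z x : ℝ × (ℝ × ℝ)) :
    oneForm p q s z x = p z * x.1 + (q z * x.2.1 + s z * x.2.2) := rfl

section Potential
variable {a m : ℝ} {p q s : ℝ × (ℝ × ℝ) → ℝ}

theorem contDiffOn_oneForm {U : Set (ℝ × (ℝ × ℝ))} (hp : ContDiffOn ℝ ∞ p U)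
    (hq : ContDiffOn ℝ ∞ q U) (hs : ContDiffOn ℝ ∞ s U) : ContDiffOn ℝ ∞ (oneForm p q s) U :=
  (hp.smul contDiffOn_const).add ((hq.smul contDiffOn_const).add (hs.smul contDiffOn_const))

theorem clm_eq_sum (L : ℝ × (ℝ × ℝ) →L[ℝ] ℝ) (x : ℝ × (ℝ × ℝ)) :
    L x = x.1 * L dirT + (x.2.1 * L dirR + x.2.2 * L dirTh) := by
  have e : x = x.1 • dirT + (x.2.1 • dirR + x.2.2 • dirTh) := by
    ext <;> simp [dirT, dirR, dirTh]
  conv_lhs => rw [e]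
  simp

theorem stOrb_subset_closure (a m : ℝ) : stOrb a m ⊆ closure (stInt a m) := by
  rw [stInt, stOrb, orbitInt, orbit, closure_prod_eq, closure_prod_eq, closure_univ,
    closure_Ioo Real.pi_pos.ne]
  exact prod_mono subset_rfl (prod_mono subset_closure subset_rfl)

theorem convex_stOrb (a m : ℝ) : Convex ℝ (stOrb a m) :=
  convex_univ.prod ((convex_Ioi _).prod (convex_Icc _ _))

/-- Poincaré lemma on the orbit space, the axis included. -/
theorem exists_potential (hp : ContDiffOn ℝ ∞ p (stOrb a m)) (hq : ContDiffOn ℝ ∞ q (stOrb a m))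
    (hs : ContDiffOn ℝ ∞ s (stOrb a m))
    (h1 : ∀ z ∈ stInt a m, fderiv ℝ p z dirR = fderiv ℝ q z dirT)
    (h2 : ∀ z ∈ stInt a m, fderiv ℝ p z dirTh = fderiv ℝ s z dirT)
    (h3 : ∀ z ∈ stInt a m, fderiv ℝ q z dirTh = fderiv ℝ s z dirR) :
    ∃ f, ContDiffOn ℝ ∞ f (stOrb a m) ∧
      ∀ z ∈ stOrb a m, HasFDerivWithinAt f (oneForm p q s z) (stOrb a m) z := by
  have hω := contDiffOn_oneForm hp hq hs
  have hi := fun {f : ℝ × (ℝ × ℝ) → ℝ} (hf : ContDiffOn ℝ ∞ f (stOrb a m)) {z} (hz : z ∈ stInt a m)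
    => differentiableAt_of_stInt (hf.mono (stInt_subset_stOrb a m)) hz
  -- Closedness is known off the axis; symmetry of the derivative passes to the axis by continuity.
  have hsymm : ∀ x y, EqOn (fun z => fderivWithin ℝ (oneForm p q s) (stOrb a m) z x y)
      (fun z => fderivWithin ℝ (oneForm p q s) (stOrb a m) z y x) (stOrb a m) := by
    intro x y
    have hc : ∀ x y, ContinuousOn (fun z => fderivWithin ℝ (oneForm p q s) (stOrb a m) z x y)
        (stOrb a m) := fun x y =>
      ((hω.continuousOn_fderivWithin (uniqueDiffOn_stOrb a m) (by simp)).clm_apply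
        continuousOn_const).clm_apply continuousOn_const
    refine EqOn.of_subset_closure (fun z hz => ?_) (hc x y) (hc y x) (stInt_subset_stOrb a m)
      (stOrb_subset_closure a m)
    have e : ∀ x y, fderivWithin ℝ (oneForm p q s) (stOrb a m) z x y =
        fderiv ℝ p z x * y.1 + (fderiv ℝ q z x * y.2.1 + fderiv ℝ s z x * y.2.2) := by
      intro x y
      have hF : HasFDerivAt (oneForm p q s) _ z :=
        ((hi hp hz).hasFDerivAt.smul_const (ContinuousLinearMap.fst ℝ ℝ (ℝ × ℝ))).add
          (((hi hq hz).hasFDerivAt.smul_const ((ContinuousLinearMap.fst ℝ ℝ ℝ).comp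
            (ContinuousLinearMap.snd ℝ ℝ (ℝ × ℝ)))).add
          ((hi hs hz).hasFDerivAt.smul_const ((ContinuousLinearMap.snd ℝ ℝ ℝ).comp
            (ContinuousLinearMap.snd ℝ ℝ (ℝ × ℝ)))))
      rw [fderivWithin_of_mem_nhds (stOrb_mem_nhds hz), hF.fderiv]
      simp
    simp only [e]
    rw [clm_eq_sum (fderiv ℝ p z) x, clm_eq_sum (fderiv ℝ q z) x, clm_eq_sum (fderiv ℝ s z) x,
      clm_eq_sum (fderiv ℝ p z) y, clm_eq_sum (fderiv ℝ q z) y, clm_eq_sum (fderiv ℝ s z) y,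
      h1 z hz, h2 z hz, h3 z hz]
    ring
  -- In the coordinates (t, r, θ) the region is convex, so a closed form is exact.
  obtain ⟨f, hf⟩ := (convex_stOrb a m).exists_forall_hasFDerivWithinAt_of_fderivWithin_symmetric
    (hω.differentiableOn (by simp)) fun z hz x _ y _ => hsymm x y hz
  refine ⟨f, ?_, hf⟩
  -- The derivative of f is the given smooth form, hence f is smooth up to the axis.
  rw [contDiffOn_infty_iff_fderivWithin (uniqueDiffOn_stOrb a m)]
  exact ⟨fun z hz => (hf z hz).differentiableWithinAt,
    hω.congr fun z hz => (hf z hz).fderivWithin (uniqueDiffOn_stOrb a m z hz)⟩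

/-- A function with no `t`- and `r`-derivative at `θ` depends on `θ` only. -/
theorem eq_of_oneForm_axis {f : ℝ × (ℝ × ℝ) → ℝ}
    (hf : ∀ z ∈ stOrb a m, HasFDerivWithinAt f (oneForm p q s z) (stOrb a m) z) {θ : ℝ}
    (hθ : θ ∈ Icc 0 Real.pi)
    (h0 : ∀ t r, rPlus a m < r → p (t, (r, θ)) = 0 ∧ q (t, (r, θ)) = 0) {t r t' r' : ℝ}
    (hr : rPlus a m < r) (hr' : rPlus a m < r') : f (t, (r, θ)) = f (t', (r', θ)) := by
  have hconv : Convex ℝ ((univ : Set ℝ) ×ˢ Ioi (rPlus a m)) := convex_univ.prod (convex_Ioi _)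
  have hd : ∀ x ∈ (univ : Set ℝ) ×ˢ Ioi (rPlus a m),
      HasFDerivWithinAt (fun x : ℝ × ℝ => f (x.1, (x.2, θ))) (0 : ℝ × ℝ →L[ℝ] ℝ)
        (univ ×ˢ Ioi (rPlus a m)) x := by
    intro x hx
    have hg : HasFDerivWithinAt (fun x : ℝ × ℝ => (x.1, (x.2, θ)))
        ((ContinuousLinearMap.fst ℝ ℝ ℝ).prod ((ContinuousLinearMap.snd ℝ ℝ ℝ).prod 0))
        (univ ×ˢ Ioi (rPlus a m)) x :=
      (hasFDerivAt_fst.prodMk (hasFDerivAt_snd.prodMk (hasFDerivAt_const _ _))).hasFDerivWithinAt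
    have hm : MapsTo (fun x : ℝ × ℝ => (x.1, (x.2, θ))) (univ ×ˢ Ioi (rPlus a m)) (stOrb a m) :=
      fun y hy => ⟨mem_univ _, hy.2, hθ⟩
    have := HasFDerivWithinAt.comp x (hf (x.1, (x.2, θ)) ⟨mem_univ _, hx.2, hθ⟩) hg hm
    refine this.congr_fderiv ?_
    ext <;> simp [oneForm_apply, h0 x.1 x.2 hx.2]
  exact hconv.is_const_of_fderivWithin_eq_zero (fun x hx => (hd x hx).differentiableWithinAt)
    (fun x hx => (hd x hx).fderivWithin ((uniqueDiffOn_univ.prod isOpen_Ioi.uniqueDiffOn) x hx))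
    (x := (t, r)) (y := (t', r')) ⟨mem_univ _, hr⟩ ⟨mem_univ _, hr'⟩

theorem hasDerivWithinAt_theta {f : ℝ × (ℝ × ℝ) → ℝ}
    (hf : ∀ z ∈ stOrb a m, HasFDerivWithinAt f (oneForm p q s z) (stOrb a m) z) {t r θ : ℝ}
    (hr : rPlus a m < r) (hθ : θ ∈ Icc 0 Real.pi) :
    HasDerivWithinAt (fun θ => f (t, (r, θ))) (s (t, (r, θ))) (Icc 0 Real.pi) θ := by
  have hg : HasDerivWithinAt (fun θ : ℝ => (t, (r, θ))) dirTh (Icc 0 Real.pi) θ :=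
    ((hasDerivAt_const _ _).prodMk ((hasDerivAt_const _ _).prodMk
      (hasDerivAt_id' _))).hasDerivWithinAt
  have := HasFDerivWithinAt.comp_hasDerivWithinAt (f := fun θ : ℝ => (t, (r, θ))) θ
    (hf (t, (r, θ)) ⟨mem_univ _, hr, hθ⟩) hg fun y hy => ⟨mem_univ _, hr, hy⟩
  exact this.congr_deriv (by simp [oneForm_apply, dirTh])

theorem eq_left_of_hasDerivWithinAt_zero {g : ℝ → ℝ}
    (hg : ∀ θ ∈ Icc 0 Real.pi, HasDerivWithinAt g 0 (Icc 0 Real.pi) θ) {θ : ℝ}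
    (hθ : θ ∈ Icc 0 Real.pi) : g θ = g 0 :=
  constant_of_derivWithin_zero (fun x hx => (hg x hx).differentiableWithinAt)
    (fun x hx => (hg x (Ico_subset_Icc_self hx)).derivWithin
      (uniqueDiffOn_Icc Real.pi_pos x (Ico_subset_Icc_self hx))) θ hθ

/-- A closed one-form whose restriction to the axis vanishes, and which is supported in `r ≤ R` at
`t = 0`, has a potential that vanishes on the axis. -/
theorem exists_potential_axisZero (hp : ContDiffOn ℝ ∞ p (stOrb a m))
    (hq : ContDiffOn ℝ ∞ q (stOrb a m)) (hs : ContDiffOn ℝ ∞ s (stOrb a m))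
    (h1 : ∀ z ∈ stInt a m, fderiv ℝ p z dirR = fderiv ℝ q z dirT)
    (h2 : ∀ z ∈ stInt a m, fderiv ℝ p z dirTh = fderiv ℝ s z dirT)
    (h3 : ∀ z ∈ stInt a m, fderiv ℝ q z dirTh = fderiv ℝ s z dirR)
    (p0 : AxisZero a m p) (q0 : AxisZero a m q) {R : ℝ}
    (hR : ∀ r, rPlus a m < r → R < r → ∀ θ ∈ Icc 0 Real.pi, s (0, (r, θ)) = 0) :
    ∃ f, ContDiffOn ℝ ∞ f (stOrb a m) ∧ AxisZero a m f ∧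
      ∀ z ∈ stOrb a m, HasFDerivWithinAt f (oneForm p q s z) (stOrb a m) z := by
  obtain ⟨f, hf, hd⟩ := exists_potential hp hq hs h1 h2 h3
  -- Along the arc t = 0, r = r₀ the θ-component vanishes, so f takes the same value at both poles.
  -- This ties together the two axis constants; for the electric field it says that the total charge
  -- is zero.
  set r₀ := max R (rPlus a m) + 1
  have hr₀ : rPlus a m < r₀ := by simp only [r₀]; linarith [le_max_right R (rPlus a m)]
  have hR₀ : R < r₀ := by simp only [r₀]; linarith [le_max_left R (rPlus a m)]
  have hpi := Real.pi_pos.le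
  have e0 : ∀ θ ∈ Icc 0 Real.pi, f (0, (r₀, θ)) = f (0, (r₀, 0)) := fun θ hθ =>
    eq_left_of_hasDerivWithinAt_zero (g := fun θ => f (0, (r₀, θ)))
      (fun θ hθ => by simpa [hR r₀ hr₀ hR₀ θ hθ] using hasDerivWithinAt_theta hd (t := 0) hr₀ hθ) hθ
  refine ⟨fun z => f z - f (0, (r₀, 0)), hf.sub contDiffOn_const, fun t r hr => ⟨?_, ?_⟩,
    fun z hz => (hd z hz).sub_const _⟩
  · rw [sub_eq_zero]
    exact eq_of_oneForm_axis hd (left_mem_Icc.2 hpi) (fun t r hr => ⟨(p0 t r hr).1, (q0 t r hr).1⟩)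
      hr hr₀
  · rw [sub_eq_zero, ← e0 _ (right_mem_Icc.2 hpi)]
    exact eq_of_oneForm_axis hd (right_mem_Icc.2 hpi)
      (fun t r hr => ⟨(p0 t r hr).2, (q0 t r hr).2⟩) hr hr₀

end Potential

/-! ### The electric twist potential -/

section Twist
variable {a m : ℝ} {lam w f01 f02 u : ℝ × (ℝ × ℝ) → ℝ}

theorem ReducedMaxwell.smooth_lam (hM : ReducedMaxwell a m lam w f01 f02 u) :
    ContDiffOn ℝ ∞ lam (stDom a m) := by
  rw [hM.lam_eq]
  exact (ContDiff.contDiffOn (by fun_prop)).mul hM.smooth_w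

theorem contDiffOn_snd_stDom {f : ℝ × ℝ → ℝ} (hf : ContDiff ℝ ∞ f) :
    ContDiffOn ℝ ∞ (fun z : ℝ × (ℝ × ℝ) => f z.2) (stDom a m) :=
  (hf.comp contDiff_snd).contDiffOn

theorem ReducedMaxwell.smooth_elR (h : |a| < m) (hM : ReducedMaxwell a m lam w f01 f02 u) :
    ContDiffOn ℝ ∞ (elR a m f01 lam) (stDom a m) := by
  refine ((ContDiffOn.div (ContDiff.contDiffOn (by fun_prop))
    (contDiffOn_snd_stDom (contDiff_sigma a)) fun z hz => (sigma_pos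
      (delta_pos h hz.2.1).1).ne').neg).mul
    (((contDiffOn_snd_stDom (contDiff_kPi a m)).mul hM.smooth_01).sub
      (ContDiffOn.mul (ContDiff.contDiffOn (by fun_prop))
        (smooth_fderiv_stDom hM.smooth_lam dirR)))

theorem ReducedMaxwell.smooth_elTh (h : |a| < m) (hM : ReducedMaxwell a m lam w f01 f02 u) :
    ContDiffOn ℝ ∞ (elTh a m f02 lam) (stDom a m) := by
  refine ((ContDiffOn.div (ContDiff.contDiffOn (by fun_prop))
    (contDiffOn_snd_stDom ((contDiff_sigma a).mul (contDiff_delta a m))) fun z hz =>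
      (mul_pos (sigma_pos (delta_pos h hz.2.1).1) (delta_pos h hz.2.1).2).ne').neg).mul
    (((contDiffOn_snd_stDom (contDiff_kPi a m)).mul hM.smooth_02).sub
      (ContDiffOn.mul (ContDiff.contDiffOn (by fun_prop))
        (smooth_fderiv_stDom hM.smooth_lam dirTh)))

theorem smooth_coK_stDom (h : |a| < m) :
    ContDiffOn ℝ ∞ (fun z : ℝ × (ℝ × ℝ) => coK a m z.2) (stDom a m) :=
  (contDiffOn_snd_stDom ((contDiff_delta a m).mul (Real.contDiff_sin.comp contDiff_snd))).div
    (contDiffOn_snd_stDom (contDiff_sigma a)) fun _ hz => (sigma_pos (delta_pos h hz.2.1).1).ne'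

theorem ReducedMaxwell.smooth_momV (h : |a| < m) (hM : ReducedMaxwell a m lam w f01 f02 u) :
    ContDiffOn ℝ ∞ (momV a m w) (stDom a m) :=
  ((contDiffOn_snd_stDom (contDiff_sigma a)).div (contDiffOn_snd_stDom (contDiff_delta a m))
    fun _ hz => (delta_pos h hz.2.1).2.ne').mul (smooth_fderiv_stDom hM.smooth_w dirT)

theorem ReducedMaxwell.axisZero_momV (hM : ReducedMaxwell a m lam w f01 f02 u) :
    AxisZero a m (momV a m w) := fun t r hr => by
  have := axisZero_fderiv_dirT hM.smooth_w hM.w_axis t r hr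
  exact ⟨mul_eq_zero_of_right _ this.1, mul_eq_zero_of_right _ this.2⟩

/-- `η` is a potential of the electric field. -/
structure IsPotential (a m : ℝ) (lam f01 f02 u eta : ℝ × (ℝ × ℝ) → ℝ) : Prop where
  smooth : ContDiffOn ℝ ∞ eta (stOrb a m)
  axis : AxisZero a m eta
  deriv : ∀ z ∈ stOrb a m, HasFDerivWithinAt eta (oneForm (fun z => coK a m z.2 * u z)
    (fun z => -elTh a m f02 lam z) (elR a m f01 lam) z) (stOrb a m) z

/-- Gauss's law and two components of Ampère's law are the closedness conditions of the one-form,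
whose t- and r-components carry a factor sin θ and so vanish on the axis. The t-component is chosen
so that Hamilton's equation for η holds by construction. -/
theorem ReducedMaxwell.exists_isPotential (h : |a| < m)
    (hM : ReducedMaxwell a m lam w f01 f02 u) {R : ℝ}
    (hR : ∀ r, rPlus a m < r → R < r → ∀ θ ∈ Ioo 0 Real.pi, elR a m f01 lam (0, (r, θ)) = 0) :
    ∃ eta, IsPotential a m lam f01 f02 u eta := by
  have hs := stOrb_subset_stDom a m
  have hd : ∀ {f : ℝ × (ℝ × ℝ) → ℝ}, ContDiffOn ℝ ∞ f (stDom a m) → ∀ {z}, z ∈ stInt a m →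
      DifferentiableAt ℝ f z := fun hf _ hz =>
    differentiableAt_of_stDom hf (stInt_subset_stDom a m hz)
  have hn : ∀ z e, fderiv ℝ (fun z => -elTh a m f02 lam z) z e =
      -fderiv ℝ (elTh a m f02 lam) z e := fun z e => by rw [fderiv_fun_neg]; rfl
  obtain ⟨f, h1, h2, h3⟩ := exists_potential_axisZero (a := a) (m := m) (R := R)
    (((smooth_coK_stDom h).mul hM.smooth_u).mono hs) ((hM.smooth_elTh h).neg.mono hs)
    ((hM.smooth_elR h).mono hs)
    (fun z hz => by rw [hn, hM.ampere_th z hz, neg_neg])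
    (fun z hz => (hM.ampere_r z hz).symm)
    (fun z hz => by rw [hn]; linarith [hM.gauss z hz])
    (fun t r hr => by simp [coK]) (fun t r hr => by simp [elTh])
    (fun r hr hRr θ hθ => by
      rcases eq_or_lt_of_le hθ.1 with h0 | h0
      · simp [elR, ← h0]
      rcases eq_or_lt_of_le hθ.2 with h1 | h1
      · simp [elR, h1]
      exact hR r hr hRr θ ⟨h0, h1⟩)
  exact ⟨f, h1, h2, h3⟩

theorem IsPotential.hasFDerivAt {eta : ℝ × (ℝ × ℝ) → ℝ} (hE : IsPotential a m lam f01 f02 u eta)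
    {z : ℝ × (ℝ × ℝ)} (hz : z ∈ stInt a m) : HasFDerivAt eta
      (oneForm (fun z => coK a m z.2 * u z) (fun z => -elTh a m f02 lam z) (elR a m f01 lam) z) z :=
  (hE.deriv z (stInt_subset_stOrb a m hz)).hasFDerivAt (stOrb_mem_nhds hz)

theorem IsPotential.fderiv_dirT {eta : ℝ × (ℝ × ℝ) → ℝ} (hE : IsPotential a m lam f01 f02 u eta)
    {z : ℝ × (ℝ × ℝ)} (hz : z ∈ stInt a m) : fderiv ℝ eta z dirT = coK a m z.2 * u z := by
  rw [(hE.hasFDerivAt hz).fderiv, oneForm_apply]; simp [dirT]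

theorem IsPotential.fderiv_dirR {eta : ℝ × (ℝ × ℝ) → ℝ} (hE : IsPotential a m lam f01 f02 u eta)
    {z : ℝ × (ℝ × ℝ)} (hz : z ∈ stInt a m) : fderiv ℝ eta z dirR = -elTh a m f02 lam z := by
  rw [(hE.hasFDerivAt hz).fderiv, oneForm_apply]; simp [dirR]

theorem IsPotential.fderiv_dirTh {eta : ℝ × (ℝ × ℝ) → ℝ} (hE : IsPotential a m lam f01 f02 u eta)
    {z : ℝ × (ℝ × ℝ)} (hz : z ∈ stInt a m) : fderiv ℝ eta z dirTh = elR a m f01 lam z := by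
  rw [(hE.hasFDerivAt hz).fderiv, oneForm_apply]; simp [dirTh]

theorem IsPotential.normal {eta : ℝ × (ℝ × ℝ) → ℝ} (hE : IsPotential a m lam f01 f02 u eta)
    (t : ℝ) : NormalDerivZeroOnAxis a m (fun p => eta (t, p)) := fun r hr => by
  have hu := uniqueDiffOn_Icc Real.pi_pos
  have h0 := left_mem_Icc.2 Real.pi_pos.le
  have h1 := right_mem_Icc.2 Real.pi_pos.le
  have e0 := (hasDerivWithinAt_theta hE.deriv (t := t) hr h0).derivWithin (hu _ h0)
  have e1 := (hasDerivWithinAt_theta hE.deriv (t := t) hr h1).derivWithin (hu _ h1)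
  exact ⟨e0.trans (by simp [elR]), e1.trans (by simp [elR])⟩

end Twist

section Axisymmetric
variable {a m : ℝ} {A : (Fin 4 → ℝ) → Fin 4 → ℝ}

/-- The potential of the electric field of `A`. -/
abbrev IsPot (a m : ℝ) (A : (Fin 4 → ℝ) → Fin 4 → ℝ) (eta : ℝ × (ℝ × ℝ) → ℝ) : Prop :=
  IsPotential a m (sl fun q => blPot A q 3) (sl (faraday A 0 1)) (sl (faraday A 0 2))
    (sl (faraday A 1 2)) eta

theorem exists_isPot (h : |a| < m) (hA : IsAxisymMaxwell a m A) : ∃ eta, IsPot a m A eta := by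
  obtain ⟨r₁, r₂, hr, hc⟩ := hA.compact_data
  refine (reducedMaxwell h hA).exists_isPotential h (R := r₂) fun r hr hR θ hθ => ?_
  have hz : ((0 : ℝ), (r, θ)) ∈ stInt a m := ⟨mem_univ _, hr, hθ⟩
  rw [← sl_faradayUp_zero_one h hA hz, sl, faradayUp]
  have := hc (lift 0 (r, θ)) (lift_mem_blChart hz.2) rfl fun hm => absurd hm.2 (not_le.2 hR)
  simp [this]

theorem IsPot.isElectricTwist (h : |a| < m) (hA : IsAxisymMaxwell a m A)
    {eta : ℝ × (ℝ × ℝ) → ℝ} (hE : IsPot a m A eta) :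
    IsElectricTwist a m A (fun t p => eta (t, p)) where
  smooth := hE.smooth
  eq_r t p hp := by
    have hz : (t, p) ∈ stInt a m := ⟨mem_univ _, hp⟩
    have e := slice_dth (hE.smooth.mono (stInt_subset_stOrb a m)) hz
    rw [hE.fderiv_dirTh hz, ← sl_faradayUp_zero_one h hA hz] at e
    exact e.symm
  eq_theta t p hp := by
    have hz : (t, p) ∈ stInt a m := ⟨mem_univ _, hp⟩
    have e := slice_dr (hE.smooth.mono (stInt_subset_stOrb a m)) hz
    rw [hE.fderiv_dirR hz, ← sl_faradayUp_zero_two h hA hz] at e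
    exact (neg_eq_iff_eq_neg.2 e).symm
  axis t r hr := hE.axis t r hr

/-- 𝔈^r prescribes ∂_θη, and η = 0 at θ = 0 fixes the constant of integration. -/
theorem IsElectricTwist.eqOn {eta eta' : ℝ → ℝ × ℝ → ℝ} (hE : IsElectricTwist a m A eta)
    (hE' : IsElectricTwist a m A eta') (t : ℝ) : EqOn (eta t) (eta' t) (orbit a m) := by
  intro p hp
  have hc : ∀ {f : ℝ → ℝ × ℝ → ℝ}, IsElectricTwist a m A f →
      ContinuousOn (fun θ => f t (p.1, θ)) (Icc 0 Real.pi) := fun hf =>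
    hf.smooth.continuousOn.comp (f := fun θ : ℝ => (t, (p.1, θ))) (by fun_prop)
      fun θ hθ => ⟨mem_univ _, hp.1, hθ⟩
  have hd : ∀ {f : ℝ → ℝ × ℝ → ℝ}, IsElectricTwist a m A f → ∀ θ ∈ Ioo 0 Real.pi,
      HasDerivAt (fun θ => f t (p.1, θ)) (faradayUp a m A 0 1 (lift t (p.1, θ))) θ :=
    fun {f} hf θ hθ => by
      have hz : (t, (p.1, θ)) ∈ stInt a m := ⟨mem_univ _, hp.1, hθ⟩
      rw [hf.eq_r t _ hz.2]
      exact (hasDerivAt_dirTh (differentiableAt_of_stInt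
        (hf.smooth.mono (stInt_subset_stOrb a m)) hz)).differentiableAt.hasDerivAt
  rcases eq_or_lt_of_le hp.2.1 with h0 | h0
  · have e : p = (p.1, 0) := Prod.ext rfl h0.symm
    rw [e, (hE.axis t p.1 hp.1).1, (hE'.axis t p.1 hp.1).1]
  obtain ⟨c, hc, he⟩ := exists_hasDerivAt_eq_slope
    (fun θ => eta t (p.1, θ) - eta' t (p.1, θ)) (fun _ => 0) h0
    (((hc hE).sub (hc hE')).mono (Icc_subset_Icc_right hp.2.2)) fun θ hθ => by
      have hθ' : θ ∈ Ioo 0 Real.pi := ⟨hθ.1, hθ.2.trans_le hp.2.2⟩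
      exact ((hd hE θ hθ').sub (hd hE' θ hθ')).congr_deriv (sub_self _)
  rw [eq_comm, div_eq_zero_iff] at he
  have e2 := he.resolve_right (by linarith)
  rw [(hE.axis t p.1 hp.1).1, (hE'.axis t p.1 hp.1).1] at e2
  linarith

/-- The definition of the twist potential constrains only spatial derivatives. Uniqueness on each
slice identifies it with the constructed potential, whose time derivative is known. -/
theorem IsElectricTwist.isPot (h : |a| < m) (hA : IsAxisymMaxwell a m A) {eta : ℝ → ℝ × ℝ → ℝ}
    (hE : IsElectricTwist a m A eta) : IsPot a m A (fun z => eta z.1 z.2) := by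
  obtain ⟨f, hf⟩ := exists_isPot h hA
  have e : EqOn (fun z : ℝ × (ℝ × ℝ) => eta z.1 z.2) f (stOrb a m) := fun z hz =>
    hE.eqOn (hf.isElectricTwist h hA) z.1 hz.2
  exact ⟨hE.smooth, fun t r hr => hE.axis t r hr, fun z hz => (hf.deriv z hz).congr e (e hz)⟩

end Axisymmetric


/-! ### Hamiltonian curves -/

/-- A curve of states that are regular at the axis and solve the field equations. -/
structure IsFlow (a m : ℝ) (x : ℝ → PhasePt) : Prop where
  smooth_lam : ContDiffOn ℝ ∞ (fun z : ℝ × (ℝ × ℝ) => (x z.1).lam z.2) (stOrb a m)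
  smooth_eta : ContDiffOn ℝ ∞ (fun z : ℝ × (ℝ × ℝ) => (x z.1).eta z.2) (stOrb a m)
  smooth_u : ContDiffOn ℝ ∞ (fun z : ℝ × (ℝ × ℝ) => (x z.1).u z.2) (stOrb a m)
  smooth_v : ContDiffOn ℝ ∞ (fun z : ℝ × (ℝ × ℝ) => (x z.1).v z.2) (stOrb a m)
  lam_axis : ∀ t, ZeroOnAxis a m (x t).lam
  eta_axis : ∀ t, ZeroOnAxis a m (x t).eta
  u_axis : ∀ t, ZeroOnAxis a m (x t).u
  v_axis : ∀ t, ZeroOnAxis a m (x t).v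
  lam_normal : ∀ t, NormalDerivZeroOnAxis a m (x t).lam
  eta_normal : ∀ t, NormalDerivZeroOnAxis a m (x t).eta
  lam_dt : ∀ z ∈ stInt a m, fderiv ℝ (fun z => (x z.1).lam z.2) z dirT = coK a m z.2 * (x z.1).v z.2
  eta_dt : ∀ z ∈ stInt a m, fderiv ℝ (fun z => (x z.1).eta z.2) z dirT = coK a m z.2 * (x z.1).u z.2
  v_dt : ∀ z ∈ stInt a m,
    fderiv ℝ (fun z => (x z.1).v z.2) z dirT = -(hamGrad a m (x z.1)).lam z.2
  u_dt : ∀ z ∈ stInt a m,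
    fderiv ℝ (fun z => (x z.1).u z.2) z dirT = -(hamGrad a m (x z.1)).eta z.2

section Flow
variable {a m : ℝ} {x : ℝ → PhasePt}

theorem IsFlow.axState (hx : IsFlow a m x) : AxState a m x :=
  axState_of_smooth hx.smooth_lam hx.smooth_eta hx.smooth_u hx.smooth_v hx.lam_axis hx.eta_axis
    hx.u_axis hx.v_axis hx.lam_normal hx.eta_normal

theorem smooth_slice_orbit {f : ℝ × (ℝ × ℝ) → ℝ} (hf : ContDiffOn ℝ ∞ f (stOrb a m)) (t : ℝ) :
    ContDiffOn ℝ ∞ (fun p => f (t, p)) (orbit a m) :=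
  hf.comp (by fun_prop) fun _ hp => ⟨mem_univ _, hp⟩

theorem IsFlow.smoothInt (hx : IsFlow a m x) (t : ℝ) : (x t).SmoothInt a m where
  lam := (smooth_slice_orbit hx.smooth_lam t).mono (orbitInt_subset_orbit a m)
  eta := (smooth_slice_orbit hx.smooth_eta t).mono (orbitInt_subset_orbit a m)
  u := (smooth_slice_orbit hx.smooth_u t).mono (orbitInt_subset_orbit a m)
  v := (smooth_slice_orbit hx.smooth_v t).mono (orbitInt_subset_orbit a m)

/-- The velocity of a Hamiltonian curve. -/
def velocity (a m : ℝ) (x : PhasePt) : PhasePt where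
  lam := fun p => coK a m p * x.v p
  v := fun p => -(hamGrad a m x).lam p
  eta := fun p => coK a m p * x.u p
  u := fun p => -(hamGrad a m x).eta p

theorem hasDerivAt_of_dirT {f : ℝ × (ℝ × ℝ) → ℝ} (hf : ContDiffOn ℝ ∞ f (stOrb a m)) {t : ℝ}
    {p : ℝ × ℝ} (hp : p ∈ orbitInt a m) {c : ℝ} (hc : fderiv ℝ f (t, p) dirT = c) :
    HasDerivAt (fun τ => f (τ, p)) c t := by
  have hz : (t, p) ∈ stInt a m := ⟨mem_univ _, hp⟩
  exact hc ▸ hasDerivAt_dirT (differentiableAt_of_stInt (hf.mono (stInt_subset_stOrb a m)) hz)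

/-- Interchange of `∂_t` with `∂_r`. -/
theorem hasDerivAt_slice_dr {f : ℝ × (ℝ × ℝ) → ℝ} {g : ℝ × ℝ → ℝ}
    (hf : ContDiffOn ℝ ∞ f (stOrb a m)) {t : ℝ} {p : ℝ × ℝ} (hp : p ∈ orbitInt a m)
    (hg : ∀ y ∈ orbitInt a m, fderiv ℝ f (t, y) dirT = g y) :
    HasDerivAt (fun τ => dr (fun y => f (τ, y)) p) (dr g p) t := by
  have hi := hf.mono (stInt_subset_stOrb a m)
  have hz : ∀ t, (t, p) ∈ stInt a m := fun t => ⟨mem_univ _, hp⟩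
  have h1 : (fun τ => dr (fun y => f (τ, y)) p) = fun τ => fderiv ℝ f (τ, p) dirR :=
    funext fun τ => slice_dr hi (hz τ)
  have h2 : dr g p = fderiv ℝ (fun z => fderiv ℝ f z dirR) (t, p) dirT := by
    rw [fderiv_comm hi (hz t), ← slice_dr (contDiffOn_fderiv_dir hi dirT) (hz t)]
    exact dr_congr (fun y hy => (hg y hy).symm) hp
  rw [h1, h2]
  exact hasDerivAt_dirT (differentiableAt_of_stInt (contDiffOn_fderiv_dir hi dirR) (hz t))

/-- Interchange of `∂_t` with `∂_θ`. -/
theorem hasDerivAt_slice_dth {f : ℝ × (ℝ × ℝ) → ℝ} {g : ℝ × ℝ → ℝ}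
    (hf : ContDiffOn ℝ ∞ f (stOrb a m)) {t : ℝ} {p : ℝ × ℝ} (hp : p ∈ orbitInt a m)
    (hg : ∀ y ∈ orbitInt a m, fderiv ℝ f (t, y) dirT = g y) :
    HasDerivAt (fun τ => dth (fun y => f (τ, y)) p) (dth g p) t := by
  have hi := hf.mono (stInt_subset_stOrb a m)
  have hz : ∀ t, (t, p) ∈ stInt a m := fun t => ⟨mem_univ _, hp⟩
  have h1 : (fun τ => dth (fun y => f (τ, y)) p) = fun τ => fderiv ℝ f (τ, p) dirTh :=
    funext fun τ => slice_dth hi (hz τ)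
  have h2 : dth g p = fderiv ℝ (fun z => fderiv ℝ f z dirTh) (t, p) dirT := by
    rw [fderiv_comm hi (hz t), ← slice_dth (contDiffOn_fderiv_dir hi dirT) (hz t)]
    exact dth_congr (fun y hy => (hg y hy).symm) hp
  rw [h1, h2]
  exact hasDerivAt_dirT (differentiableAt_of_stInt (contDiffOn_fderiv_dir hi dirTh) (hz t))

/-- Local conservation of energy. -/
theorem IsFlow.hasDerivAt_altDensity (h : |a| < m) (s : ℝ) (hx : IsFlow a m x) (t : ℝ)
    {p : ℝ × ℝ} (hp : p ∈ orbitInt a m) :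
    HasDerivAt (fun τ => altDensity a m s (x τ) p) (-dvg (currentS a m s (x t)) p) t := by
  have hz : ∀ {y}, y ∈ orbitInt a m → (t, y) ∈ stInt a m := fun hy => ⟨mem_univ _, hy⟩
  have l0 := hasDerivAt_of_dirT hx.smooth_lam hp (hx.lam_dt _ (hz hp))
  have e0 := hasDerivAt_of_dirT hx.smooth_eta hp (hx.eta_dt _ (hz hp))
  have u0 := hasDerivAt_of_dirT hx.smooth_u hp (hx.u_dt _ (hz hp))
  have v0 := hasDerivAt_of_dirT hx.smooth_v hp (hx.v_dt _ (hz hp))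
  have l1 := hasDerivAt_slice_dr hx.smooth_lam hp fun y hy => hx.lam_dt _ (hz hy)
  have l2 := hasDerivAt_slice_dth hx.smooth_lam hp fun y hy => hx.lam_dt _ (hz hy)
  have e1 := hasDerivAt_slice_dr hx.smooth_eta hp fun y hy => hx.eta_dt _ (hz hy)
  have e2 := hasDerivAt_slice_dth hx.smooth_eta hp fun y hy => hx.eta_dt _ (hz hy)
  have hK := smooth_coK h
  have hS := hx.smoothInt t
  -- The variation is the velocity of the motion itself: the pairing with the gradient cancels by
  -- antisymmetry, and the flux becomes -J^a.
  have key := polar_eq_pairing_add_dvg (δ := velocity a m (x t)) h s hS (hK.mul hS.v)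
    (hK.mul hS.u) hp
  have hpair : pairing (hamGrad a m (x t)) (velocity a m (x t)) p = 0 := by
    simp only [pairing, velocity, hamGrad_u_eq h _ hp, hamGrad_v_eq h _ hp]
    ring
  have hflux : dvg (polarFlux a m s (x t) (velocity a m (x t))) p =
      -dvg (currentS a m s (x t)) p := by
    have e : EqOn (polarFlux a m s (x t) (velocity a m (x t)))
        (fun y => -currentS a m s (x t) y) (orbitInt a m) := fun y hy => by
      change _ = -currentS a m s (x t) y
      rw [currentS_eq h s _ hy]
      simp only [polarFlux, velocity, Prod.neg_mk, Prod.mk.injEq]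
      constructor <;> ring
    rw [dvg_congr e hp]
    simp only [dvg, dr, dth, Prod.fst_neg, Prod.snd_neg, deriv.fun_neg]
    ring
  rw [← hflux, ← zero_add (dvg _ p), ← hpair, ← key]
  have e : (fun τ => altDensity a m s (x τ) p) = fun τ => polar a m s (x τ) (x τ) p / 2 :=
    funext fun τ => altDensity_eq h s _ hp
  rw [e]
  have yR := (e1.sub ((e0.const_mul (2 * (1 - s))).mul_const (gamR a m p))).add
    ((l0.const_mul s).mul_const (twR a m p))
  have yT := (e2.sub ((e0.const_mul (2 * (1 - s))).mul_const (gamTh a m p))).add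
    ((l0.const_mul s).mul_const (twTh a m p))
  have zR := (l1.sub ((l0.const_mul (2 * s)).mul_const (gamR a m p))).sub
    ((e0.const_mul (1 - s)).mul_const (twR a m p))
  have zT := (l2.sub ((l0.const_mul (2 * s)).mul_const (gamTh a m p))).sub
    ((e0.const_mul (1 - s)).mul_const (twTh a m p))
  have q := (l0.mul l0).add (e0.mul e0)
  have := (((((u0.mul u0).add (v0.mul v0)).const_mul (coK a m p)).add
    ((((yR.mul yR).add (zR.mul zR)).add (q.const_mul
      (4 * (s * (1 - s)) * (gamR a m p ^ 2 + twR a m p ^ 2 / 4)))).const_mul (coR a m p))).add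
    ((((yT.mul yT).add (zT.mul zT)).add (q.const_mul
      (4 * (s * (1 - s)) * (gamTh a m p ^ 2 + twTh a m p ^ 2 / 4)))).const_mul
        (coTh a m p))).div_const 2
  refine this.congr_deriv ?_
  simp only [polar, yEtaR, yEtaTh, yLamR, yLamTh, velocity, Pi.add_apply, Pi.sub_apply]
  ring

theorem IsFlow.spacetimeDiv_eq_zero (h : |a| < m) (s : ℝ) (hx : IsFlow a m x) (t : ℝ)
    {p : ℝ × ℝ} (hp : p ∈ orbitInt a m) : spacetimeDiv a m s x t p = 0 := by
  have := (hx.hasDerivAt_altDensity h s t hp).deriv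
  rw [spacetimeDiv]
  simp only [currentT, this]
  ring

theorem IsVarGrad.congr {H : PhasePt → ℝ} {y g g' : PhasePt} (hg : IsVarGrad a m H y g)
    (h1 : EqOn g'.lam g.lam (orbitInt a m)) (h2 : EqOn g'.v g.v (orbitInt a m))
    (h3 : EqOn g'.eta g.eta (orbitInt a m)) (h4 : EqOn g'.u g.u (orbitInt a m)) :
    IsVarGrad a m H y g' := by
  have e : ∀ δ, EqOn (pairing g δ) (pairing g' δ) (orbitInt a m) := fun δ p hp => by
    simp only [pairing, h1 hp, h2 hp, h3 hp, h4 hp]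
  have hm := (isOpen_orbitInt a m).measurableSet
  exact ⟨hg.cont_lam.congr h1, hg.cont_v.congr h2, hg.cont_eta.congr h3, hg.cont_u.congr h4,
    fun δ hδ => (hg.integrable δ hδ).congr_fun (e δ) hm,
    fun δ hδ => setIntegral_congr_fun hm (e δ) ▸ hg.hasDeriv δ hδ⟩

theorem IsFlow.hamiltonEqs (h : |a| < m) (s : ℝ) (hx : IsFlow a m x) {t : ℝ}
    (ht : InPhaseSpace a m (x t)) : HamiltonEqs a m (HAlt a m s) x t := by
  have hz : ∀ {y}, y ∈ orbitInt a m → (t, y) ∈ stInt a m := fun hy => ⟨mem_univ _, hy⟩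
  refine (isVarGrad_HAlt h s ht).congr (fun p hp => ?_) (fun p hp => ?_) (fun p hp => ?_)
    fun p hp => ?_
  · simp only [(hasDerivAt_of_dirT hx.smooth_v hp (hx.v_dt _ (hz hp))).deriv, neg_neg]
  · simp only [(hasDerivAt_of_dirT hx.smooth_lam hp (hx.lam_dt _ (hz hp))).deriv,
      hamGrad_v_eq h _ hp]
  · simp only [(hasDerivAt_of_dirT hx.smooth_u hp (hx.u_dt _ (hz hp))).deriv, neg_neg]
  · simp only [(hasDerivAt_of_dirT hx.smooth_eta hp (hx.eta_dt _ (hz hp))).deriv,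
      hamGrad_u_eq h _ hp]

end Flow

/-! ### The field equations -/

section Field
variable {a m : ℝ} {lam w f01 f02 u eta : ℝ × (ℝ × ℝ) → ℝ}

/-- This is the defining equation of the twist potential in explicit weights; through it derivatives
of 𝒜₀ become the ω-terms of `hamGrad`. -/
theorem hasDerivAt_kA0_th (h : |a| < m) {p : ℝ × ℝ} (hp : p ∈ orbitInt a m) :
    HasDerivAt (fun θ => kA0 a m (p.1, θ)) (coR a m p * twR a m p) p.2 := by
  have h2 := pi_pos h hp.1
  have h1 := sigma_pos (a := a) (delta_pos h hp.1).1
  have hs := sin_pos_of_mem hp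
  refine ((((hasDerivAt_const p.2 (2 * a * m * p.1)).div (hasDerivAt_pi_th a m p) h2.ne').neg
    )).congr_deriv ?_
  simp only [coR, twR, piTh, Prod.mk.eta]
  field_simp
  ring

theorem hasDerivAt_kA0_r (h : |a| < m) {p : ℝ × ℝ} (hp : p ∈ orbitInt a m) :
    HasDerivAt (fun r => kA0 a m (r, p.2)) (-(coTh a m p * twTh a m p)) p.1 := by
  have h2 := pi_pos h hp.1
  have h1 := sigma_pos (a := a) (delta_pos h hp.1).1
  have hs := sin_pos_of_mem hp
  refine ((((hasDerivAt_id' p.1).const_mul (2 * a * m)).div (hasDerivAt_pi_r a m p)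
    h2.ne').neg).congr_deriv ?_
  simp only [coTh, twTh, Prod.mk.eta]
  field_simp

theorem smooth_kA0 (h : |a| < m) : ContDiffOn ℝ ∞ (kA0 a m) (orbitInt a m) :=
  ((ContDiff.contDiffOn (by fun_prop)).div (contDiff_kPi a m).contDiffOn
    fun _ hp => (pi_pos h hp.1).ne').neg

theorem smooth_snd {f : ℝ × ℝ → ℝ} (hf : ContDiffOn ℝ ∞ f (orbitInt a m)) :
    ContDiffOn ℝ ∞ (fun z : ℝ × (ℝ × ℝ) => f z.2) (stInt a m) :=
  hf.comp contDiffOn_snd fun _ hz => hz.2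

theorem fderiv_kA0 (h : |a| < m) {z : ℝ × (ℝ × ℝ)} (hz : z ∈ stInt a m) :
    fderiv ℝ (fun z : ℝ × (ℝ × ℝ) => kA0 a m z.2) z dirR = -(coTh a m z.2 * twTh a m z.2) ∧
    fderiv ℝ (fun z : ℝ × (ℝ × ℝ) => kA0 a m z.2) z dirTh = coR a m z.2 * twR a m z.2 := by
  have hd := differentiableAt_of_stInt (smooth_snd (smooth_kA0 h)) hz
  exact ⟨(hasDerivAt_dirR hd).unique (hasDerivAt_kA0_r h hz.2),
    (hasDerivAt_dirTh hd).unique (hasDerivAt_kA0_th h hz.2)⟩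

/-- The relation between 𝔈^θ and F_{tθ} is inverted and 𝔈^θ replaced by -∂_rη. The 𝒜₀-term comes
from the off-diagonal entry of the metric. -/
theorem f02_eq (h : |a| < m) (hE : IsPotential a m lam f01 f02 u eta) : EqOn f02
    (fun z => coR a m z.2 * fderiv ℝ eta z dirR - kA0 a m z.2 * fderiv ℝ lam z dirTh)
    (stInt a m) := fun z hz => by
  have h2 := pi_pos h hz.2.1
  obtain ⟨h0, hD⟩ := delta_pos h hz.2.1
  have h1 := sigma_pos (a := a) h0
  have hs := sin_pos_of_mem hz.2
  simp only [hE.fderiv_dirR hz, elTh, coR, kA0]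
  field_simp
  ring

theorem f01_eq (h : |a| < m) (hE : IsPotential a m lam f01 f02 u eta) : EqOn f01
    (fun z => -(coTh a m z.2 * fderiv ℝ eta z dirTh) - kA0 a m z.2 * fderiv ℝ lam z dirR)
    (stInt a m) := fun z hz => by
  have h2 := pi_pos h hz.2.1
  obtain ⟨h0, hD⟩ := delta_pos h hz.2.1
  have h1 := sigma_pos (a := a) h0
  have hs := sin_pos_of_mem hz.2
  simp only [hE.fderiv_dirTh hz, elR, coTh, kA0]
  field_simp
  ring

/-- Up to factors of Σ and sin θ this is the determinant of the (t, φ) block, g_tt g_φφ - g_tφ² = -Δ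
sin²θ. -/
theorem pi_mul_eq (a m : ℝ) (p : ℝ × ℝ) :
    (kDelta a m p - a ^ 2 * Real.sin p.2 ^ 2) * kPi a m p =
      kDelta a m p * kSigma a p ^ 2 - (2 * a * m * p.1 * Real.sin p.2) ^ 2 := by
  have h' : Real.cos p.2 ^ 2 = 1 - Real.sin p.2 ^ 2 := by
    linarith [Real.sin_sq_add_cos_sq p.2]
  simp only [kPi, kSigma, kDelta, h']
  ring

theorem upRPhi_eq (h : |a| < m) (hE : IsPotential a m lam f01 f02 u eta) :
    EqOn (upRPhi a m f01 lam)
    (fun z => coR a m z.2 * fderiv ℝ lam z dirR + kA0 a m z.2 * fderiv ℝ eta z dirTh)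
    (stInt a m) := fun z hz => by
  have h2 := pi_pos h hz.2.1
  obtain ⟨h0, hD⟩ := delta_pos h hz.2.1
  have h1 := sigma_pos (a := a) h0
  have hs := sin_pos_of_mem hz.2
  have e : kDelta a m z.2 - a ^ 2 * Real.sin z.2.2 ^ 2 = (kDelta a m z.2 * kSigma a z.2 ^ 2
      - (2 * a * m * z.2.1 * Real.sin z.2.2) ^ 2) / kPi a m z.2 := by
    rw [eq_div_iff h2.ne', pi_mul_eq]
  simp only [upRPhi, e, f01_eq h hE hz, coR, coTh, kA0]
  field_simp
  ring

theorem upThPhi_eq (h : |a| < m) (hE : IsPotential a m lam f01 f02 u eta) :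
    EqOn (upThPhi a m f02 lam)
    (fun z => coTh a m z.2 * fderiv ℝ lam z dirTh - kA0 a m z.2 * fderiv ℝ eta z dirR)
    (stInt a m) := fun z hz => by
  have h2 := pi_pos h hz.2.1
  obtain ⟨h0, hD⟩ := delta_pos h hz.2.1
  have h1 := sigma_pos (a := a) h0
  have hs := sin_pos_of_mem hz.2
  have e : kDelta a m z.2 - a ^ 2 * Real.sin z.2.2 ^ 2 = (kDelta a m z.2 * kSigma a z.2 ^ 2
      - (2 * a * m * z.2.1 * Real.sin z.2.2) ^ 2) / kPi a m z.2 := by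
    rw [eq_div_iff h2.ne', pi_mul_eq]
  simp only [upThPhi, e, f02_eq h hE hz, coR, coTh, kA0]
  field_simp
  ring

theorem fderiv_mul_dir {f g : ℝ × (ℝ × ℝ) → ℝ} (hf : ContDiffOn ℝ ∞ f (stInt a m))
    (hg : ContDiffOn ℝ ∞ g (stInt a m)) {z : ℝ × (ℝ × ℝ)} (hz : z ∈ stInt a m)
    (e : ℝ × (ℝ × ℝ)) : fderiv ℝ (fun z => f z * g z) z e =
      f z * fderiv ℝ g z e + g z * fderiv ℝ f z e := by
  rw [fderiv_fun_mul (differentiableAt_of_stInt hf hz) (differentiableAt_of_stInt hg hz)]; simp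

theorem fderiv_add_dir {f g : ℝ × (ℝ × ℝ) → ℝ} (hf : ContDiffOn ℝ ∞ f (stInt a m))
    (hg : ContDiffOn ℝ ∞ g (stInt a m)) {z : ℝ × (ℝ × ℝ)} (hz : z ∈ stInt a m)
    (e : ℝ × (ℝ × ℝ)) : fderiv ℝ (fun z => f z + g z) z e = fderiv ℝ f z e + fderiv ℝ g z e := by
  rw [fderiv_fun_add (differentiableAt_of_stInt hf hz) (differentiableAt_of_stInt hg hz)]; simp

theorem fderiv_sub_dir {f g : ℝ × (ℝ × ℝ) → ℝ} (hf : ContDiffOn ℝ ∞ f (stInt a m))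
    (hg : ContDiffOn ℝ ∞ g (stInt a m)) {z : ℝ × (ℝ × ℝ)} (hz : z ∈ stInt a m)
    (e : ℝ × (ℝ × ℝ)) : fderiv ℝ (fun z => f z - g z) z e = fderiv ℝ f z e - fderiv ℝ g z e := by
  rw [fderiv_fun_sub (differentiableAt_of_stInt hf hz) (differentiableAt_of_stInt hg hz)]; simp

theorem slice_dr_mul {f : ℝ × (ℝ × ℝ) → ℝ} (hf : ContDiffOn ℝ ∞ f (stInt a m)) {c : ℝ × ℝ → ℝ}
    (hc : ContDiffOn ℝ ∞ c (orbitInt a m)) {z : ℝ × (ℝ × ℝ)} (hz : z ∈ stInt a m) :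
    dr (fun y => c y * dr (fun p => f (z.1, p)) y) z.2 =
      fderiv ℝ (fun z => c z.2 * fderiv ℝ f z dirR) z dirR := by
  rw [← slice_dr ((smooth_snd hc).mul (contDiffOn_fderiv_dir hf dirR)) hz]
  refine dr_congr (fun y hy => ?_) hz.2
  simp only [slice_dr hf (z := (z.1, y)) ⟨mem_univ _, hy⟩]

theorem slice_dth_mul {f : ℝ × (ℝ × ℝ) → ℝ} (hf : ContDiffOn ℝ ∞ f (stInt a m)) {c : ℝ × ℝ → ℝ}
    (hc : ContDiffOn ℝ ∞ c (orbitInt a m)) {z : ℝ × (ℝ × ℝ)} (hz : z ∈ stInt a m) :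
    dth (fun y => c y * dth (fun p => f (z.1, p)) y) z.2 =
      fderiv ℝ (fun z => c z.2 * fderiv ℝ f z dirTh) z dirTh := by
  rw [← slice_dth ((smooth_snd hc).mul (contDiffOn_fderiv_dir hf dirTh)) hz]
  refine dth_congr (fun y hy => ?_) hz.2
  simp only [slice_dth hf (z := (z.1, y)) ⟨mem_univ _, hy⟩]

/-- Faraday's law is Hamilton's equation for `u`. -/
theorem ReducedMaxwell.u_dt (h : |a| < m) (hM : ReducedMaxwell a m lam w f01 f02 u)
    (hE : IsPotential a m lam f01 f02 u eta) {x : ℝ → PhasePt}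
    (h1 : (fun z : ℝ × (ℝ × ℝ) => (x z.1).lam z.2) = lam)
    (h2 : (fun z : ℝ × (ℝ × ℝ) => (x z.1).eta z.2) = eta) {z : ℝ × (ℝ × ℝ)} (hz : z ∈ stInt a m) :
    fderiv ℝ u z dirT = -(hamGrad a m (x z.1)).eta z.2 := by
  have hl := hM.smooth_lam.mono (stInt_subset_stDom a m)
  have he := hE.smooth.mono (stInt_subset_stOrb a m)
  have hA := smooth_snd (smooth_kA0 h)
  have dl := fun e => contDiffOn_fderiv_dir hl e
  have de := fun e => contDiffOn_fderiv_dir he e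
  have cR := (smooth_snd (smooth_coR h)).mul (de dirR)
  have cT := (smooth_snd (smooth_coTh h)).mul (de dirTh)
  have hneg : fderiv ℝ (fun z => -(coTh a m z.2 * fderiv ℝ eta z dirTh)) z dirTh =
      -fderiv ℝ (fun z => coTh a m z.2 * fderiv ℝ eta z dirTh) z dirTh := by
    rw [fderiv_fun_neg]; rfl
  have e1 : (x z.1).lam = fun p => lam (z.1, p) := by rw [← h1]
  have e2 : (x z.1).eta = fun p => eta (z.1, p) := by rw [← h2]
  -- In the curl of (F_{tr}, F_{tθ}) the second derivatives of λ multiplied by 𝒜₀ cancel; the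
  -- derivatives of 𝒜₀ remain and give the twist coupling.
  rw [hM.bianchi z hz, fderiv_congr_stInt (f02_eq h hE) hz, fderiv_congr_stInt (f01_eq h hE) hz,
    fderiv_sub_dir cR (hA.mul (dl dirTh)) hz, fderiv_sub_dir cT.neg (hA.mul (dl dirR)) hz, hneg,
    fderiv_mul_dir hA (dl dirTh) hz, fderiv_mul_dir hA (dl dirR) hz, (fderiv_kA0 h hz).1,
    (fderiv_kA0 h hz).2, fderiv_comm hl hz dirTh dirR, hamGrad_eta_eq h _ hz.2, e1, e2,
    slice_dr_mul he (smooth_coR h) hz, slice_dth_mul he (smooth_coTh h) hz, slice_dr hl hz,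
    slice_dth hl hz]
  ring

/-- The `φ`-component of Ampère's law is Hamilton's equation for `v`. -/
theorem ReducedMaxwell.v_dt (h : |a| < m) (hM : ReducedMaxwell a m lam w f01 f02 u)
    (hE : IsPotential a m lam f01 f02 u eta) {x : ℝ → PhasePt}
    (h1 : (fun z : ℝ × (ℝ × ℝ) => (x z.1).lam z.2) = lam)
    (h2 : (fun z : ℝ × (ℝ × ℝ) => (x z.1).eta z.2) = eta) {z : ℝ × (ℝ × ℝ)} (hz : z ∈ stInt a m) :
    fderiv ℝ (momV a m w) z dirT = -(hamGrad a m (x z.1)).lam z.2 := by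
  have hl := hM.smooth_lam.mono (stInt_subset_stDom a m)
  have he := hE.smooth.mono (stInt_subset_stOrb a m)
  have hA := smooth_snd (smooth_kA0 h)
  have dl := fun e => contDiffOn_fderiv_dir hl e
  have de := fun e => contDiffOn_fderiv_dir he e
  have cR := (smooth_snd (smooth_coR h)).mul (dl dirR)
  have cT := (smooth_snd (smooth_coTh h)).mul (dl dirTh)
  have e1 : (x z.1).lam = fun p => lam (z.1, p) := by rw [← h1]
  have e2 : (x z.1).eta = fun p => eta (z.1, p) := by rw [← h2]
  rw [hM.ampere_phi z hz, fderiv_congr_stInt (upRPhi_eq h hE) hz,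
    fderiv_congr_stInt (upThPhi_eq h hE) hz, fderiv_add_dir cR (hA.mul (de dirTh)) hz,
    fderiv_sub_dir cT (hA.mul (de dirR)) hz,
    fderiv_mul_dir hA (de dirTh) hz, fderiv_mul_dir hA (de dirR) hz, (fderiv_kA0 h hz).1,
    (fderiv_kA0 h hz).2, fderiv_comm he hz dirTh dirR, hamGrad_lam_eq h _ hz.2, e1, e2,
    slice_dr_mul hl (smooth_coR h) hz, slice_dth_mul hl (smooth_coTh h) hz, slice_dr he hz,
    slice_dth he hz]
  ring

theorem ReducedMaxwell.lam_dt (h : |a| < m) (hM : ReducedMaxwell a m lam w f01 f02 u)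
    {z : ℝ × (ℝ × ℝ)} (hz : z ∈ stInt a m) :
    fderiv ℝ lam z dirT = coK a m z.2 * momV a m w z := by
  have hD := (delta_pos h hz.2.1).2
  have hS := sigma_pos (a := a) (delta_pos h hz.2.1).1
  have hw := differentiableAt_of_stDom hM.smooth_w (stInt_subset_stDom a m hz)
  have hl := differentiableAt_of_stDom hM.smooth_lam (stInt_subset_stDom a m hz)
  have e : fderiv ℝ lam z dirT = Real.sin z.2.2 * fderiv ℝ w z dirT := by
    have h2 := hasDerivAt_dirT hl
    rw [hM.lam_eq] at h2 ⊢
    exact h2.unique ((hasDerivAt_dirT hw).const_mul (Real.sin z.2.2))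
  rw [e, coK, momV]
  field_simp

theorem ReducedMaxwell.lam_normal (hM : ReducedMaxwell a m lam w f01 f02 u) (t : ℝ) :
    NormalDerivZeroOnAxis a m (fun p => lam (t, p)) := fun r hr => by
  have key : ∀ θ ∈ Icc 0 Real.pi, Real.sin θ = 0 → w (t, (r, θ)) = 0 →
      derivWithin (fun θ => lam (t, (r, θ))) (Icc 0 Real.pi) θ = 0 := fun θ hθ hs h0 => by
    have hw := hasDerivAt_dirTh (differentiableAt_of_stDom hM.smooth_w
      (z := (t, (r, θ))) ⟨mem_univ _, hr, mem_univ _⟩)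
    have := ((Real.hasDerivAt_sin θ).mul hw).hasDerivWithinAt (s := Icc 0 Real.pi)
    rw [hM.lam_eq]
    refine (this.derivWithin (uniqueDiffOn_Icc Real.pi_pos θ hθ)).trans ?_
    simp [hs, h0]
  exact ⟨key 0 (left_mem_Icc.2 Real.pi_pos.le) Real.sin_zero (hM.w_axis t r hr).1,
    key Real.pi (right_mem_Icc.2 Real.pi_pos.le) Real.sin_pi (hM.w_axis t r hr).2⟩

end Field

section Axisymmetric
variable {a m : ℝ} {A : (Fin 4 → ℝ) → Fin 4 → ℝ}

/-- The factor √(-det ḡ) is zero on the axis, whatever value the matrix inverse takes there. So v,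
which is defined by this formula also on the axis, agrees with its smooth extension. -/
theorem faradayUp_axis (h : |a| < m) (A : (Fin 4 → ℝ) → Fin 4 → ℝ) (μ ν : Fin 4)
    {t r θ : ℝ} (hr : rPlus a m < r) (hs : Real.sin θ = 0) :
    faradayUp a m A μ ν (lift t (r, θ)) = 0 := by
  have e : (kerrMetric a m (lift t (r, θ) 1, lift t (r, θ) 2)).det = 0 := by
    rw [show (lift t (r, θ) 1, lift t (r, θ) 2) = (r, θ) from rfl, det_kerrMetric h hr]
    simp [hs]
  rw [faradayUp, e]
  simp

theorem phaseCurve_v_eq (h : |a| < m) (hA : IsAxisymMaxwell a m A) (η : ℝ → ℝ × ℝ → ℝ) :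
    EqOn (fun z : ℝ × (ℝ × ℝ) => (phaseCurve a m A η z.1).v z.2) (momV a m (sl (potW A)))
      (stOrb a m) := by
  rintro ⟨t, r, θ⟩ hz
  have hz' := (reducedMaxwell h hA).axisZero_momV t r hz.2.1
  have hv : ∀ θ, Real.sin θ = 0 → -faradayUp a m A 0 3 (lift t (r, θ)) = 0 := fun θ hs => by
    rw [faradayUp_axis h A 0 3 hz.2.1 hs, neg_zero]
  rcases eq_or_lt_of_le hz.2.2.1 with h0 | h0
  · have h0 : 0 = θ := h0
    subst h0
    exact (hv 0 Real.sin_zero).trans hz'.1.symm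
  rcases eq_or_lt_of_le hz.2.2.2 with h1 | h1
  · have h1 : θ = Real.pi := h1
    subst h1
    exact (hv _ Real.sin_pi).trans hz'.2.symm
  exact sl_faradayUp_zero_three h hA ⟨mem_univ _, hz.2.1, h0, h1⟩

theorem isFlow_phaseCurve (h : |a| < m) (hA : IsAxisymMaxwell a m A) {η : ℝ → ℝ × ℝ → ℝ}
    (hη : IsElectricTwist a m A η) : IsFlow a m (phaseCurve a m A η) := by
  have hM := reducedMaxwell h hA
  have hE := hη.isPot h hA
  have hs := stOrb_subset_stDom a m
  have hv := phaseCurve_v_eq h hA η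
  have hvi : EqOn (fun z : ℝ × (ℝ × ℝ) => (phaseCurve a m A η z.1).v z.2)
    (momV a m (sl (potW A))) (stInt a m) := fun z hz => hv (stInt_subset_stOrb a m hz)
  refine ⟨hM.smooth_lam.mono hs, hE.smooth, hM.smooth_u.mono hs,
    ((hM.smooth_momV h).mono hs).congr hv, fun t r hr => ?_, hη.axis,
    fun t r hr => hM.u_axis t r hr, fun t r hr => ?_, hM.lam_normal, hE.normal,
    fun z hz => ?_, fun z hz => hE.fderiv_dirT hz, fun z hz => ?_, fun z hz => ?_⟩
  · have := congrFun hM.lam_eq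
    exact ⟨(this (t, (r, 0))).trans (by simp), (this (t, (r, Real.pi))).trans (by simp)⟩
  · have h0 := hM.axisZero_momV t r hr
    exact ⟨(hv (x := (t, (r, 0))) ⟨mem_univ _, hr, left_mem_Icc.2 Real.pi_pos.le⟩).trans h0.1,
      (hv (x := (t, (r, Real.pi))) ⟨mem_univ _, hr, right_mem_Icc.2 Real.pi_pos.le⟩).trans h0.2⟩
  · exact (hM.lam_dt h hz).trans (by rw [← hvi hz])
  · rw [fderiv_congr_stInt hvi hz]
    exact hM.v_dt h hE rfl rfl hz
  · exact hM.u_dt h hE rfl rfl hz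

end Axisymmetric


/-! ### Finite propagation speed -/

theorem delta_eq_mul {a m : ℝ} (h : |a| < m) (p : ℝ × ℝ) :
    kDelta a m p = (p.1 - rPlus a m) * (p.1 - rPlus a m + 2 * √(m ^ 2 - a ^ 2)) := by
  have h2 : 0 ≤ m ^ 2 - a ^ 2 := by
    have := sq_lt_sq' (by linarith [neg_abs_le a]) (lt_of_le_of_lt (le_abs_self a) h)
    linarith
  have hq := Real.sq_sqrt h2
  simp only [kDelta, rPlus]
  linear_combination hq

/-- The speed `√(N² q^{rr})` is at most `(r - r₊) / m`. -/
theorem sq_speed_le {a m : ℝ} (h : |a| < m) {p : ℝ × ℝ} (hp : p ∈ orbitInt a m) :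
    m ^ 2 * (coR a m p * coK a m p) ≤ (p.1 - rPlus a m) ^ 2 := by
  have hm : 0 < m := lt_of_le_of_lt (abs_nonneg a) h
  obtain ⟨h0, hD⟩ := delta_pos h hp.1
  have hS := sigma_pos (a := a) h0
  have hP := pi_pos h hp.1
  have hs := sin_pos_of_mem hp
  have hr : rPlus a m < p.1 := hp.1
  have e : coR a m p * coK a m p = kDelta a m p ^ 2 / kPi a m p := by
    simp only [coR, coK]; field_simp
  set d := √(m ^ 2 - a ^ 2) with hd
  have hd0 : 0 ≤ d := Real.sqrt_nonneg _
  have hdm : d ≤ m := Real.sqrt_le_iff.2 ⟨hm.le, by nlinarith [sq_nonneg a]⟩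
  have hrp : rPlus a m = m + d := rfl
  -- N² q^{rr} is Δ²/Π with Δ = (r-r₊)(r-r₋). Since r₋ = m - d ≥ 0, the second factor is at most r,
  -- while Π ≥ m²r².
  have hPge : m ^ 2 * p.1 ^ 2 ≤ kPi a m p := by
    rw [pi_eq]
    have : 0 ≤ kSigma a p * kDelta a m p := by positivity
    have h3 : 0 ≤ m * p.1 * (p.1 ^ 2 + 2 * a ^ 2) := by positivity
    have h4 : 0 ≤ m * p.1 ^ 2 * (p.1 - m) := mul_nonneg (by positivity) (by linarith)
    nlinarith
  have h5 : (p.1 - rPlus a m + 2 * d) ^ 2 ≤ p.1 ^ 2 :=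
    pow_le_pow_left₀ (by linarith) (by linarith) 2
  rw [e, ← mul_div_assoc, div_le_iff₀ hP, delta_eq_mul h, mul_pow]
  have h6 : m ^ 2 * (p.1 - rPlus a m + 2 * d) ^ 2 ≤ kPi a m p :=
    (mul_le_mul_of_nonneg_left h5 (sq_nonneg m)).trans hPge
  calc _ = (p.1 - rPlus a m) ^ 2 * (m ^ 2 * (p.1 - rPlus a m + 2 * d) ^ 2) := by ring
    _ ≤ _ := mul_le_mul_of_nonneg_left h6 (sq_nonneg _)

/-- The inequality of means in the form √(ck)|xy| ≤ ½(kx² + cy²), combined with the bound ρ for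
|μ|√(ck). -/
theorem abs_mul_le_of_sq_le {μ k c ρ x y : ℝ} (hk : 0 < k) (hc : 0 < c) (hρ : 0 ≤ ρ)
    (h : μ ^ 2 * (c * k) ≤ ρ ^ 2) : |μ * (c * k * (x * y))| ≤ ρ / 2 * (k * x ^ 2 + c * y ^ 2) := by
  refine abs_le_of_sq_le_sq ?_ (by positivity)
  have h1 : (μ * (c * k * (x * y))) ^ 2 = μ ^ 2 * (c * k) * (c * k * (x * y) ^ 2) := by ring
  have h2 : (ρ / 2 * (k * x ^ 2 + c * y ^ 2)) ^ 2 =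
      ρ ^ 2 * (c * k * (x * y) ^ 2) + (ρ / 2 * (k * x ^ 2 - c * y ^ 2)) ^ 2 := by ring
  rw [h1, h2]
  have h3 : 0 ≤ c * k * (x * y) ^ 2 := by positivity
  nlinarith [mul_le_mul_of_nonneg_right h h3, sq_nonneg (ρ / 2 * (k * x ^ 2 - c * y ^ 2))]

/-- The radial energy flux is bounded by the energy density times the speed of propagation. -/
theorem abs_currentS_le {a m s : ℝ} (h : |a| < m) (hs : s ∈ Icc (0 : ℝ) 1) (x : PhasePt)
    {p : ℝ × ℝ} (hp : p ∈ orbitInt a m) :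
    m * |(currentS a m s x p).1| ≤ (p.1 - rPlus a m) * altDensity a m s x p := by
  have hm : 0 < m := lt_of_le_of_lt (abs_nonneg a) h
  have hr : 0 ≤ p.1 - rPlus a m := (sub_pos.2 hp.1).le
  have hk := coK_pos h hp
  have hc := coR_pos h hp
  have ht := coTh_pos h hp
  have hsp := sq_speed_le h hp
  have i1 := abs_mul_le_of_sq_le (x := x.u p) (y := yEtaR a m s x p) hk hc hr hsp
  have i2 := abs_mul_le_of_sq_le (x := x.v p) (y := yLamR a m s x p) hk hc hr hsp
  have hss : 0 ≤ s * (1 - s) := mul_nonneg hs.1 (sub_nonneg.2 hs.2)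
  have e : m * |(currentS a m s x p).1| = |m * (coR a m p * coK a m p *
      (x.u p * yEtaR a m s x p)) + m * (coR a m p * coK a m p * (x.v p * yLamR a m s x p))| := by
    rw [currentS_eq h s x hp, ← abs_of_pos hm, ← abs_mul, ← abs_neg, abs_of_pos hm]
    congr 1
    ring
  -- Only the momenta and the radial parts of Y_η and Y_λ enter the radial flux; the other squares
  -- in the energy are dropped.
  have hge : 1 / 2 * (coK a m p * x.u p ^ 2 + coR a m p * yEtaR a m s x p ^ 2)
      + 1 / 2 * (coK a m p * x.v p ^ 2 + coR a m p * yLamR a m s x p ^ 2)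
      ≤ altDensity a m s x p := by
    have q1 : 0 ≤ coR a m p * (4 * (s * (1 - s)) * (gamR a m p ^ 2 + twR a m p ^ 2 / 4)
        * (x.lam p ^ 2 + x.eta p ^ 2)) := by positivity
    have q2 : 0 ≤ coTh a m p * (yEtaTh a m s x p ^ 2 + yLamTh a m s x p ^ 2
        + 4 * (s * (1 - s)) * (gamTh a m p ^ 2 + twTh a m p ^ 2 / 4)
        * (x.lam p ^ 2 + x.eta p ^ 2)) := by positivity
    rw [altDensity_eq h s x hp]
    simp only [polar]
    linarith
  rw [e]
  refine (abs_add_le _ _).trans ((add_le_add i1 i2).trans ?_)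
  have := mul_le_mul_of_nonneg_left hge hr
  linarith

/-! ### Cut-off functions adapted to the speed (r - r₊)/m. -/

/-- A function that is positive exactly in a light cone. -/
def coneFn (m T ρ₀ σ : ℝ) (t ρ : ℝ) : ℝ :=
  2 * ρ * ρ₀ * Real.cosh ((T - σ * t) / m) - ρ ^ 2 - ρ₀ ^ 2

/-- The cone function factors as (ρ - ρ₀e^{-y})(ρ₀e^y - ρ), so for ρ > 0 its positivity means
|log(ρ/ρ₀)| < y. -/
theorem mem_Icc_of_cone_pos {y Y ρ ρ₀ : ℝ} (hρ₀ : 0 < ρ₀) (hy : 0 ≤ y) (hY : y ≤ Y)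
    (h : 0 < 2 * ρ * ρ₀ * Real.cosh y - ρ ^ 2 - ρ₀ ^ 2) :
    ρ ∈ Icc (ρ₀ * Real.exp (-Y)) (ρ₀ * Real.exp Y) := by
  have he : Real.exp y * Real.exp (-y) = 1 := by rw [← Real.exp_add]; simp
  have hf : 2 * ρ * ρ₀ * Real.cosh y - ρ ^ 2 - ρ₀ ^ 2 =
      (ρ - ρ₀ * Real.exp (-y)) * (ρ₀ * Real.exp y - ρ) := by
    rw [Real.cosh_eq]; linear_combination ρ₀ ^ 2 * he
  rw [hf] at h
  have i1 : ρ₀ * Real.exp (-Y) ≤ ρ₀ * Real.exp (-y) :=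
    mul_le_mul_of_nonneg_left (Real.exp_le_exp.2 (by linarith)) hρ₀.le
  have i2 : ρ₀ * Real.exp y ≤ ρ₀ * Real.exp Y :=
    mul_le_mul_of_nonneg_left (Real.exp_le_exp.2 hY) hρ₀.le
  have i3 : ρ₀ * Real.exp (-y) ≤ ρ₀ * Real.exp y :=
    mul_le_mul_of_nonneg_left (Real.exp_le_exp.2 (by linarith)) hρ₀.le
  rcases pos_and_pos_or_neg_and_neg_of_mul_pos h with ⟨h1, h2⟩ | ⟨h1, h2⟩
  · exact ⟨by linarith, by linarith⟩
  · linarith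

/-- By cosh² - sinh² = 1 the squares of the two sides differ by 4ρ² times the cone function. So
inside the cone the level sets of that function are not crossed outward at speed ρ/m. -/
theorem abs_cone_slope_le {y ρ ρ₀ : ℝ} (hρ : 0 ≤ ρ) (hρ₀ : 0 ≤ ρ₀) (hy : 0 ≤ y)
    (h : 0 ≤ 2 * ρ * ρ₀ * Real.cosh y - ρ ^ 2 - ρ₀ ^ 2) :
    ρ * |2 * ρ₀ * Real.cosh y - 2 * ρ| ≤ 2 * ρ * ρ₀ * Real.sinh y := by
  have hs : 0 ≤ Real.sinh y := Real.sinh_nonneg_iff.2 hy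
  rw [← abs_of_nonneg hρ, ← abs_mul, abs_of_nonneg hρ]
  refine abs_le_of_sq_le_sq ?_ (by positivity)
  have hc := Real.cosh_sq y
  have e : (2 * ρ * ρ₀ * Real.sinh y) ^ 2 - (ρ * (2 * ρ₀ * Real.cosh y - 2 * ρ)) ^ 2 =
      4 * ρ ^ 2 * (2 * ρ * ρ₀ * Real.cosh y - ρ ^ 2 - ρ₀ ^ 2) := by
    linear_combination (-(4 * ρ ^ 2 * ρ₀ ^ 2)) * hc
  nlinarith [mul_nonneg (mul_nonneg zero_le_four (sq_nonneg ρ)) h]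

theorem deriv_expNegInvGlue_nonneg (x : ℝ) : 0 ≤ deriv expNegInvGlue x :=
  expNegInvGlue.monotone.deriv_nonneg

/-- Every such point is a global minimum of a nonnegative function that vanishes there. -/
theorem deriv_expNegInvGlue_of_nonpos {x : ℝ} (hx : x ≤ 0) : deriv expNegInvGlue x = 0 := by
  refine IsLocalMin.deriv_eq_zero (Filter.Eventually.of_forall fun y => ?_)
  rw [expNegInvGlue.zero_of_nonpos hx]
  exact expNegInvGlue.nonneg y

theorem hasDerivAt_expNegInvGlue (x : ℝ) :
    HasDerivAt expNegInvGlue (deriv expNegInvGlue x) x :=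
  (expNegInvGlue.contDiff (n := 1)).differentiable (by simp) |>.differentiableAt.hasDerivAt

/-- A smooth cut-off function supported in a light cone. -/
def coneCut (a m T ρ₀ σ : ℝ) (z : ℝ × (ℝ × ℝ)) : ℝ :=
  expNegInvGlue (coneFn m T ρ₀ σ z.1 (z.2.1 - rPlus a m))

theorem contDiff_coneCut (a m T ρ₀ σ : ℝ) : ContDiff ℝ ∞ (coneCut a m T ρ₀ σ) := by
  unfold coneCut coneFn
  refine (expNegInvGlue.contDiff (n := ⊤)).comp ?_
  have : ContDiff ℝ ∞ Real.cosh := Real.contDiff_cosh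
  fun_prop

/-- Differentiation under the integral sign. -/
theorem Ax.hasDerivAt_integral {a m : ℝ} {n : ℤ} {F : ℝ × (ℝ × ℝ) → ℝ} (hF : Ax a m n F)
    (hn : 0 ≤ n) {r₁ r₂ T : ℝ} (hr : rPlus a m < r₁)
    (hs : ∀ t, |t| ≤ T → SuppIn a m r₁ r₂ fun p => F (t, p)) {t : ℝ} (ht : |t| < T) :
    HasDerivAt (fun τ => ∫ p in orbitInt a m, F (τ, p))
      (∫ p in orbitInt a m, fderiv ℝ F (t, p) dirT) t := by
  have hm := (isOpen_orbitInt a m).measurableSet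
  obtain ⟨C, hC, hb⟩ := (hF.bddT.mono hn) T r₁ r₂ hr
  have hK : MeasurableSet (Icc r₁ r₂ ×ˢ Ioo 0 Real.pi) := measurableSet_Icc.prod measurableSet_Ioo
  have hfin : volume (Icc r₁ r₂ ×ˢ Ioo 0 Real.pi) < ⊤ := by
    rw [Measure.volume_eq_prod, Measure.prod_prod]
    exact ENNReal.mul_lt_top measure_Icc_lt_top measure_Ioo_lt_top
  have hg : Integrable (indicator (Icc r₁ r₂ ×ˢ Ioo 0 Real.pi) fun _ => C) :=
    (integrable_indicator_iff hK).2 (integrableOn_const hfin.ne)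
  have hN : Ioo (-T) T ∈ nhds t := Ioo_mem_nhds (abs_lt.1 ht).1 (abs_lt.1 ht).2
  have hT : ∀ τ ∈ Ioo (-T) T, |τ| ≤ T := fun τ hτ => (abs_lt.2 ⟨hτ.1, hτ.2⟩).le
  have hder : ∀ p ∈ orbitInt a m, ∀ τ, HasDerivAt (fun τ => F (τ, p))
      (fderiv ℝ F (τ, p) dirT) τ := fun p hp τ =>
    hasDerivAt_dirT (hF.diff (z := (τ, p)) ⟨mem_univ _, hp⟩)
  refine (hasDerivAt_integral_of_dominated_loc_of_deriv_le
    (F' := fun τ p => fderiv ℝ F (τ, p) dirT) hN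
    (Filter.Eventually.of_forall fun τ =>
      (hF.smooth_slice τ).continuousOn.aestronglyMeasurable hm)
    (hF.integrable hn t hr (hs t ht.le))
    (ContinuousOn.aestronglyMeasurable ?_ hm) ?_ hg.integrableOn ?_).2
  · exact (contDiffOn_fderiv_dir hF.smooth dirT).continuousOn.comp
      (f := fun p : ℝ × ℝ => (t, p)) (by fun_prop) fun p hp => ⟨mem_univ _, hp⟩
  · filter_upwards [ae_restrict_mem hm] with p hp τ hτ
    by_cases hpr : p.1 ∈ Icc r₁ r₂
    · rw [indicator_of_mem (show p ∈ Icc r₁ r₂ ×ˢ Ioo 0 Real.pi from ⟨hpr, hp.2⟩)]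
      simpa using hb τ p (hT τ hτ) hp hpr
    -- The support bound is uniform in time, so off the strip F vanishes for all nearby times and
    -- its t-derivative is zero.
    · rw [indicator_of_notMem (fun hc => hpr hc.1), norm_le_zero_iff]
      refine (hder p hp τ).unique ((hasDerivAt_const τ (0 : ℝ)).congr_of_eventuallyEq ?_)
      filter_upwards [Ioo_mem_nhds hτ.1 hτ.2] with τ' hτ' using hs τ' (hT τ' hτ') p hp hpr
  · filter_upwards [ae_restrict_mem hm] with p hp τ _ using hder p hp τ

/-! ### Energy estimate in light cones. -/

section Propagation
variable {a m : ℝ} {x : ℝ → PhasePt}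

theorem ax_coneCut {T ρ₀ σ : ℝ} : Ax a m 0 (coneCut a m T ρ₀ σ) :=
  ax_zero (contDiff_coneCut a m T ρ₀ σ).contDiffOn

theorem AxState.currentS_r (hx : AxState a m x) (h : |a| < m) (s : ℝ) :
    Ax a m 1 (fun z => (currentS a m s (x z.1) z.2).1) := by
  refine ((((ax_coR h).mul (ax_coK h)).mul ((hx.u.mul (hx.yEtaR (s := s) h)).add
    (hx.v.mul (hx.yLamR (s := s) h)))).neg.mono (by norm_num)).congr fun z hz => ?_
  simp only [currentS_eq h s _ hz.2]

theorem AxState.currentS_th (hx : AxState a m x) (h : |a| < m) (s : ℝ) :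
    Ax a m 1 (fun z => (currentS a m s (x z.1) z.2).2) := by
  refine ((((ax_coTh h).mul (ax_coK h)).mul ((hx.u.mul (hx.yEtaTh (s := s) h)).add
    (hx.v.mul (hx.yLamTh (s := s) h)))).neg.mono (by norm_num)).congr fun z hz => ?_
  simp only [currentS_eq h s _ hz.2]

theorem suppIn_coneCut (h : |a| < m) {T ρ₀ σ t Y : ℝ} (hρ₀ : 0 < ρ₀) (h0 : 0 ≤ T - σ * t)
    (hY : T - σ * t ≤ m * Y) : SuppIn a m (rPlus a m + ρ₀ * Real.exp (-Y))
      (rPlus a m + ρ₀ * Real.exp Y) fun p => coneCut a m T ρ₀ σ (t, p) := by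
  have hm : 0 < m := lt_of_le_of_lt (abs_nonneg a) h
  intro p hp hpr
  refine expNegInvGlue.zero_of_nonpos (not_lt.1 fun hc => hpr ?_)
  have := mem_Icc_of_cone_pos hρ₀ (div_nonneg h0 hm.le) ((div_le_iff₀' hm).2 hY) hc
  exact ⟨by linarith [this.1], by linarith [this.2]⟩

/-- The energy in a light cone. -/
def coneEnergy (a m : ℝ) (x : ℝ → PhasePt) (T ρ₀ σ t : ℝ) : ℝ :=
  ∫ p in orbitInt a m, coneCut a m T ρ₀ σ (t, p) * altDensity a m (1 / 2) (x t) p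

theorem half_mem : (1 / 2 : ℝ) ∈ Icc (0 : ℝ) 1 := by norm_num

/-- The energy in a light cone does not increase. -/
theorem IsFlow.hasDerivAt_coneEnergy (h : |a| < m) (hx : IsFlow a m x) {T ρ₀ σ t : ℝ}
    (hρ₀ : 0 < ρ₀) (hσ : |σ| = 1) (ht : |t| < T) :
    ∃ c, HasDerivAt (coneEnergy a m x T ρ₀ σ) c t ∧ σ * c ≤ 0 := by
  have hm : 0 < m := lt_of_le_of_lt (abs_nonneg a) h
  have hO := isOpen_orbitInt a m
  have hax := hx.axState
  have hσt : ∀ t, |t| ≤ T → 0 ≤ T - σ * t ∧ T - σ * t ≤ m * (2 * T / m) := fun t ht => by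
    have : |σ * t| ≤ T := by rw [abs_mul, hσ, one_mul]; exact ht
    rw [mul_div_cancel₀ _ hm.ne']
    constructor <;> linarith [(abs_le.1 this).1, (abs_le.1 this).2]
  set r₁ := rPlus a m + ρ₀ * Real.exp (-(2 * T / m))
  set r₂ := rPlus a m + ρ₀ * Real.exp (2 * T / m)
  have hr : rPlus a m < r₁ := by simp only [r₁]; linarith [mul_pos hρ₀ (Real.exp_pos (-(2 * T / m)))]
  have hsupp : ∀ t, |t| ≤ T → SuppIn a m r₁ r₂ fun p => coneCut a m T ρ₀ σ (t, p) :=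
    fun t ht => suppIn_coneCut h hρ₀ (hσt t ht).1 (hσt t ht).2
  set χ := coneCut a m T ρ₀ σ with hχ
  have hE : Ax a m 1 (fun z : ℝ × (ℝ × ℝ) => χ z * altDensity a m (1 / 2) (x z.1) z.2) := by
    simpa using ax_coneCut.mul (hax.altDensity (s := 1 / 2) h)
  have hd := hE.hasDerivAt_integral zero_le_one hr
    (fun t ht p hp hpr => mul_eq_zero_of_left (hsupp t ht p hp hpr) _) ht
  refine ⟨_, hd, ?_⟩
  set J := currentS a m (1 / 2) (x t) with hJ
  -- The divergence of χJ integrates to zero. Adding it to ∂_t(χe) cancels the terms with χ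
  -- undifferentiated, so the sign can be checked pointwise on the terms with derivatives of χ.
  set V : ℝ → ℝ × ℝ → ℝ × ℝ := fun t p => χ (t, p) • currentS a m (1 / 2) (x t) p
  have hV1 : Ax a m 1 fun z => (V z.1 z.2).1 := by
    simpa [V] using ax_coneCut.mul (hax.currentS_r h (1 / 2))
  have hV2 : Ax a m 1 fun z => (V z.1 z.2).2 := by
    simpa [V] using ax_coneCut.mul (hax.currentS_th h (1 / 2))
  obtain ⟨i2, i2'⟩ := Ax.integral_dvg hV1 hV2 t (r₂ := r₂) hr
    (fun p hp hpr => by simp [V, hsupp t ht.le p hp hpr])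
    (fun p hp hpr => by simp [V, hsupp t ht.le p hp hpr])
  have i1 : IntegrableOn (fun p => fderiv ℝ (fun z : ℝ × (ℝ × ℝ) =>
      χ z * altDensity a m (1 / 2) (x z.1) z.2) (t, p) dirT) (orbitInt a m) := by
    obtain ⟨C, -, hC⟩ := hE.bddT.slice zero_le_one t (r₂ := r₂) hr
    refine integrableOn_of_bounded (r₁ := r₁) (r₂ := r₂) ?_ (fun p hp hpr => ?_) hC
    · exact (contDiffOn_fderiv_dir hE.smooth dirT).continuousOn.comp
        (f := fun p : ℝ × ℝ => (t, p)) (by fun_prop) fun p hp => ⟨mem_univ _, hp⟩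
    · refine (hasDerivAt_dirT (hE.diff (z := (t, p)) ⟨mem_univ _, hp⟩)).unique
        ((hasDerivAt_const t (0 : ℝ)).congr_of_eventuallyEq ?_)
      filter_upwards [Ioo_mem_nhds (abs_lt.1 ht).1 (abs_lt.1 ht).2] with τ hτ
      exact mul_eq_zero_of_left (hsupp τ (abs_lt.2 ⟨hτ.1, hτ.2⟩).le p hp hpr) _
  have i3 := integral_add i1 i2
  rw [i2', add_zero] at i3
  rw [← i3, ← integral_const_mul]
  refine setIntegral_nonpos hO.measurableSet fun p hp => ?_
  set y := (T - σ * t) / m with hy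
  set ρ := p.1 - rPlus a m with hρ
  have hρ0 : 0 < ρ := sub_pos.2 hp.1
  have hy0 : 0 ≤ y := div_nonneg (hσt t ht.le).1 hm.le
  set f := coneFn m T ρ₀ σ t ρ with hf
  have hcut_t : HasDerivAt (fun τ => χ (τ, p))
      (deriv expNegInvGlue f * (2 * ρ * ρ₀ * (Real.sinh y * (-σ / m)))) t := by
    have h1 : HasDerivAt (fun τ => (T - σ * τ) / m) (-σ / m) t := by
      simpa using (((hasDerivAt_id' t).const_mul σ).const_sub T).div_const m
    have h2 := ((((Real.hasDerivAt_cosh y).comp t h1).const_mul (2 * ρ * ρ₀)).sub_const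
      (ρ ^ 2)).sub_const (ρ₀ ^ 2)
    exact (hasDerivAt_expNegInvGlue f).comp t h2
  have hcut_r : HasDerivAt (fun r => χ (t, (r, p.2)))
      (deriv expNegInvGlue f * (2 * ρ₀ * Real.cosh y - 2 * ρ)) p.1 := by
    have h1 : HasDerivAt (fun r => r - rPlus a m) 1 p.1 := (hasDerivAt_id' p.1).sub_const _
    have h2 : HasDerivAt (fun r => coneFn m T ρ₀ σ t (r - rPlus a m))
        (2 * ρ₀ * Real.cosh y - 2 * ρ) p.1 := by
      have := ((((h1.const_mul 2).mul_const ρ₀).mul_const (Real.cosh y)).sub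
        (h1.pow 2)).sub_const (ρ₀ ^ 2)
      refine this.congr_deriv ?_
      simp only [← hρ]
      push_cast
      ring
    exact (hasDerivAt_expNegInvGlue f).comp p.1 h2
  have hz : (t, p) ∈ stInt a m := ⟨mem_univ _, hp⟩
  have eF := (hasDerivAt_dirT (hE.diff hz)).unique
    (hcut_t.mul (hx.hasDerivAt_altDensity h (1 / 2) t hp))
  have cJ1 := ContDiffOn.diffAt hO ((hax.currentS_r h (1 / 2)).smooth_slice t) hp
  have cJ2 := ContDiffOn.diffAt hO ((hax.currentS_th h (1 / 2)).smooth_slice t) hp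
  have eV : dvg (V t) p = χ (t, p) * dvg J p
      + deriv expNegInvGlue f * (2 * ρ₀ * Real.cosh y - 2 * ρ) * (J p).1 := by
    have e1 : dr (fun p => (V t p).1) p = _ := (hcut_r.mul (hasDerivAt_dr cJ1)).deriv
    have e2 : dth (fun p => (V t p).2) p = _ :=
      ((hasDerivAt_dth cJ2).const_mul (χ (t, p))).deriv
    rw [dvg, dvg, e1, e2]
    ring
  have hpos := altDensity_nonneg h half_mem (x t) hp
  have hflux := abs_currentS_le h half_mem (x t) hp
  have hg := deriv_expNegInvGlue_nonneg f
  have hσσ : σ * σ = 1 := by rw [← abs_mul_abs_self, hσ, one_mul]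
  simp only at eF ⊢
  rw [eF, eV]
  have e3 : σ * (deriv expNegInvGlue f * (2 * ρ * ρ₀ * (Real.sinh y * (-σ / m))) *
        altDensity a m (1 / 2) (x t) p + χ (t, p) * -dvg J p + (χ (t, p) * dvg J p
        + deriv expNegInvGlue f * (2 * ρ₀ * Real.cosh y - 2 * ρ) * (J p).1)) =
      deriv expNegInvGlue f * ((2 * ρ₀ * Real.cosh y - 2 * ρ) * (σ * (J p).1)
        - 2 * ρ * ρ₀ * Real.sinh y / m * altDensity a m (1 / 2) (x t) p) := by
    have : σ * (-σ / m) = -1 / m := by rw [← mul_div_assoc, mul_neg, hσσ]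
    linear_combination (deriv expNegInvGlue f * (2 * ρ * ρ₀ * Real.sinh y) *
      altDensity a m (1 / 2) (x t) p) * this
  refine e3.trans_le ?_
  -- Outside the cone the cut-off has zero derivative; inside, the slope estimate makes the loss of
  -- the cone dominate the radial flux.
  rcases le_or_gt f 0 with hf0 | hf0
  · rw [deriv_expNegInvGlue_of_nonpos hf0, zero_mul]
  refine mul_nonpos_of_nonneg_of_nonpos hg (sub_nonpos.2 ?_)
  have hslope := abs_cone_slope_le hρ0.le hρ₀.le hy0 hf0.le
  set S := 2 * ρ * ρ₀ * Real.sinh y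
  set L := 2 * ρ₀ * Real.cosh y - 2 * ρ
  set e := altDensity a m (1 / 2) (x t) p
  calc L * (σ * (J p).1) ≤ |L * (σ * (J p).1)| := le_abs_self _
    _ = |L| * |(J p).1| := by rw [abs_mul, abs_mul, hσ, one_mul]
    _ ≤ |L| * (ρ * e / m) :=
        mul_le_mul_of_nonneg_left ((le_div_iff₀' hm).2 hflux) (abs_nonneg _)
    _ = ρ * |L| * e / m := by ring
    _ ≤ S * e / m := div_le_div_of_nonneg_right (mul_le_mul_of_nonneg_right hslope hpos) hm.le
    _ = S / m * e := by ring

/-- The sign σ treats future and past together: in the parameter y with t = σy the cone energy is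
nonnegative and nonincreasing, so it stays zero if it starts at zero. -/
theorem IsFlow.coneEnergy_eq_zero (h : |a| < m) (hx : IsFlow a m x) {T ρ₀ σ τ : ℝ}
    (hρ₀ : 0 < ρ₀) (hσ : |σ| = 1) (hτ : 0 ≤ τ) (hτT : τ < T)
    (h0 : coneEnergy a m x T ρ₀ σ 0 = 0) : coneEnergy a m x T ρ₀ σ (σ * τ) = 0 := by
  have hT : ∀ y ∈ Icc 0 τ, |σ * y| < T := fun y hy => by
    rw [abs_mul, hσ, one_mul, abs_of_nonneg hy.1]; exact hy.2.trans_lt hτT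
  have hd : ∀ y ∈ Icc 0 τ, ∃ c, HasDerivAt (fun y => coneEnergy a m x T ρ₀ σ (σ * y)) c y ∧
      c ≤ 0 := fun y hy => by
    obtain ⟨c, hc, hc'⟩ := hx.hasDerivAt_coneEnergy h hρ₀ hσ (hT y hy)
    refine ⟨c * σ, ?_, by linarith⟩
    have h1 : HasDerivAt (fun y => σ * y) σ y := by
      simpa using (hasDerivAt_id' y).const_mul σ
    exact hc.comp y h1
  have hanti : AntitoneOn (fun y => coneEnergy a m x T ρ₀ σ (σ * y)) (Icc 0 τ) := by
    refine antitoneOn_of_deriv_nonpos (convex_Icc _ _) (fun y hy => ?_) (fun y hy => ?_)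
      fun y hy => ?_
    · obtain ⟨c, hc, -⟩ := hd y hy
      exact hc.continuousAt.continuousWithinAt
    · obtain ⟨c, hc, -⟩ := hd y (interior_subset hy)
      exact hc.differentiableAt.differentiableWithinAt
    · obtain ⟨c, hc, hc'⟩ := hd y (interior_subset hy)
      rwa [hc.deriv]
  have hle := hanti (left_mem_Icc.2 hτ) (right_mem_Icc.2 hτ) hτ
  simp only [mul_zero, h0] at hle
  refine le_antisymm hle (setIntegral_nonneg (isOpen_orbitInt a m).measurableSet fun p hp => ?_)
  exact mul_nonneg (expNegInvGlue.nonneg _) (altDensity_nonneg h half_mem _ hp)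

/-- Finite propagation speed. -/
theorem IsFlow.suppIn (h : |a| < m) (hx : IsFlow a m x) {r₁ r₂ : ℝ} (hr : rPlus a m < r₁)
    (h0 : (x 0).SuppIn a m r₁ r₂) (t : ℝ) :
    ∃ r₁' r₂', rPlus a m < r₁' ∧ (x t).SuppIn a m r₁' r₂' := by
  have hm : 0 < m := lt_of_le_of_lt (abs_nonneg a) h
  have hO := isOpen_orbitInt a m
  -- The extra unit keeps the cone open at time t, where T - σt = 1, so that the chosen point lies
  -- in its interior.
  set T := |t| + 1
  set Y := T / m
  have hT0 : 0 < T := by positivity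
  have hY0 : 0 < Y := div_pos hT0 hm
  have hY : Real.exp Y * Real.exp (-Y) = 1 := by rw [← Real.exp_add]; simp
  -- Rates of at most 1/m for log(r - r₊) allow the support to spread by the factors e^{±T/m}.
  set r₁' := rPlus a m + (r₁ - rPlus a m) * Real.exp (-Y)
  set r₂' := rPlus a m + (r₂ - rPlus a m) * Real.exp Y
  have hr' : rPlus a m < r₁' := by
    simp only [r₁']
    linarith [mul_pos (sub_pos.2 hr) (Real.exp_pos (-Y))]
  have key : ∀ p ∈ orbitInt a m, p.1 ∉ Icc r₁' r₂' →
      altDensity a m (1 / 2) (x t) p = 0 := by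
    intro p hp hpr
    obtain ⟨σ, hσ, hσt⟩ : ∃ σ : ℝ, |σ| = 1 ∧ t = σ * |t| := by
      rcases le_total 0 t with ht | ht
      · exact ⟨1, by simp, by rw [abs_of_nonneg ht, one_mul]⟩
      · exact ⟨-1, by simp, by rw [abs_of_nonpos ht]; ring⟩
    set ρ₀ := p.1 - rPlus a m with hρ₀'
    have hρ₀ : 0 < ρ₀ := sub_pos.2 hp.1
    have hsupp := suppIn_coneCut (a := a) h (T := T) (σ := σ) (t := 0) (Y := Y) hρ₀
      (by simpa using hT0.le) (by simp only [Y]; rw [mul_div_cancel₀ _ hm.ne']; simp)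
    -- A point both in the initial support and in the base of the cone would put the chosen radius
    -- between r₁' and r₂'.
    have hinit : coneEnergy a m x T ρ₀ σ 0 = 0 := by
      refine setIntegral_eq_zero_of_forall_eq_zero fun q hq => ?_
      by_cases hq1 : q.1 ∈ Icc r₁ r₂
      · refine mul_eq_zero_of_left (hsupp q hq fun hq2 => hpr ⟨?_, ?_⟩) _
        · have h1 : r₁ - rPlus a m ≤ ρ₀ * Real.exp Y := by linarith [hq1.1, hq2.2]
          have := mul_le_mul_of_nonneg_right h1 (Real.exp_pos (-Y)).le
          rw [mul_assoc, hY, mul_one] at this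
          simp only [r₁']; linarith
        · have h1 : ρ₀ * Real.exp (-Y) ≤ r₂ - rPlus a m := by linarith [hq1.2, hq2.1]
          have := mul_le_mul_of_nonneg_right h1 (Real.exp_pos Y).le
          rw [mul_assoc, mul_comm (Real.exp (-Y)), hY, mul_one] at this
          simp only [r₂']; linarith
      · exact mul_eq_zero_of_right _ (h0.altDensity h _ q hq hq1)
    have hend := hx.coneEnergy_eq_zero h hρ₀ hσ (abs_nonneg t) (lt_add_one |t|) hinit
    rw [← hσt] at hend
    have hE : Ax a m 1 (fun z : ℝ × (ℝ × ℝ) => coneCut a m T ρ₀ σ z *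
        altDensity a m (1 / 2) (x z.1) z.2) := by
      simpa using ax_coneCut.mul (hx.axState.altDensity (s := 1 / 2) h)
    have hσt1 : T - σ * t = 1 := by
      have : σ * σ = 1 := by rw [← abs_mul_abs_self, hσ, one_mul]
      simp only [T]
      rw [hσt, ← mul_assoc, this, abs_mul, hσ]
      simp
    have hint := hE.integrable zero_le_one t
      (r₁ := rPlus a m + ρ₀ * Real.exp (-(1 / m))) (r₂ := rPlus a m + ρ₀ * Real.exp (1 / m))
      (by linarith [mul_pos hρ₀ (Real.exp_pos (-(1 / m)))]) fun q hq hqr =>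
        mul_eq_zero_of_left (suppIn_coneCut h hρ₀ (by rw [hσt1]; exact zero_le_one)
          (by rw [hσt1, mul_div_cancel₀ _ hm.ne']) q hq hqr) _
    have hae := (setIntegral_eq_zero_iff_of_nonneg_ae
      (ae_restrict_of_forall_mem hO.measurableSet fun q hq => mul_nonneg
        (expNegInvGlue.nonneg _) (altDensity_nonneg h half_mem (x t) hq)) hint).1 hend
    have hz := Measure.eqOn_open_of_ae_eq hae hO (hE.smooth_slice t).continuousOn
      continuousOn_const hp
    -- At the chosen radius the cone function equals 2ρ₀²(cosh(1/m) - 1) > 0, so the cut-off is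
    -- positive and the energy density must vanish.
    refine (mul_eq_zero.1 hz).resolve_left (expNegInvGlue.pos_of_pos ?_).ne'
    rw [coneFn, hσt1]
    simp only [← hρ₀']
    have hc : 1 < Real.cosh (1 / m) := Real.one_lt_cosh.2 (by positivity)
    nlinarith [mul_pos hρ₀ hρ₀]
  -- At s = 1/2 the mass term is present, so a vanishing density gives λ = η = 0 pointwise besides u
  -- = v = 0.
  have key' := fun p hp hpr => eq_zero_of_polar_self h half_mem hp (key p hp hpr)
  refine ⟨r₁', r₂', hr', fun p hp hpr => ?_, fun p hp hpr => ?_, fun p hp hpr => ?_,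
    fun p hp hpr => ?_⟩
  · exact ((key' p hp hpr).2.2.2.2.2.2 (by norm_num)).1
  · exact (key' p hp hpr).2.1
  · exact ((key' p hp hpr).2.2.2.2.2.2 (by norm_num)).2
  · exact (key' p hp hpr).1

end Propagation


/-! ### The phase-space curve of a Maxwell field -/

theorem smoothCompact_of_suppIn {a m r₁ r₂ : ℝ} {f : ℝ × ℝ → ℝ} (hr : rPlus a m < r₁)
    (hf : ContDiffOn ℝ ∞ f (orbit a m)) (h0 : ZeroOnAxis a m f) (hs : SuppIn a m r₁ r₂ f) :
    SmoothCompact a m f := by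
  refine ⟨hf, r₁, r₂, hr, fun p hp hpr => ?_⟩
  rcases eq_or_lt_of_le hp.2.1 with h1 | h1
  · rw [show p = (p.1, 0) from Prod.ext rfl h1.symm]
    exact (h0 p.1 hp.1).1
  rcases eq_or_lt_of_le hp.2.2 with h2 | h2
  · rw [show p = (p.1, Real.pi) from Prod.ext rfl h2]
    exact (h0 p.1 hp.1).2
  exact hs p ⟨hp.1, h1, h2⟩ hpr

/-- Compactly supported data evolve inside the phase space. -/
theorem IsFlow.inPhaseSpace {a m : ℝ} (h : |a| < m) {x : ℝ → PhasePt} (hx : IsFlow a m x)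
    {r₁ r₂ : ℝ} (hr : rPlus a m < r₁) (h0 : (x 0).SuppIn a m r₁ r₂) (t : ℝ) :
    InPhaseSpace a m (x t) := by
  obtain ⟨ρ₁, ρ₂, hρ, hs⟩ := hx.suppIn h hr h0 t
  exact ⟨smoothCompact_of_suppIn hρ (smooth_slice_orbit hx.smooth_lam t) (hx.lam_axis t) hs.lam,
    smoothCompact_of_suppIn hρ (smooth_slice_orbit hx.smooth_v t) (hx.v_axis t) hs.v,
    smoothCompact_of_suppIn hρ (smooth_slice_orbit hx.smooth_eta t) (hx.eta_axis t) hs.eta,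
    smoothCompact_of_suppIn hρ (smooth_slice_orbit hx.smooth_u t) (hx.u_axis t) hs.u,
    hx.lam_axis t, hx.eta_axis t, hx.v_axis t, hx.u_axis t, hx.lam_normal t, hx.eta_normal t⟩

theorem eq_zero_of_fderiv_dirTh {a m : ℝ} {f : ℝ × (ℝ × ℝ) → ℝ}
    (hf : ContDiffOn ℝ ∞ f (stOrb a m)) {t r : ℝ} (hr : rPlus a m < r) (h0 : f (t, (r, 0)) = 0)
    (hd : ∀ θ ∈ Ioo 0 Real.pi, fderiv ℝ f (t, (r, θ)) dirTh = 0) {θ : ℝ}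
    (hθ : θ ∈ Ioo 0 Real.pi) : f (t, (r, θ)) = 0 := by
  obtain ⟨c, hc, he⟩ := exists_hasDerivAt_eq_slope (fun θ => f (t, (r, θ))) (fun _ => 0) hθ.1
    (hf.continuousOn.comp (f := fun θ : ℝ => (t, (r, θ))) (by fun_prop)
      fun y hy => ⟨mem_univ _, hr, hy.1, hy.2.trans hθ.2.le⟩) fun y hy => by
      have hy' : y ∈ Ioo 0 Real.pi := ⟨hy.1, hy.2.trans hθ.2⟩
      have := hasDerivAt_dirTh (differentiableAt_of_stInt (hf.mono (stInt_subset_stOrb a m))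
        (z := (t, (r, y))) ⟨mem_univ _, hr, hy'⟩)
      rwa [hd y hy'] at this
  rw [eq_comm, div_eq_zero_iff] at he
  have := he.resolve_right (by linarith [hθ.1])
  linarith

section Axisymmetric
variable {a m : ℝ} {A : (Fin 4 → ℝ) → Fin 4 → ℝ} {η : ℝ → ℝ × ℝ → ℝ}

/-- Where the Faraday tensor vanishes on a sphere, so does the phase-space point. -/
theorem phaseCurve_eq_zero (h : |a| < m) (hA : IsAxisymMaxwell a m A)
    (hη : IsElectricTwist a m A η) {t r : ℝ} (hr : rPlus a m < r)
    (hF : ∀ θ ∈ Ioo 0 Real.pi, ∀ μ ν, faraday A μ ν (lift t (r, θ)) = 0) {θ : ℝ}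
    (hθ : θ ∈ Ioo 0 Real.pi) :
    (phaseCurve a m A η t).lam (r, θ) = 0 ∧ (phaseCurve a m A η t).v (r, θ) = 0 ∧
    (phaseCurve a m A η t).eta (r, θ) = 0 ∧ (phaseCurve a m A η t).u (r, θ) = 0 := by
  have hx := isFlow_phaseCurve h hA hη
  have hE := hη.isPot h hA
  have hU : ∀ θ ∈ Ioo 0 Real.pi, ∀ μ ν, faradayUp a m A μ ν (lift t (r, θ)) = 0 :=
    fun θ hθ μ ν => by simp [faradayUp, hF θ hθ]
  refine ⟨?_, ?_, ?_, hF θ hθ 1 2⟩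
  · refine eq_zero_of_fderiv_dirTh hx.smooth_lam hr (hx.lam_axis t r hr).1 (fun y hy => ?_) hθ
    exact (faraday_three h hA (z := (t, (r, y))) ⟨mem_univ _, hr, hy⟩).2.2.symm.trans (hF y hy 2 3)
  · exact neg_eq_zero.2 (hU θ hθ 0 3)
  · refine eq_zero_of_fderiv_dirTh hx.smooth_eta hr (hx.eta_axis t r hr).1 (fun y hy => ?_) hθ
    have hz : (t, (r, y)) ∈ stInt a m := ⟨mem_univ _, hr, hy⟩
    exact (hE.fderiv_dirTh hz).trans ((sl_faradayUp_zero_one h hA hz).symm.trans (hU y hy 0 1))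

theorem inPhaseSpace_phaseCurve (h : |a| < m) (hA : IsAxisymMaxwell a m A)
    (hη : IsElectricTwist a m A η) (t : ℝ) : InPhaseSpace a m (phaseCurve a m A η t) := by
  obtain ⟨r₁, r₂, hr, hc⟩ := hA.compact_data
  have key := fun p (hp : p ∈ orbitInt a m) (hpr : p.1 ∉ Icc r₁ r₂) =>
    phaseCurve_eq_zero h hA hη (t := 0) hp.1 (fun θ hθ =>
      hc (lift 0 (p.1, θ)) (lift_mem_blChart (p := (p.1, θ)) ⟨hp.1, hθ⟩) rfl hpr) hp.2
  exact (isFlow_phaseCurve h hA hη).inPhaseSpace h hr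
    ⟨fun p hp hpr => (key p hp hpr).1, fun p hp hpr => (key p hp hpr).2.1,
      fun p hp hpr => (key p hp hpr).2.2.1, fun p hp hpr => (key p hp hpr).2.2.2⟩ t

theorem faraday_eq_lift (h : |a| < m) (hA : IsAxisymMaxwell a m A) (μ ν : Fin 4) {q : Fin 4 → ℝ}
    (hq : q ∈ blChart a m) : faraday A μ ν q = faraday A μ ν (lift (q 0) (q 1, q 2)) := by
  rw [← faraday_update_three h hA μ ν hq 0]
  congr 1
  funext i
  fin_cases i <;> simp [lift]

/-- F_{rθ} is u, F_{tφ} is a multiple of v, and F_{rφ}, F_{θφ} are derivatives of λ. `f01_eq` and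
`f02_eq` recover F_{tr} and F_{tθ} from derivatives of η and λ. Conversely λ and η are obtained by
integrating F and 𝔈^r in θ from the axis. -/
theorem vanishes_iff (h : |a| < m) (hA : IsAxisymMaxwell a m A) (hη : IsElectricTwist a m A η)
    (t : ℝ) : (phaseCurve a m A η t).Vanishes a m ↔ FieldVanishesAt a m A t := by
  have hx := isFlow_phaseCurve h hA hη
  have hE := hη.isPot h hA
  constructor
  · intro hv q hq hqt
    have hp : (q 1, q 2) ∈ orbitInt a m := mem_orbitInt_of_blChart hq
    have hz : (t, (q 1, q 2)) ∈ stInt a m := ⟨mem_univ _, hp⟩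
    have h0 := fun p (hp : p ∈ orbitInt a m) => hv p (orbitInt_subset_orbit a m hp)
    have dr0 : ∀ {f : ℝ × (ℝ × ℝ) → ℝ}, ContDiffOn ℝ ∞ f (stOrb a m) →
        (∀ p ∈ orbitInt a m, f (t, p) = 0) → fderiv ℝ f (t, (q 1, q 2)) dirR = 0 ∧
          fderiv ℝ f (t, (q 1, q 2)) dirTh = 0 := fun hf hf0 => by
      have hi := hf.mono (stInt_subset_stOrb a m)
      rw [← slice_dr hi hz, ← slice_dth hi hz, dr_congr (g := fun _ => 0) (fun p hp => hf0 p hp) hp,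
        dth_congr (g := fun _ => 0) (fun p hp => hf0 p hp) hp]
      simp [dr, dth]
    obtain ⟨l1, l2⟩ := dr0 hx.smooth_lam fun p hp => (h0 p hp).1
    obtain ⟨e1, e2⟩ := dr0 hE.smooth fun p hp => (h0 p hp).2.2.1
    have l0 := hx.lam_dt _ hz
    obtain ⟨f03, f13, f23⟩ := faraday_three h hA hz
    have f12 : faraday A 1 2 (lift t (q 1, q 2)) = 0 := (h0 _ hp).2.2.2
    have f01 : faraday A 0 1 (lift t (q 1, q 2)) = 0 :=
      (f01_eq h hE hz).trans (by
        beta_reduce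
        rw [e2, show fderiv ℝ (sl fun q => blPot A q 3) (t, (q 1, q 2)) dirR = 0 from l1]; ring)
    have f02 : faraday A 0 2 (lift t (q 1, q 2)) = 0 :=
      (f02_eq h hE hz).trans (by
        beta_reduce
        rw [e1, show fderiv ℝ (sl fun q => blPot A q 3) (t, (q 1, q 2)) dirTh = 0 from l2]; ring)
    have f03' : faraday A 0 3 (lift t (q 1, q 2)) = 0 :=
      f03.trans (l0.trans (mul_eq_zero_of_right _ (h0 _ hp).2.1))
    have f13' : faraday A 1 3 (lift t (q 1, q 2)) = 0 := f13.trans l1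
    have f23' : faraday A 2 3 (lift t (q 1, q 2)) = 0 := f23.trans l2
    have flip : ∀ {μ ν}, faraday A μ ν (lift t (q 1, q 2)) = 0 →
        faraday A ν μ (lift t (q 1, q 2)) = 0 := fun hμν => by
      rw [faraday_antisymm, hμν, neg_zero]
    intro μ ν
    rw [faraday_eq_lift h hA μ ν hq, hqt]
    fin_cases μ <;> fin_cases ν
    exacts [faraday_self A _ _, f01, f02, f03', flip f01, faraday_self A _ _, f12, f13', flip f02,
      flip f12, faraday_self A _ _, f23', flip f03', flip f13', flip f23', faraday_self A _ _]
  · intro hF p hp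
    rcases eq_or_lt_of_le hp.2.1 with h1 | h1
    · rw [show p = (p.1, 0) from Prod.ext rfl h1.symm]
      exact ⟨(hx.lam_axis t p.1 hp.1).1, (hx.v_axis t p.1 hp.1).1, (hx.eta_axis t p.1 hp.1).1,
        (hx.u_axis t p.1 hp.1).1⟩
    rcases eq_or_lt_of_le hp.2.2 with h2 | h2
    · rw [show p = (p.1, Real.pi) from Prod.ext rfl h2]
      exact ⟨(hx.lam_axis t p.1 hp.1).2, (hx.v_axis t p.1 hp.1).2, (hx.eta_axis t p.1 hp.1).2,
        (hx.u_axis t p.1 hp.1).2⟩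
    exact phaseCurve_eq_zero h hA hη hp.1 (fun θ hθ =>
      hF (lift t (p.1, θ)) (lift_mem_blChart (p := (p.1, θ)) ⟨hp.1, hθ⟩) rfl) ⟨h1, h2⟩

end Axisymmetric

end KerrMaxwell

end

/-! ### Assembly of the three claims. -/

theorem mainTheorem1 (a m : ℝ) (ham : |a| < m) :
    (∀ s ∈ Set.Icc (0 : ℝ) 1, ∀ x : PhasePt, InPhaseSpace a m x →
      (∀ p ∈ orbitInt a m,
        altDensity a m s x p = subDensity a m s x p - dvg (robinsonFlux a m s x) p ∧
        0 ≤ altDensity a m s x p) ∧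
      MeasureTheory.IntegrableOn (altDensity a m s x) (orbitInt a m) ∧
      0 ≤ HAlt a m s x ∧
      (HAlt a m s x = 0 ↔ x.Vanishes a m) ∧
      IsVarGrad a m (HAlt a m s) x (hamGrad a m x)) ∧
    (∀ s ∈ Set.Icc (0 : ℝ) 1, ∀ τ ∈ Set.Icc (0 : ℝ) 1, ∀ x : PhasePt, InPhaseSpace a m x →
      HasPoissonBracket a m (HAlt a m s) (HAlt a m τ) x 0) ∧
    (∀ A : (Fin 4 → ℝ) → Fin 4 → ℝ, IsAxisymMaxwell a m A →
      (∃ η : ℝ → ℝ × ℝ → ℝ, IsElectricTwist a m A η) ∧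
      ∀ η : ℝ → ℝ × ℝ → ℝ, IsElectricTwist a m A η →
        (∀ t, InPhaseSpace a m (phaseCurve a m A η t)) ∧
        ∀ s ∈ Set.Icc (0 : ℝ) 1,
          (∀ t, HamiltonEqs a m (HAlt a m s) (phaseCurve a m A η) t) ∧
          (∀ t, ∀ p ∈ orbitInt a m, spacetimeDiv a m s (phaseCurve a m A η) t p = 0) ∧
          (∀ t,
            MeasureTheory.IntegrableOn (currentT a m s (phaseCurve a m A η t)) (orbitInt a m) ∧
            0 ≤ flux a m s (phaseCurve a m A η t) ∧
            (flux a m s (phaseCurve a m A η t) = 0 ↔ FieldVanishesAt a m A t))) := by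
  refine ⟨fun s hs x hx => ⟨fun p hp => ⟨robinson_identity ham s hx.smoothInt hp,
      altDensity_nonneg ham hs x hp⟩, hx.integrable_altDensity ham s, HAlt_nonneg ham hs x,
      HAlt_eq_zero_iff ham hs hx, isVarGrad_HAlt ham s hx⟩,
    fun s _ τ _ x hx => hasPoissonBracket_HAlt ham s τ hx, fun A hA => ⟨?_, fun η hη => ?_⟩⟩
  · obtain ⟨η, hη⟩ := exists_isPot ham hA
    exact ⟨_, hη.isElectricTwist ham hA⟩
  · have hx := isFlow_phaseCurve ham hA hη
    have hX := inPhaseSpace_phaseCurve ham hA hη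
    exact ⟨hX, fun s hs => ⟨fun t => hx.hamiltonEqs ham s (hX t),
      fun t p hp => hx.spacetimeDiv_eq_zero ham s t hp,
      fun t => ⟨(hX t).integrable_altDensity ham s, HAlt_nonneg ham hs _,
        (HAlt_eq_zero_iff ham hs (hX t)).trans (vanishes_iff ham hA hη t)⟩⟩⟩
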